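/- Setup. Let $E$ be a Euclidean space with scalar product $(\cdot,\cdot)$, $\Phi\subset E$ an irreducible reduced (crystallographic) root system spanning $E$, with coroots $\alpha^\vee=2\alpha/\|\alpha\|^2$, Weyl group $W$, base $\{\alpha_1,\dots,\alpha_r\}$, simple reflections $s_i=s_{\alpha_i}$, fundamental weights $\varpi_i$, weight lattice $P$ and root lattice $Q$. Let $\mathbf Q:P\to\mathbb Q$ be a nonzero $W$-invariant quadratic form with integral values on $Q$, let $\mathbf B(\lambda,\mu)=\mathbf Q(\lambda+\mu)-\mathbf Q(\lambda)-\mathbf Q(\mu)$, and let $n\ge 1$ be an integer. For $\alpha\in\Phi$ put $m(\alpha)=n/\gcd(n,\mathbf Q(\alpha))$ and $\alpha^m=m(\alpha)\alpha$; these form a root system $\Phi^m$, with coroots $\alpha^{m\vee}=m(\alpha)^{-1}\alpha^\vee$ and weight lattice $P^m\subseteq P$. Let $\mathrm{size}(\alpha^m)\in\{sh,lg\}$ be the length of $\alpha^m$ in $\Phi^m$ (all roots are long if they have the same length). For $s\ge1$ and $t\in\mathbb Z$ let $\mathbf r_s(t)\in\{0,\dots,s-1\}$ be the remainder of $t$ modulo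 $s$, and for $\lambda\in P$ put $\mathbf r(\lambda)=\sum_i \mathbf r_{m(\alpha_i)}((\lambda,\alpha_i^\vee))\varpi_i$ and $\mathbf q(\lambda)=\lambda-\mathbf r(\lambda)\in P^m$. Let $\mathbf k:\Phi\to\mathbb C^\times$ be $W$-invariant, $\mathbf k_i=\mathbf k_{\alpha_i}$, with value $\mathbf k_y$ at the roots $\alpha$ with $\mathrm{size}(\alpha^m)=y$. Let $g_j(y)\in\mathbb C^\times$ ($j\in\mathbb Z$, $y\in\{sh,lg\}$) satisfy $g_j(y)=-1$ if $n\mid j$, $g_j(y)=g_{\mathbf r_n(j)}(y)$, and $g_j(y)g_{n-j}(y)=\mathbf k_y^{-2}$ if $n\nmid j$ (the last condition for the lengths $y$ that occur). Let $\mathbb C(P)$ be the quotient field of the group algebra $\mathbb C[P]=\mathrm{span}\{x^\lambda\}_{\lambda\in P}$, with $W$ acting by field automorphisms, $w(x^\lambda)=x^{w\lambda}$. For a subgroup $L\subseteq P$ let $\mathbb C(L)\subseteq\mathbb C(P)$ be the subfield generated over $\mathbb C$ by the $x^\lambda$, $\lambda\in L$; for $W$-stable $L$ let $W\ltimes\mathbb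 C(L)$ be the semidirect product algebra. Statement. (i) There is a unique $\mathbb C$-algebra homomorphism $\sigma:W\ltimes\mathbb C(P^m)\to\mathrm{End}_{\mathbb C}(\mathbb C(P))$ such that $$\sigma(s_i)(fx^\lambda)=\frac{(1-\mathbf k_i^2)\,x^{(\mathbf q(-\lambda),\alpha_i^{m\vee})\alpha_i^m}}{1-\mathbf k_i^2x^{\alpha_i^m}}(s_if)x^\lambda+\mathbf k_i^2\,g_{\mathbf Q(\alpha_i)-\mathbf B(\lambda,\alpha_i)}(\mathrm{size}(\alpha_i^m))\frac{1-x^{-\alpha_i^m}}{1-\mathbf k_i^2x^{\alpha_i^m}}(s_if)x^{\alpha_i+s_i\lambda},\qquad \sigma(g)(fx^\lambda)=gfx^\lambda \tag{1}$$ for all $f,g\in\mathbb C(P^m)$, $\lambda\in P$, $i=1,\dots,r$. (ii) Let $\Lambda$ be a lattice with $Q\subseteq\Lambda\subseteq P$ and $\Lambda_0=\Lambda\cap P^m$. Then $\mathbb C(\Lambda)$ is stable under the restriction of $\sigma$ to $W\ltimes\mathbb C(\Lambda_0)\subseteq W\ltimes\mathbb C(P^m)$. The resulting representation $\sigma_\Lambda:W\ltimes\mathbb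 C(\Lambda_0)\to\mathrm{End}_{\mathbb C}(\mathbb C(\Lambda))$ satisfies the formulas (1) for all $f,g\in\mathbb C(\Lambda_0)$, $\lambda\in\Lambda$, $i=1,\dots,r$, and is the only $\mathbb C$-algebra homomorphism that does. (iii) Suppose that $\mathbf k$ is constant and that $g_j:=g_j(sh)=g_j(lg)$ for all $j$, and put $v=\mathbf k^2$. Then the restriction of $\sigma_\Lambda$ to $W$ is exactly the Chinta–Gunnells action: it is the unique representation of $W$ on $\mathbb C(\Lambda)$ for which $$s_i\cdot(fx^\lambda)=\frac{(s_if)x^{s_i\lambda}}{1-vx^{m(\alpha_i)\alpha_i}}\Bigl[x^{-\mathbf r_{m(\alpha_i)}\left(-\mathbf B(\lambda,\alpha_i)/\mathbf Q(\alpha_i)\right)\alpha_i}(1-v)-v\,g_{\mathbf Q(\alpha_i)-\mathbf B(\lambda,\alpha_i)}\,x^{(1-m(\alpha_i))\alpha_i}\bigl(1-x^{m(\alpha_i)\alpha_i}\bigr)\Bigr] \tag{2}$$ for all $f\in\mathbb C(\Lambda_0)$, $\lambda\in\Lambda$, $i=1,\dots,r$. (iv) Consequently, for all $v\in\mathbb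 C^\times$ and $g_j\in\mathbb C^\times$ ($j\in\mathbb Z$) with $g_j=-1$ if $n\mid j$, $g_j=g_{\mathbf r_n(j)}$, and $g_jg_{n-j}=v^{-1}$ if $n\nmid j$, and for every lattice $Q\subseteq\Lambda\subseteq P$, the Chinta–Gunnells formulas (2) define a (unique) representation of $W$ on $\mathbb C(\Lambda)$. -/

import Mathlib

open scoped InnerProductSpace

noncomputable section

namespace Metaplectic

section RootSystem

variable {ι E F : Type*} [NormedAddCommGroup E] [InnerProductSpace ℝ E]
  [AddCommGroup F] [Module ℝ F] (R : RootPairing ι ℝ E F)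

/-- The pairing between the weight space and the coroots is the one given by the scalar product
of the Euclidean space `E`: `(x, α^∨) = 2 (α, x) / (α, α)`. -/
def IsEuclidean : Prop :=
  ∀ (i : ι) (x : E),
    R.toLinearMap x (R.coroot i) = 2 * ⟪R.root i, x⟫_ℝ / ⟪R.root i, R.root i⟫_ℝ

/-- The Weyl group `W`. -/
abbrev W : Type _ := R.weylGroup

/-- The weight lattice `P`: all `x` in `E` with `(x, α^∨) ∈ ℤ` for all roots `α`. -/
def weightLattice : AddSubgroup E where
  carrier := {x | ∀ i : ι, ∃ z : ℤ, R.toLinearMap x (R.coroot i) = z}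
  zero_mem' := fun i => ⟨0, by simp⟩
  add_mem' := fun {x y} hx hy i => by
    obtain ⟨a, ha⟩ := hx i
    obtain ⟨c, hc⟩ := hy i
    exact ⟨a + c, by simp [ha, hc]⟩
  neg_mem' := fun {x} hx i => by
    obtain ⟨a, ha⟩ := hx i
    exact ⟨-a, by simp [ha]⟩

/-- The integer `(lam, α^∨)`, for a weight `lam` and a root `α`. -/
def pair (lam : weightLattice R) (i : ι) : ℤ :=
  ⌊R.toLinearMap (lam : E) (R.coroot i)⌋

theorem cast_pair (lam : weightLattice R) (i : ι) :
    (pair R lam i : ℝ) = R.toLinearMap (lam : E) (R.coroot i) := by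
  obtain ⟨z, hz⟩ := lam.2 i
  simp [pair, hz]

/-- A root as an element of the weight lattice. -/
def rootP [R.IsCrystallographic] (i : ι) : weightLattice R :=
  ⟨R.root i, fun j => by
    obtain ⟨z, hz⟩ := R.exists_value (S := ℤ) i j
    exact ⟨z, by simpa using hz.symm⟩⟩

/-- The root lattice `Q`, as a subgroup of the weight lattice. -/
def rootLattice [R.IsCrystallographic] : AddSubgroup (weightLattice R) :=
  AddSubgroup.closure (Set.range (rootP R))

theorem smul_mem_weightLattice (w : W R) {x : E} (hx : x ∈ weightLattice R) :
    w • x ∈ weightLattice R := by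
  obtain ⟨w, hw⟩ := w
  change w • x ∈ weightLattice R
  induction hw using RootPairing.weylGroup.induction generalizing x with
  | mem i =>
    intro j
    obtain ⟨z, hz⟩ := hx (R.reflectionPerm i j)
    refine ⟨z, ?_⟩
    rw [← hz]
    exact R.coroot'_reflection (i := i) (j := j) x
  | one => simpa using hx
  | mul u v hu hv ihu ihv =>
    rw [mul_smul]
    exact ihu (ihv hx)

/-- The canonical action of `W` on the weight lattice. -/
instance : DistribMulAction (W R) (weightLattice R) where
  smul w lam := ⟨w • (lam : E), smul_mem_weightLattice R w lam.2⟩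
  one_smul _ := Subtype.ext (one_smul _ _)
  mul_smul _ _ _ := Subtype.ext (mul_smul _ _ _)
  smul_zero _ := Subtype.ext (smul_zero _)
  smul_add _ _ _ := Subtype.ext (smul_add _ _ _)

theorem coe_smul (w : W R) (lam : weightLattice R) :
    ((w • lam : weightLattice R) : E) = w • (lam : E) := rfl

theorem smul_sub_mem_rootLattice [R.IsCrystallographic] (w : W R) (lam : weightLattice R) :
    w • lam - lam ∈ rootLattice R := by
  obtain ⟨w, hw⟩ := w
  induction hw using RootPairing.weylGroup.induction generalizing lam with
  | mem i =>
    have h : (RootPairing.weylGroup.ofIdx R i : W R) • lam - lam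
        = -(pair R lam i • rootP R i) := by
      apply Subtype.ext
      change R.reflection i (lam : E) - (lam : E) = -(pair R lam i • R.root i)
      rw [R.reflection_apply, ← Int.cast_smul_eq_zsmul ℝ, cast_pair]
      simp
    change (RootPairing.weylGroup.ofIdx R i : W R) • lam - lam ∈ rootLattice R
    rw [h]
    exact neg_mem (zsmul_mem (AddSubgroup.subset_closure (Set.mem_range_self i)) _)
  | one =>
    have h : (⟨1, one_mem _⟩ : W R) • lam = lam := one_smul (W R) lam
    rw [h, sub_self]
    exact zero_mem _
  | mul u v hu hv ihu ihv =>
    have h : (⟨u * v, mul_mem hu hv⟩ : W R) • lam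
        = (⟨u, hu⟩ : W R) • (⟨v, hv⟩ : W R) • lam :=
      mul_smul (⟨u, hu⟩ : W R) ⟨v, hv⟩ lam
    rw [h, ← sub_add_sub_cancel _ ((⟨v, hv⟩ : W R) • lam) lam]
    exact add_mem (ihu _) (ihv _)

/-- Stability of a subgroup of the weight lattice under the Weyl group. -/
class IsWStable (L : AddSubgroup (weightLattice R)) : Prop where
  smul_mem : ∀ (w : W R) (lam : weightLattice R), lam ∈ L → w • lam ∈ L

instance [R.IsCrystallographic] (L : AddSubgroup (weightLattice R))
    [h : Fact (rootLattice R ≤ L)] : IsWStable R L where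
  smul_mem w lam hlam := by
    have := add_mem (h.out (smul_sub_mem_rootLattice R w lam)) hlam
    simpa using this

instance (L M : AddSubgroup (weightLattice R)) [hL : IsWStable R L] [hM : IsWStable R M] :
    IsWStable R (L ⊓ M) where
  smul_mem w lam h := ⟨hL.smul_mem w lam h.1, hM.smul_mem w lam h.2⟩

end RootSystem

section Fields

variable {ι E F : Type*} [NormedAddCommGroup E] [InnerProductSpace ℝ E]
  [AddCommGroup F] [Module ℝ F] (R : RootPairing ι ℝ E F)

/-- The group algebra `ℂ[P]` of the weight lattice. -/
abbrev GroupAlgebraP : Type _ := AddMonoidAlgebra ℂ (weightLattice R)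

instance : TwoUniqueSums (weightLattice R) :=
  letI : Module ℚ E := Module.compHom E (algebraMap ℚ ℝ)
  TwoUniqueSums.of_injective_addHom (weightLattice R).subtype.toAddHom
    (weightLattice R).subtype_injective inferInstance

instance : IsDomain (GroupAlgebraP R) := NoZeroDivisors.to_isDomain _

/-- The quotient field `ℂ(P)` of `ℂ[P]`. -/
abbrev CP : Type _ := FractionRing (GroupAlgebraP R)

/-- The monomial `x^lam` in `ℂ(P)`. -/
def X (lam : weightLattice R) : CP R :=
  algebraMap (GroupAlgebraP R) (CP R) (AddMonoidAlgebra.single lam 1)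

theorem X_add (lam mu : weightLattice R) : X R (lam + mu) = X R lam * X R mu := by
  simp [X, ← map_mul, AddMonoidAlgebra.single_mul_single]

/-- The automorphisms of `ℂ(P)` over `ℂ` that extend `x^lam ↦ x^(w lam)`. -/
def weylHom : W R →* (CP R ≃ₐ[ℂ] CP R) where
  toFun w := IsFractionRing.fieldEquivOfAlgEquiv ℂ (CP R) (CP R)
    (AddMonoidAlgebra.domCongr ℂ ℂ (DistribMulAction.toAddEquiv (weightLattice R) w))
  map_one' := by
    refine Eq.trans ?_ (IsFractionRing.fieldEquivOfAlgEquiv_refl ℂ (GroupAlgebraP R) ℂ (CP R))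
    congr 1
    rw [← AddMonoidAlgebra.domCongr_refl]
    congr 1
    ext lam
    simp
  map_mul' u v := by
    change _ = AlgEquiv.trans _ _
    rw [← IsFractionRing.fieldEquivOfAlgEquiv_trans, AddMonoidAlgebra.trans_domCongr_domCongr]
    congr 2
    ext lam
    simp [mul_smul]

/-- The action of `W` on `ℂ(P)` by field automorphisms. -/
instance : MulSemiringAction (W R) (CP R) := MulSemiringAction.compHom (CP R) (weylHom R)

theorem smul_eq_weylHom (w : W R) (f : CP R) : w • f = weylHom R w f := rfl

instance : SMulCommClass (W R) ℂ (CP R) where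
  smul_comm w c f := by simp [smul_eq_weylHom]

theorem smul_X (w : W R) (lam : weightLattice R) : w • X R lam = X R (w • lam) := by
  rw [smul_eq_weylHom]
  simp [weylHom, X]

/-- The subfield `ℂ(L)` of `ℂ(P)` generated over `ℂ` by the `x^lam` with `lam` in `L`. -/
def C (L : AddSubgroup (weightLattice R)) : IntermediateField ℂ (CP R) :=
  IntermediateField.adjoin ℂ (X R '' (L : Set (weightLattice R)))

theorem X_mem_C {L : AddSubgroup (weightLattice R)} {lam : weightLattice R} (h : lam ∈ L) :
    X R lam ∈ C R L :=
  IntermediateField.subset_adjoin _ _ ⟨lam, h, rfl⟩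

theorem C_mono {L M : AddSubgroup (weightLattice R)} (h : L ≤ M) : C R L ≤ C R M :=
  IntermediateField.adjoin.mono _ _ _ (Set.image_mono h)

theorem smul_mem_C (L : AddSubgroup (weightLattice R)) [hL : IsWStable R L] (w : W R)
    {f : CP R} (hf : f ∈ C R L) : w • f ∈ C R L := by
  have h : IntermediateField.map (weylHom R w : CP R →ₐ[ℂ] CP R) (C R L) ≤ C R L := by
    rw [C, IntermediateField.adjoin_map, IntermediateField.adjoin_le_iff]
    rintro _ ⟨_, ⟨lam, hlam, rfl⟩, rfl⟩
    change w • X R lam ∈ C R L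
    rw [smul_X]
    exact X_mem_C R (hL.smul_mem w lam hlam)
  exact h ⟨f, hf, rfl⟩

/-- The action of `W` on `ℂ(L)`, for `W`-stable `L`. -/
instance (L : AddSubgroup (weightLattice R)) [IsWStable R L] :
    MulSemiringAction (W R) (C R L) where
  smul w f := ⟨w • (f : CP R), smul_mem_C R L w f.2⟩
  one_smul _ := Subtype.ext (one_smul _ _)
  mul_smul _ _ _ := Subtype.ext (mul_smul _ _ _)
  smul_zero _ := Subtype.ext (smul_zero _)
  smul_add _ _ _ := Subtype.ext (smul_add _ _ _)
  smul_one _ := Subtype.ext (smul_one _)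
  smul_mul _ _ _ := Subtype.ext (smul_mul' _ _ _)

instance (L : AddSubgroup (weightLattice R)) [IsWStable R L] :
    SMulCommClass (W R) ℂ (C R L) where
  smul_comm w c f := Subtype.ext (smul_comm w c (f : CP R))

/-- The semidirect product algebra `W ⋉ ℂ(L)`: the elements are the finite sums of products `f w`
with `f` in `ℂ(L)` and `w` in `W`, and `(f w) (g v) = f (w g) (w v)`. The product `f w` is
`SkewMonoidAlgebra.single w f`. -/
abbrev Semidirect (L : AddSubgroup (weightLattice R)) [IsWStable R L] : Type _ :=
  SkewMonoidAlgebra (C R L) (W R)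

/-- The element `w` of `W ⋉ ℂ(L)`. -/
def ofW (L : AddSubgroup (weightLattice R)) [IsWStable R L] : W R →* Semidirect R L :=
  SkewMonoidAlgebra.of (C R L) (W R)

/-- The inclusion of `ℂ(L)` in `W ⋉ ℂ(L)`. -/
def ofC (L : AddSubgroup (weightLattice R)) [IsWStable R L] : C R L →ₐ[ℂ] Semidirect R L where
  toRingHom := SkewMonoidAlgebra.singleOneRingHom
  commutes' _ := rfl

/-- The inclusion of `W ⋉ ℂ(L)` in `W ⋉ ℂ(M)` for `L ≤ M`, `f w ↦ f w`. -/
def semidirectInclusion {L M : AddSubgroup (weightLattice R)} [IsWStable R L] [IsWStable R M]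
    (h : L ≤ M) : Semidirect R L →ₐ[ℂ] Semidirect R M :=
  SkewMonoidAlgebra.liftNCAlgHom
    ((ofC R M).comp (IntermediateField.inclusion (C_mono R h))) (ofW R M) (by
      intro f w
      change SkewMonoidAlgebra.single 1 _ * SkewMonoidAlgebra.single w 1
        = SkewMonoidAlgebra.single w 1 * SkewMonoidAlgebra.single 1 _
      simp only [SkewMonoidAlgebra.single_mul_single, one_mul, mul_one, smul_one]
      rfl)

end Fields

section Base

variable {ι E F : Type*} [NormedAddCommGroup E] [InnerProductSpace ℝ E]
  [AddCommGroup F] [Module ℝ F] {R : RootPairing ι ℝ E F} (b : R.Base)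

/-- The simple reflection `s_i`. -/
def simpleReflection (i : b.support) : W R := RootPairing.weylGroup.ofIdx R i

variable [R.IsRootSystem]

/-- The vectors `ϖ_i` in `E` with `(ϖ_i, α_j^∨) = δ_ij`. -/
def fundamentalWeightE (i : b.support) : E :=
  R.toLinearMap.toPerfPair.symm (b.toCoweightBasis.coord i)

theorem fundamentalWeightE_coroot [DecidableEq b.support] (i j : b.support) :
    R.toLinearMap (fundamentalWeightE b i) (R.coroot j) = if j = i then 1 else 0 := by
  have h : R.toLinearMap (fundamentalWeightE b i) = b.toCoweightBasis.coord i :=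
    R.toLinearMap.toPerfPair.apply_symm_apply _
  rw [h, Module.Basis.coord_apply, RootPairing.Base.toCoweightBasis_repr_coroot,
    Finsupp.single_apply]

/-- The fundamental weights `ϖ_i`. -/
def fundamentalWeight (i : b.support) : weightLattice R :=
  ⟨fundamentalWeightE b i, fun j => by
    classical
    have key : ∀ y ∈ Submodule.span ℤ (R.coroot '' b.support),
        ∃ z : ℤ, R.toLinearMap (fundamentalWeightE b i) y = z := by
      intro y hy
      induction hy using Submodule.span_induction with
      | mem x hx =>
        obtain ⟨l, hl, rfl⟩ := hx
        have := fundamentalWeightE_coroot b i ⟨l, hl⟩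
        exact ⟨if (⟨l, hl⟩ : b.support) = i then 1 else 0, by rw [this]; split_ifs <;> simp⟩
      | zero => exact ⟨0, by simp⟩
      | add x y _ _ hx hy =>
        obtain ⟨a, ha⟩ := hx
        obtain ⟨c, hc⟩ := hy
        exact ⟨a + c, by simp [ha, hc]⟩
      | smul a x _ hx =>
        obtain ⟨c, hc⟩ := hx
        exact ⟨a * c, by simp [hc]⟩
    exact key _ (b.coroot_mem_span_int j)⟩

end Base

section Data

variable {ι E F : Type*} [NormedAddCommGroup E] [InnerProductSpace ℝ E]
  [AddCommGroup F] [Module ℝ F] (R : RootPairing ι ℝ E F) [R.IsCrystallographic]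

/-- A nonzero `W`-invariant quadratic form `P → ℚ` that is integral on the root lattice,
and a positive integer `n`. -/
structure MetaplecticDatum where
  Q : QuadraticMap ℤ (weightLattice R) ℚ
  Q_smul : ∀ (w : W R) (lam : weightLattice R), Q (w • lam) = Q lam
  Q_int : ∀ lam ∈ rootLattice R, ∃ z : ℤ, Q lam = z
  Q_ne_zero : Q ≠ 0
  n : ℕ
  n_pos : 0 < n

variable {R} (D : MetaplecticDatum R)

namespace MetaplecticDatum

/-- The bilinear form `B(lam, mu) = Q(lam + mu) - Q(lam) - Q(mu)`. -/
def B (lam mu : weightLattice R) : ℚ := QuadraticMap.polar D.Q lam mu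

/-- `m(α) = n / gcd(n, Q(α))`, where `Q(α)` is an integer. -/
def m (i : ι) : ℕ := D.n / Nat.gcd D.n ⌊D.Q (rootP R i)⌋.natAbs

/-- `α^m = m(α) α`. -/
def rootM (i : ι) : weightLattice R := D.m i • rootP R i

theorem m_reflectionPerm (i j : ι) : D.m (R.reflectionPerm i j) = D.m j := by
  have h : rootP R (R.reflectionPerm i j) = (RootPairing.weylGroup.ofIdx R i : W R) • rootP R j :=
    Subtype.ext (R.root_reflectionPerm i j)
  rw [m, m, h, D.Q_smul]

/-- The weight lattice `P^m` of the root system `{α^m}`: all weights `lam` with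
`(lam, (α^m)^∨) ∈ ℤ` for all roots `α`, where `(α^m)^∨ = m(α)⁻¹ α^∨`. -/
def Pm : AddSubgroup (weightLattice R) where
  carrier := {lam | ∀ i : ι, ∃ z : ℤ, (D.m i : ℝ)⁻¹ * R.toLinearMap (lam : E) (R.coroot i) = z}
  zero_mem' := fun i => ⟨0, by simp⟩
  add_mem' := fun {x y} hx hy i => by
    obtain ⟨a, ha⟩ := hx i
    obtain ⟨c, hc⟩ := hy i
    exact ⟨a + c, by simp [mul_add, ha, hc]⟩
  neg_mem' := fun {x} hx i => by
    obtain ⟨a, ha⟩ := hx i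
    exact ⟨-a, by simp [ha]⟩

instance : IsWStable R D.Pm where
  smul_mem w lam hlam := by
    obtain ⟨w, hw⟩ := w
    induction hw using RootPairing.weylGroup.induction generalizing lam with
    | mem i =>
      intro j
      obtain ⟨z, hz⟩ := hlam (R.reflectionPerm i j)
      refine ⟨z, ?_⟩
      rw [← hz, D.m_reflectionPerm]
      exact congrArg _ (R.coroot'_reflection (i := i) (j := j) (lam : E))
    | one =>
      have h : (⟨1, one_mem _⟩ : W R) • lam = lam := one_smul (W R) lam
      rwa [h]
    | mul u v hu hv ihu ihv =>
      have h : (⟨u * v, mul_mem hu hv⟩ : W R) • lam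
          = (⟨u, hu⟩ : W R) • (⟨v, hv⟩ : W R) • lam :=
        mul_smul (⟨u, hu⟩ : W R) ⟨v, hv⟩ lam
      rw [h]
      exact ihu _ (ihv _ hlam)

end MetaplecticDatum

/-- The two root lengths of the root system `{α^m}`. -/
inductive RootSize
  | sh
  | lg

open Classical in
/-- `size(α^m)`: `α^m` is short if it is shorter than some other root `β^m`, and long otherwise
(so that all roots are long if all have the same length). -/
def MetaplecticDatum.size (i : ι) : RootSize :=
  if ∃ j : ι, ‖(D.rootM i : E)‖ < ‖(D.rootM j : E)‖ then RootSize.sh else RootSize.lg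

/-- A `W`-invariant function `k` from the roots to `ℂˣ` and representation parameters `g_j(y)`
for `j` in `ℤ` and `y` a root length. In `g_mul`, every root of length `y` gives the
value `k_y`. -/
structure Parameters where
  k : ι → ℂˣ
  k_reflectionPerm : ∀ i j : ι, k (R.reflectionPerm i j) = k j
  g : ℤ → RootSize → ℂˣ
  g_of_dvd : ∀ (j : ℤ) (y : RootSize), (D.n : ℤ) ∣ j → g j y = -1
  g_mod : ∀ (j : ℤ) (y : RootSize), g j y = g (j % D.n) y
  g_mul : ∀ (j : ℤ) (i : ι), ¬ (D.n : ℤ) ∣ j →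
    g j (D.size i) * g (D.n - j) (D.size i) = (k i ^ 2)⁻¹

section Base

variable [R.IsRootSystem] (b : R.Base)

namespace MetaplecticDatum

/-- `r(lam) = ∑ i, r_{m(α_i)}((lam, α_i^∨)) ϖ_i`, with `r_s(t)` the remainder of `t` modulo `s`. -/
def r (lam : weightLattice R) : weightLattice R :=
  ∑ i : b.support, (pair R lam i % D.m i) • fundamentalWeight b i

/-- `q(lam) = lam - r(lam)`, an element of `P^m`. -/
def q (lam : weightLattice R) : weightLattice R := lam - D.r b lam

/-- The integer `(mu, (α^m)^∨) = m(α)⁻¹ (mu, α^∨)`, for `mu` in `P^m`. -/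
def pairM (mu : weightLattice R) (i : ι) : ℤ :=
  ⌊(D.m i : ℝ)⁻¹ * R.toLinearMap (mu : E) (R.coroot i)⌋

/-- The expression that `σ(s_i) (f x^lam)` is claimed to be equal to. The index
`Q(α_i) - B(lam, α_i)` of `g` is an integer. -/
def sigmaFormula (p : Parameters D) (i : b.support) (f : CP R) (lam : weightLattice R) : CP R :=
  let v : CP R := algebraMap ℂ (CP R) ((p.k i : ℂ) ^ 2)
  let gam : CP R := algebraMap ℂ (CP R)
    (p.g ⌊D.Q (rootP R i) - D.B lam (rootP R i)⌋ (D.size i) : ℂ)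
  let s : W R := simpleReflection b i
  (1 - v) * X R (D.pairM (D.q b (-lam)) i • D.rootM i) / (1 - v * X R (D.rootM i))
      * (s • f) * X R lam
    + v * gam * ((1 - X R (-D.rootM i)) / (1 - v * X R (D.rootM i)))
      * (s • f) * X R (rootP R i + s • lam)

/-- The Chinta-Gunnells expression for the action of `s_i` on `f x^lam`, with parameters
`v` and `g_j`. The numbers `Q(α_i) - B(lam, α_i)` and `B(lam, α_i) / Q(α_i)` are integers. -/
def chintaGunnellsFormula (v : ℂˣ) (g : ℤ → ℂˣ) (i : b.support) (f : CP R)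
    (lam : weightLattice R) : CP R :=
  let c : ℂ → CP R := algebraMap ℂ (CP R)
  let s : W R := simpleReflection b i
  let al : weightLattice R := rootP R i
  (s • f) * X R (s • lam) / (1 - c v * X R (D.rootM i))
    * (X R (-(⌊-(D.B lam al / D.Q al)⌋ % (D.m i : ℤ)) • al) * (1 - c v)
      - c v * c (g ⌊D.Q al - D.B lam al⌋) * X R ((1 - (D.m i : ℤ)) • al) * (1 - X R (D.rootM i)))

/-- An algebra map `σ : W ⋉ ℂ(P^m) → End(ℂ(P))` is given by the metaplectic formulas. -/
def IsSigma (p : Parameters D) (σ : Semidirect R D.Pm →ₐ[ℂ] Module.End ℂ (CP R)) : Prop :=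
  (∀ (i : b.support) (f : C R D.Pm) (lam : weightLattice R),
    σ (ofW R D.Pm (simpleReflection b i)) ((f : CP R) * X R lam)
      = D.sigmaFormula b p i (f : CP R) lam) ∧
  (∀ (g f : C R D.Pm) (lam : weightLattice R),
    σ (ofC R D.Pm g) ((f : CP R) * X R lam) = (g : CP R) * (f : CP R) * X R lam)

section Sublattice

variable (L : AddSubgroup (weightLattice R)) [Fact (rootLattice R ≤ L)]

/-- The element `f x^lam` of `ℂ(L)`, for `f` in `ℂ(L ∩ P^m)` and `lam` in `L`. -/
def mulX (f : C R (L ⊓ D.Pm)) (lam : L) : C R L :=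
  ⟨(f : CP R) * X R (lam : weightLattice R),
    mul_mem (C_mono R inf_le_left f.2) (X_mem_C R lam.2)⟩

/-- An algebra map `σ : W ⋉ ℂ(L ∩ P^m) → End(ℂ(L))` is given by the metaplectic formulas. -/
def IsSigmaOn (p : Parameters D)
    (σ : Semidirect R (L ⊓ D.Pm) →ₐ[ℂ] Module.End ℂ (C R L)) : Prop :=
  (∀ (i : b.support) (f : C R (L ⊓ D.Pm)) (lam : L),
    (σ (ofW R (L ⊓ D.Pm) (simpleReflection b i)) (D.mulX L f lam) : CP R)
      = D.sigmaFormula b p i (f : CP R) (lam : weightLattice R)) ∧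
  (∀ (g f : C R (L ⊓ D.Pm)) (lam : L),
    (σ (ofC R (L ⊓ D.Pm) g) (D.mulX L f lam) : CP R)
      = (g : CP R) * (f : CP R) * X R (lam : weightLattice R))

/-- A representation of `W` on `ℂ(L)` is given by the Chinta-Gunnells formulas. -/
def IsChintaGunnells (v : ℂˣ) (g : ℤ → ℂˣ) (τ : Representation ℂ (W R) (C R L)) : Prop :=
  ∀ (i : b.support) (f : C R (L ⊓ D.Pm)) (lam : L),
    (τ (simpleReflection b i) (D.mulX L f lam) : CP R)
      = D.chintaGunnellsFormula b v g i (f : CP R) (lam : weightLattice R)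

end Sublattice

end MetaplecticDatum

end Base

end Data

end Metaplectic

end

open Metaplectic

/-! Uniqueness is the easy half: the simple reflections and ℂ(P^m) generate the semidirect product,
and the products f x^λ span ℂ(P) over ℂ (`C_induction`). For existence, the formula for σ(s_i)
defines an operator `sigma` that is semilinear over ℂ(P^m). By the presentation of W
(`exists_monoidHom_weylGroup`) it remains to see that these operators are involutions and satisfy
the braid relations. The first is a computation with g_j g_{n-j} = k^{-2} (`sigma_sigma`).

The braid relations are reached through Demazure-Lusztig operators. Put y = x^{α_i^m}, v = k_i² and
A_i = ((1-vy)/(1-y)) σ_i - (1-v)/(1-y) (`demLus`). For two semilinear involutions S and T whose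
field automorphisms act on y and z like two simple reflections (`RankTwoDatum`), the braid
difference of the two Demazure-Lusztig operators equals that of S and T times a nonzero product over
the positive roots u of factors (1-vu)/(1-u) or (1-wu)/(1-u). This holds vector by vector, so a
braid relation for A_i, A_j at one vector gives the one for σ_i, σ_j at that vector
(`altProd_apply_of_demazureLusztig`).

The operators A_i are simple on suitable monomials. Let δ be the weight with (δ,α_i^∨) = 1 - m(α_i)
for all i (`shift`). Then A_i x^{μ+δ} is a scalar multiple of x^{s_iμ+δ} as long as 0 ≤ (μ,α_i^∨) ≤
m(α_i) (`demLus_X`). If |(μ,β^∨)| ≤ m(β) for all roots β and μ is nonnegative at two simple coroots,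
this applies to every letter of both braid words. The two products of scalars agree, because both
words meet the same values in opposite orders (`altProdRev_demLus_X`, `IsBond.chainProd_eq`). So the
braid relation for σ_i, σ_j holds at such x^{μ+δ}.

The vectors at which it holds form a ℂ(P^m)-subspace stable under σ_i and σ_j. The formula for σ_i
then allows μ to be replaced by s_iμ, and translation by P^m brings every weight into the range
|(μ,β^∨)| ≤ m(β) (`exists_isSmall_add`). Hence the relation holds on all of ℂ(P)
(`altProd_sigma_eq`).

The formulas show that ℂ(Λ) is stable. The comparison with Chinta-Gunnells is algebra once Q(α) ≠ 0
(`qRoot_ne_zero`), since then B(λ,α)/Q(α) = (λ,α^∨). For the last part, k is a square root of v. -/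

noncomputable section

namespace Metaplectic

/-! ### Alternating words and the Cartan integers of rank two -/

section AlternatingProducts

/-- The product `a b a ⋯` of `n` factors. -/
def altProd {G : Type*} [Monoid G] : G → G → ℕ → G
  | _, _, 0 => 1
  | a, b, n + 1 => a * altProd b a n

theorem map_altProd {G H : Type*} [Monoid G] [Monoid H] (φ : G →* H) (a b : G) (n : ℕ) :
    φ (altProd a b n) = altProd (φ a) (φ b) n := by
  induction n generalizing a b with
  | zero => exact map_one φ
  | succ n ih => rw [altProd, altProd, map_mul, ih]

/-- `IsBond p q m`: the Cartan integers `-p` and `-q` of two simple roots belong to a rank two root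
system whose Weyl group has order `2m`. -/
inductive IsBond : ℤ → ℤ → ℕ → Prop
  | zero : IsBond 0 0 2
  | one : IsBond 1 1 3
  | two_one : IsBond 2 1 4
  | one_two : IsBond 1 2 4
  | three_one : IsBond 3 1 6
  | one_three : IsBond 1 3 6

theorem IsBond.symm {p q : ℤ} {m : ℕ} (h : IsBond p q m) : IsBond q p m := by
  cases h <;> constructor

theorem IsBond.exists_eq_add_one {p q : ℤ} {m : ℕ} (h : IsBond p q m) : ∃ n, m = n + 1 := by
  cases h <;> exact ⟨_, rfl⟩

/-- Nonnegativity of the values of a weight at the roots that occur one after the other when two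
simple reflections are applied alternately. -/
def ChainNonneg : ℝ → ℝ → ℕ → ℝ → ℝ → Prop
  | _, _, 0, _, _ => True
  | p, q, n + 1, x, y => 0 ≤ x ∧ ChainNonneg q p n (y + p * x) (-x)

/-- The chain runs through the m positive roots of the rank two system, so each of its terms is a
combination of x and y with nonnegative coefficients. -/
theorem IsBond.chainNonneg {p q : ℤ} {m : ℕ} (h : IsBond p q m) {x y : ℝ} (hx : 0 ≤ x)
    (hy : 0 ≤ y) : ChainNonneg p q m x y := by
  cases h <;> simp only [ChainNonneg, and_true] <;> push_cast <;>
    (refine ⟨by linarith, ?_⟩) <;> repeat' apply And.intro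
  all_goals linarith

end AlternatingProducts

/-! ### Presentation of the Weyl group by simple reflections -/

section WeylGroup

variable {ι E F : Type*} [NormedAddCommGroup E] [InnerProductSpace ℝ E]
  [AddCommGroup F] [Module ℝ F] {R : RootPairing ι ℝ E F} (b : R.Base)

theorem ofIdx_smul (i : ι) (x : E) :
    RootPairing.weylGroup.ofIdx R i • x = x - R.toLinearMap x (R.coroot i) • R.root i := by
  rw [RootPairing.weylGroup.ofIdx_smul, RootPairing.Equiv.reflection_smul, R.reflection_apply]
  rfl

theorem weylGroup_ext {u w : W R} (h : ∀ x : E, u • x = w • x) : u = w := by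
  refine Subtype.ext (RootPairing.Equiv.weightHom_injective R (LinearEquiv.ext h))

theorem ofIdx_mul_self (i : ι) :
    RootPairing.weylGroup.ofIdx R i * RootPairing.weylGroup.ofIdx R i = 1 := by
  refine weylGroup_ext fun x ↦ ?_
  rw [mul_smul, RootPairing.weylGroup.ofIdx_smul, RootPairing.weylGroup.ofIdx_smul, one_smul]
  simp

@[simp]
theorem simpleReflection_mul_self (i : b.support) :
    simpleReflection b i * simpleReflection b i = 1 := ofIdx_mul_self _

@[simp]
theorem simpleReflection_smul_smul {α : Type*} [MulAction (W R) α] (i : b.support) (x : α) :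
    simpleReflection b i • simpleReflection b i • x = x := by
  rw [← mul_smul, simpleReflection_mul_self, one_smul]

theorem ofIdx_reflectionPerm (i j : ι) :
    RootPairing.weylGroup.ofIdx R (R.reflectionPerm i j) = RootPairing.weylGroup.ofIdx R i
      * RootPairing.weylGroup.ofIdx R j * RootPairing.weylGroup.ofIdx R i := by
  refine weylGroup_ext fun x ↦ ?_
  rw [mul_smul, mul_smul, RootPairing.weylGroup.ofIdx_smul, RootPairing.weylGroup.ofIdx_smul,
    RootPairing.weylGroup.ofIdx_smul, RootPairing.weylGroup.ofIdx_smul]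
  simp [RootPairing.reflection_reflectionPerm]

instance [Finite ι] [R.IsRootSystem] : Finite (W R) := by
  refine Finite.of_injective R.weylGroupToPerm fun u w h ↦ weylGroup_ext fun x ↦ ?_
  have hx : x ∈ Submodule.span ℝ (Set.range R.root) := by
    rw [RootPairing.IsRootSystem.span_root_eq_top]; trivial
  induction hx using Submodule.span_induction with
  | mem x hx =>
    obtain ⟨i, rfl⟩ := hx
    rw [R.weylGroup_apply_root, R.weylGroup_apply_root, h]
  | zero => rw [smul_zero, smul_zero]
  | add x y _ _ hx hy => rw [smul_add, smul_add, hx, hy]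
  | smul c x _ hx => rw [smul_comm u, smul_comm w, hx]

variable [Finite ι] [R.IsCrystallographic] [R.IsReduced]

/-- Every root arises from simple roots by reflections, and the reflection in a reflected root is a
conjugate, so the simple reflections generate W. -/
theorem weylGroup_induction {p : W R → Prop} (one : p 1)
    (mul : ∀ i w, p w → p (simpleReflection b i * w)) (w : W R) : p w := by
  have hgen : ∀ i : ι, RootPairing.weylGroup.ofIdx R i
      ∈ Subgroup.closure (Set.range (simpleReflection b)) := by
    intro i
    induction i using b.induction_reflect with
    | h₀ i hi => rw [ofIdx_reflectionPerm]; exact mul_mem (mul_mem hi hi) hi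
    | h₁ i hi => exact Subgroup.subset_closure ⟨⟨i, hi⟩, rfl⟩
    | h₂ i j hi hj =>
      have : RootPairing.weylGroup.ofIdx R j ∈ Subgroup.closure (Set.range (simpleReflection b)) :=
        Subgroup.subset_closure ⟨⟨j, hj⟩, rfl⟩
      rw [ofIdx_reflectionPerm]; exact mul_mem (mul_mem this hi) this
  have htop : w ∈ Subgroup.closure (Set.range (simpleReflection b)) := by
    obtain ⟨w, hw⟩ := w
    induction hw using RootPairing.weylGroup.induction with
    | mem i => exact hgen i
    | one => exact one_mem _
    | mul u v hu hv ihu ihv => exact mul_mem ihu ihv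
  induction htop using Subgroup.closure_induction_left with
  | one => exact one
  | mul_left x hx y hy ih => obtain ⟨i, rfl⟩ := hx; exact mul i y ih
  | inv_mul_cancel x hx y hy ih =>
    obtain ⟨i, rfl⟩ := hx
    rw [inv_eq_of_mul_eq_one_left (simpleReflection_mul_self b i)]
    exact mul i y ih

/-- Distinct simple roots have nonpositive Cartan integers, and the crystallographic bound on their
product leaves exactly the listed pairs. -/
theorem exists_isBond {i j : b.support} (hij : i ≠ j) :
    ∃ m, IsBond (-R.pairingIn ℤ j i) (-R.pairingIn ℤ i j) m := by
  have hne : (i : ι) ≠ j := fun h ↦ hij (Subtype.ext h)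
  have h1 := b.pairingIn_le_zero_of_ne hne i.2 j.2
  have h2 := R.pairingIn_pairingIn_mem_set_of_isCrystal_of_isRed' (i := i) (j := j)
    (fun h ↦ hne (R.root.injective h)) (b.root_ne_neg_of_ne i.2 j.2 hne)
  simp only [Set.mem_insert_iff, Set.mem_singleton_iff, Prod.mk.injEq] at h2
  rcases h2 with h | h | h | h | h | h | h | h | h | h | h <;> rw [h.1] at h1 ⊢ <;> rw [h.2]
  all_goals first | omega | exact ⟨_, by constructor⟩

-- Both words subtract from x a combination of the two simple roots with coefficients linear in the
-- two coroot values of x; for each bond these coefficients agree.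
omit [Finite ι] [R.IsReduced] in
theorem altProd_simpleReflection_eq {i j : b.support} {m : ℕ}
    (h : IsBond (-R.pairingIn ℤ j i) (-R.pairingIn ℤ i j) m) :
    altProd (simpleReflection b i) (simpleReflection b j) m
      = altProd (simpleReflection b j) (simpleReflection b i) m := by
  refine weylGroup_ext fun x ↦ ?_
  have hi : ∀ x : E, simpleReflection b i • x = x - R.toLinearMap x (R.coroot i) • R.root i :=
    ofIdx_smul (i : ι)
  have hj : ∀ x : E, simpleReflection b j • x = x - R.toLinearMap x (R.coroot j) • R.root j :=
    ofIdx_smul (j : ι)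
  have aij : R.toLinearMap (R.root i) (R.coroot j) = (R.pairingIn ℤ i j : ℝ) := by
    simpa using (R.algebraMap_pairingIn ℤ (i : ι) (j : ι)).symm
  have aji : R.toLinearMap (R.root j) (R.coroot i) = (R.pairingIn ℤ j i : ℝ) := by
    simpa using (R.algebraMap_pairingIn ℤ (j : ι) (i : ι)).symm
  have aii : R.toLinearMap (R.root i) (R.coroot i) = 2 := by simp
  have ajj : R.toLinearMap (R.root j) (R.coroot j) = 2 := by simp
  generalize hp : -R.pairingIn ℤ j i = p at h
  generalize hq : -R.pairingIn ℤ i j = q at h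
  rw [← neg_eq_iff_eq_neg.mpr hq.symm] at aij
  rw [← neg_eq_iff_eq_neg.mpr hp.symm] at aji
  cases h <;>
    simp only [altProd, mul_smul, one_smul, hi, hj, map_sub, map_smul, LinearMap.sub_apply,
      LinearMap.smul_apply, aij, aji, aii, ajj, smul_eq_mul] <;> push_cast <;> module

variable [R.IsRootSystem]

/-- The linear form on `E` with value `1` at every simple root. -/
def heightForm : E →ₗ[ℝ] ℝ := b.toWeightBasis.constr ℝ fun _ ↦ 1

omit [Finite ι] [R.IsCrystallographic] [R.IsReduced] in
@[simp]
theorem heightForm_root_support (i : b.support) : heightForm b (R.root i) = 1 := by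
  rw [← b.toWeightBasis_apply, heightForm, Module.Basis.constr_basis]

theorem heightForm_root (i : ι) : heightForm b (R.root i) = b.height i := by
  obtain ⟨f, -, -, hf⟩ := b.exists_root_eq_sum_int i
  rw [RootPairing.Base.height_eq_sum hf, hf, map_sum]
  push_cast
  refine Finset.sum_congr rfl fun j hj ↦ ?_
  rw [map_zsmul, heightForm_root_support b ⟨j, hj⟩]
  simp

theorem heightForm_root_ne_zero (i : ι) : heightForm b (R.root i) ≠ 0 := by
  rw [heightForm_root]; exact_mod_cast b.height_ne_zero i

theorem isPos_iff_heightForm (i : ι) : b.IsPos i ↔ 0 < heightForm b (R.root i) := by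
  rw [heightForm_root, RootPairing.Base.isPos_iff]; norm_cast

theorem heightForm_smul_root_ne_zero (w : W R) (i : ι) : heightForm b (w • R.root i) ≠ 0 := by
  rw [R.weylGroup_apply_root]; exact heightForm_root_ne_zero b _

/-- The left descents of `w`. -/
def IsDescent (w : W R) (i : b.support) : Prop := heightForm b (w⁻¹ • R.root i) < 0

/-- The positive roots made negative by `w⁻¹`. -/
def inversions (w : W R) : Set ι := {k | b.IsPos k ∧ heightForm b (w⁻¹ • R.root k) < 0}

omit [Finite ι] [R.IsCrystallographic] [R.IsReduced] [R.IsRootSystem] in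
theorem inv_simpleReflection_mul_smul (w : W R) (i : b.support) (x : E) :
    (simpleReflection b i * w)⁻¹ • x = w⁻¹ • simpleReflection b i • x := by
  rw [mul_inv_rev, inv_eq_of_mul_eq_one_left (simpleReflection_mul_self b i), mul_smul]

omit [Finite ι] [R.IsCrystallographic] [R.IsReduced] [R.IsRootSystem] in
theorem simpleReflection_smul_root (i : b.support) (k : ι) :
    simpleReflection b i • R.root k = R.root (R.reflectionPerm i k) := by
  rw [R.root_reflectionPerm]; rfl

/-- The reflection s_i permutes the positive roots other than α_i. It therefore carries the
inversions of s_i w injectively to those of w and misses α_i, which is an inversion of w. -/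
theorem ncard_inversions_lt {w : W R} {i : b.support} (h : IsDescent b w i) :
    (inversions b (simpleReflection b i * w)).ncard < (inversions b w).ncard := by
  have hself : simpleReflection b i • R.root i = -R.root i := by
    change RootPairing.weylGroup.ofIdx R i • R.root i = _
    simp
  have hpos : ∀ k ∈ inversions b (simpleReflection b i * w), k ≠ i := by
    rintro _ ⟨-, hk⟩ rfl
    rw [inv_simpleReflection_mul_smul, hself, smul_neg, map_neg] at hk
    exact absurd h (by unfold IsDescent; linarith)
  rw [← Set.ncard_image_of_injective _ (R.reflectionPerm i).injective]
  refine Set.ncard_lt_ncard ⟨?_, fun hsub ↦ ?_⟩ (Set.toFinite _)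
  · rintro _ ⟨k, hk, rfl⟩
    refine ⟨hk.1.reflectionPerm i.2 (hpos k hk), ?_⟩
    rw [← simpleReflection_smul_root, ← inv_simpleReflection_mul_smul]
    exact hk.2
  · obtain ⟨k, hk, hki⟩ := hsub (show (i : ι) ∈ inversions b w from
      ⟨b.isPos_of_mem_support i.2, h⟩)
    have : R.root k = -R.root i := by
      rw [← hself, ← hki, simpleReflection_smul_root, R.reflectionPerm_self]
    have h1 := (isPos_iff_heightForm b k).mp hk.1
    rw [this, map_neg, heightForm_root_support] at h1
    linarith

section Extend

variable {G : Type*} [Monoid G] (f : b.support → G)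

open Classical in
/-- A function on the Weyl group that multiplies `f` along a reduced expression. -/
def weylExtend (w : W R) : G :=
  if h : ∃ i, IsDescent b w i then
    have := ncard_inversions_lt b h.choose_spec
    f h.choose * weylExtend (simpleReflection b h.choose * w)
  else 1
termination_by (inversions b w).ncard

theorem weylExtend_of_exists {w : W R} (h : ∃ i, IsDescent b w i) :
    weylExtend b f w = f h.choose * weylExtend b f (simpleReflection b h.choose * w) := by
  rw [weylExtend, dif_pos h]

theorem weylExtend_one : weylExtend b f 1 = 1 := by
  rw [weylExtend, dif_neg]
  rintro ⟨i, hi⟩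
  rw [IsDescent, inv_one, one_smul, heightForm_root_support] at hi
  linarith

/-- The element of the Weyl group obtained from `w` by `n` simple reflections on the left, that
alternate and begin with the one of `i`. -/
def alternate : b.support → b.support → ℕ → W R → W R
  | _, _, 0, w => w
  | i, j, n + 1, w => alternate j i n (simpleReflection b i * w)

omit [Finite ι] [R.IsCrystallographic] [R.IsReduced] [R.IsRootSystem] in
theorem altProd_mul_alternate (i j : b.support) (n : ℕ) (w : W R) :
    altProd (simpleReflection b i) (simpleReflection b j) n * alternate b i j n w = w := by
  induction n generalizing i j w with
  | zero => exact one_mul w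
  | succ n ih =>
    rw [altProd, alternate, mul_assoc, ih, ← mul_assoc, simpleReflection_mul_self, one_mul]

omit [Finite ι] [R.IsReduced] [R.IsRootSystem] in
theorem simpleReflection_smul_root_of_ne (i j : b.support) :
    simpleReflection b i • R.root j = R.root j + ((-R.pairingIn ℤ j i : ℤ) : ℝ) • R.root i := by
  change RootPairing.weylGroup.ofIdx R i • R.root j = _
  have aji : R.toLinearMap (R.root j) (R.coroot i) = (R.pairingIn ℤ j i : ℝ) := by
    simpa using (R.algebraMap_pairingIn ℤ (j : ι) (i : ι)).symm
  rw [ofIdx_smul, aji]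
  push_cast
  module

/-- Under w ↦ s_i w the pair of values at w⁻¹α_i, w⁻¹α_j changes by the rule of `ChainNonneg`. As
long as the chain is nonnegative, the next letter is a descent and can be split off by the induction
hypothesis `ih`. -/
theorem weylExtend_eq_altProd_mul {M : ℕ}
    (ih : ∀ w, (inversions b w).ncard < M → ∀ i, IsDescent b w i →
      weylExtend b f w = f i * weylExtend b f (simpleReflection b i * w)) (n : ℕ)
    (w : W R) (hw : (inversions b w).ncard < M) (i j : b.support)
    (h : ChainNonneg (-R.pairingIn ℤ j i : ℤ) (-R.pairingIn ℤ i j : ℤ) n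
      (-heightForm b (w⁻¹ • R.root i)) (-heightForm b (w⁻¹ • R.root j))) :
    weylExtend b f w = altProd (f i) (f j) n * weylExtend b f (alternate b i j n w) := by
  induction n generalizing i j w with
  | zero => rw [altProd, alternate, one_mul]
  | succ n ihn =>
    have hd : IsDescent b w i :=
      lt_of_le_of_ne (by linarith [h.1]) (heightForm_smul_root_ne_zero b _ _)
    rw [ih w hw i hd, altProd, alternate, mul_assoc,
      ihn _ ((ncard_inversions_lt b hd).trans hw) j i]
    convert h.2 using 1
    · rw [inv_simpleReflection_mul_smul, simpleReflection_smul_root_of_ne, smul_add,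
        smul_comm w⁻¹, map_add, LinearMap.map_smul, smul_eq_mul]
      ring
    · rw [inv_simpleReflection_mul_smul, simpleReflection_smul_root,
        R.root_reflectionPerm, R.reflection_apply_self, smul_neg, map_neg]

variable {f}

/-- Independence of the chosen descent. If i and j are both descents of w, then w begins with the
longest word in s_i and s_j, from either side. Splitting off this word in both ways gives the two
sides of the braid relation for `f`. -/
theorem weylExtend_of_isDescent
    (hf : ∀ (i j : b.support) (m : ℕ), i ≠ j → IsBond (-R.pairingIn ℤ j i) (-R.pairingIn ℤ i j) m →
      altProd (f i) (f j) m = altProd (f j) (f i) m) (w : W R) (i : b.support)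
    (h : IsDescent b w i) :
    weylExtend b f w = f i * weylExtend b f (simpleReflection b i * w) := by
  induction hM : (inversions b w).ncard using Nat.strong_induction_on generalizing w i with
  | _ M ihM =>
    subst hM
    have ih : ∀ w', (inversions b w').ncard < (inversions b w).ncard → ∀ i, IsDescent b w' i →
      weylExtend b f w' = f i * weylExtend b f (simpleReflection b i * w') :=
      fun w' hw' i hi ↦ ihM _ hw' w' i hi rfl
    have hex : ∃ i, IsDescent b w i := ⟨i, h⟩
    rw [weylExtend_of_exists b f hex]
    have hj := hex.choose_spec
    generalize hex.choose = j at hj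
    rcases eq_or_ne i j with rfl | hij
    · rfl
    obtain ⟨m, hm⟩ := exists_isBond b hij
    -- The first letter stays as it stands in the goal: `ih` covers only elements with fewer
    -- inversions than w, and s_i w is the first of these.
    have step : ∀ i j : b.support, IsDescent b w i → IsDescent b w j → ∀ n,
        IsBond (-R.pairingIn ℤ (j : ι) i) (-R.pairingIn ℤ (i : ι) j) (n + 1) →
        f i * weylExtend b f (simpleReflection b i * w)
          = altProd (f i) (f j) (n + 1) * weylExtend b f (alternate b i j (n + 1) w) := by
      intro i j hi hj n hn
      have hc := (hn.chainNonneg (x := -heightForm b (w⁻¹ • R.root i))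
        (y := -heightForm b (w⁻¹ • R.root j)) (by unfold IsDescent at hi; linarith)
        (by unfold IsDescent at hj; linarith)).2
      rw [weylExtend_eq_altProd_mul b f ih n _ (ncard_inversions_lt b hi) j i, altProd, alternate,
        mul_assoc]
      convert hc using 1
      · rw [inv_simpleReflection_mul_smul, simpleReflection_smul_root_of_ne, smul_add,
          smul_comm w⁻¹, map_add, LinearMap.map_smul, smul_eq_mul]
        ring
      · rw [inv_simpleReflection_mul_smul, simpleReflection_smul_root,
          R.root_reflectionPerm, R.reflection_apply_self, smul_neg, map_neg]
    obtain ⟨n, rfl⟩ : ∃ n, m = n + 1 := hm.exists_eq_add_one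
    rw [step i j h hj n hm, step j i hj h n hm.symm, hf i j _ hij hm]
    -- The remainders coincide in W, since both give w after multiplication by the same alternating
    -- word.
    congr 2
    have e1 := altProd_mul_alternate b i j (n + 1) w
    have e2 := altProd_mul_alternate b j i (n + 1) w
    rw [← altProd_simpleReflection_eq b hm] at e2
    exact mul_left_cancel (e2.trans e1.symm)

/-- The Weyl group is presented by the simple reflections, the relations `s_i ^ 2 = 1` and the
braid relations. -/
theorem exists_monoidHom_weylGroup (hf2 : ∀ i, f i * f i = 1)
    (hf : ∀ (i j : b.support) (m : ℕ), i ≠ j → IsBond (-R.pairingIn ℤ j i) (-R.pairingIn ℤ i j) m →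
      altProd (f i) (f j) m = altProd (f j) (f i) m) :
    ∃ φ : W R →* G, ∀ i, φ (simpleReflection b i) = f i := by
  have hmul : ∀ i w, weylExtend b f (simpleReflection b i * w) = f i * weylExtend b f w := by
    intro i w
    by_cases h : IsDescent b w i
    · rw [weylExtend_of_isDescent b hf w i h, ← mul_assoc, hf2, one_mul]
    · have h' : IsDescent b (simpleReflection b i * w) i := by
        rw [IsDescent, inv_simpleReflection_mul_smul, simpleReflection_smul_root,
          R.root_reflectionPerm, R.reflection_apply_self, smul_neg, map_neg]
        have := heightForm_smul_root_ne_zero b w⁻¹ i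
        rw [IsDescent, not_lt] at h
        have := lt_of_le_of_ne h this.symm
        linarith
      rw [weylExtend_of_isDescent b hf _ i h', ← mul_assoc, simpleReflection_mul_self, one_mul]
  refine ⟨⟨⟨weylExtend b f, weylExtend_one b f⟩, fun u w ↦ ?_⟩, fun i ↦ ?_⟩
  · change weylExtend b f (u * w) = weylExtend b f u * weylExtend b f w
    induction u using weylGroup_induction b with
    | one => rw [one_mul, weylExtend_one, one_mul]
    | mul i u ih => rw [mul_assoc, hmul, hmul, ih, mul_assoc]
  · change weylExtend b f (simpleReflection b i) = f i
    have := hmul i 1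
    rwa [mul_one, weylExtend_one, mul_one] at this

end Extend

end WeylGroup

/-! ### Braid differences of Demazure-Lusztig operators in rank two -/

section RankTwo

variable {K V : Type*} [Field K] [AddCommGroup V] [Module K V]

/-- The Demazure-Lusztig operator `v S + (1 - v) a (S - 1)` attached to `S`. -/
def demazureLusztig (S : V → V) (v a : K) (x : V) : V :=
  (v + (1 - v) * a) • S x - ((1 - v) * a) • x

/-- The condition s a = 1 - a is satisfied by a = 1/(1-y) when s y = y⁻¹. It turns S² = 1 into the
Hecke relation (A - v)(A + 1) = 0. -/
theorem demazureLusztig_demazureLusztig {s : K →+* K} {S : V → V}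
    (Sadd : ∀ x y, S (x + y) = S x + S y) (hS : ∀ (f : K) (x : V), S (f • x) = s f • S x)
    (hSS : ∀ x, S (S x) = x) {v a : K} (sv : s v = v) (sa : s a = 1 - a) (x : V) :
    demazureLusztig S v a (demazureLusztig S v a x)
      = v • x - (1 - v) • demazureLusztig S v a x := by
  simp only [demazureLusztig, sub_eq_add_neg, neg_add, ← neg_smul, Sadd, hS, hSS, map_mul,
      map_add, map_neg,
    map_one, sv, sa, smul_add, smul_smul]
  match_scalars <;> ring

theorem demazureLusztig_add {S : V → V} (Sadd : ∀ x y, S (x + y) = S x + S y) (v a : K)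
    (x y : V) : demazureLusztig S v a (x + y)
      = demazureLusztig S v a x + demazureLusztig S v a y := by
  simp only [demazureLusztig, Sadd]
  module

theorem demazureLusztig_smul {s : K →+* K} {S : V → V}
    (hS : ∀ (f : K) (x : V), S (f • x) = s f • S x) {v a f : K} (sf : s f = f)
    (x : V) : demazureLusztig S v a (f • x) = f • demazureLusztig S v a x := by
  simp only [demazureLusztig, hS, sf]
  module

variable {s t : K →+* K} {S T : V → V}
    (Sadd : ∀ x y, S (x + y) = S x + S y) (Tadd : ∀ x y, T (x + y) = T x + T y)
    (hS : ∀ (f : K) (x : V), S (f • x) = s f • S x) (hT : ∀ (f : K) (x : V), T (f • x) = t f • T x)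
    (hSS : ∀ x, S (S x) = x) (hTT : ∀ x, T (T x) = x)

-- In each rank two type the shorter words cancel in the braid difference. What remains is the braid
-- difference of S and T with the product of the leading coefficients over the positive roots. No
-- relation between S and T is assumed.
include hS hT Sadd Tadd in
theorem demazureLusztig_comm_A1A1
    {v w a b : K} (sb : s b = b) (ta : t a = a) (sw : s w = w) (tv : t v = v) (x : V) :
    demazureLusztig S v a (demazureLusztig T w b x) - demazureLusztig T w b (demazureLusztig S v
        a x)
      = ((v + (1 - v) * a) * (w + (1 - w) * b)) • (S (T x) - T (S x)) := by
  simp only [demazureLusztig, sub_eq_add_neg, neg_add, ← neg_smul, Sadd, Tadd, hS, hT, map_mul,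
      map_add,
    map_neg, map_one, sw, tv, sb, ta, smul_add, smul_smul]
  match_scalars <;> ring

-- The hypothesis `h` holds for a = 1/(1-y), b = 1/(1-z), c = 1/(1-yz), and it removes all words
-- shorter than STS and TST. Both operators carry the same parameter v, as the two roots are
-- conjugate in this type.
include hS hT Sadd Tadd hSS hTT in
theorem demazureLusztig_braid_A2
    {v a b c : K} (sa : s a = 1 - a) (sb : s b = c) (sc : s c = b)
    (ta : t a = c) (tb : t b = 1 - b) (tc : t c = a) (sv : s v = v) (tv : t v = v)
    (h : c * (a + b - 1) = a * b) (x : V) :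
    demazureLusztig S v a (demazureLusztig T v b (demazureLusztig S v a x))
      - demazureLusztig T v b (demazureLusztig S v a (demazureLusztig T v b x))
      = ((v + (1 - v) * a) * (v + (1 - v) * b) * (v + (1 - v) * c))
        • (S (T (S x)) - T (S (T x))) := by
  simp only [demazureLusztig, sub_eq_add_neg, neg_add, ← neg_smul, Sadd, Tadd, hS, hT, hSS, hTT,
      map_mul,
    map_add, map_neg, map_one, sv, tv, sa, sb, sc, ta, tb, tc, smul_add, smul_smul]
  match_scalars
  all_goals first
    | ring1
    | linear_combination (1 - v) ^ 2 * (v + (1 - v) * a) * h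
    | linear_combination -(1 - v) ^ 2 * (v + (1 - v) * a) * h
    | linear_combination (1 - v) ^ 2 * (v + (1 - v) * b) * h
    | linear_combination -(1 - v) ^ 2 * (v + (1 - v) * b) * h
    | linear_combination (1 - v) ^ 3 * (a - b) * h

-- The letters a, b, c, d are the values 1/(1-u) at the positive roots y, z, yz, y²z, with h = 1-v
-- and k = 1-w. The letters pa, pc are v+ha, v+hc, while rb, rd are w+kb, w+kd; a prime replaces the
-- root by its negative. By `braid_four_sub` the braid difference is Z D, and this keeps the
-- expansion short.
include hS hT Sadd Tadd hSS hTT in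
theorem rankTwo_B2
    {v w h k a b c d pa pa' rb rb' pc pc' rd rd' y z : K} {Z D : V → V}
    (sh : s h = h) (th : t h = h) (sk : s k = k) (tk : t k = k)
    (sa : s a = 1 - a) (sb : s b = d) (sc : s c = c) (sd : s d = b)
    (ta : t a = c) (tb : t b = 1 - b) (tc : t c = a) (td : t d = d)
    (spa : s pa = pa') (tpa : t pa = pc) (spc : s pc = pc) (tpc : t pc = pa)
    (tpa' : t pa' = pc') (srb' : s rb' = rd')
    (srb : s rb = rd) (trb : t rb = rb') (srd : s rd = rb) (trd : t rd = rd)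
    (hpa : pa * pa' = v + h ^ 2 * (a * (1 - a))) (hpc : pc * pc' = v + h ^ 2 * (c * (1 - c)))
    (hrb : rb * rb' = w + k ^ 2 * (b * (1 - b))) (hrd : rd * rd' = w + k ^ 2 * (d * (1 - d)))
    (hy : 1 - y ≠ 0) (hz : 1 - z ≠ 0) (hyz : 1 - y * z ≠ 0) (hyyz : 1 - y ^ 2 * z ≠ 0)
    (ha : a = 1 / (1 - y)) (hb : b = 1 / (1 - z)) (hc : c = 1 / (1 - y * z))
    (hd : d = 1 / (1 - y ^ 2 * z))
    (hD : ∀ x, D x = (pa * rd) • S (T x) - (rb * pc) • T (S x) + (pa * k * (b - d)) • S x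
      + (rb * h * (c - a)) • T x)
    (hZ : ∀ x, Z x = (pa * rd) • S (T x) + (rb * pc) • T (S x) + (pa * k * (1 - b - d)) • S x
      + (rb * h * (1 - c - a)) • T x + (h * k * (2 * a * b - a - b + 1)) • x) (x : V) :
    Z (D x) = (pa * rb * pc * rd) • (S (T (S (T x))) - T (S (T (S x)))) := by
  have hzy : 1 - z * y ≠ 0 := by rwa [mul_comm]
  have hzyy : 1 - z * y ^ 2 ≠ 0 := by rwa [mul_comm]
  -- These identities between the functions 1/(1-u) are what makes the coefficients of words shorter
  -- than STST vanish. Afterwards a, b, c, d can be treated as independent letters.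
  have e1 : (1 - b - d) * (a + c - 1) + (2 * a * b - a - b + 1) = 0 := by
    subst ha hb hc hd; field_simp; ring
  have e2 : (1 - a - c) * (d * (1 - d) - b * (1 - b)) + (2 * a * b - a - b + 1) * (b - d) = 0 := by
    subst ha hb hc hd; field_simp; ring
  have e3 : c * (1 - c) * (d + b - 1) + (1 - b - d) * (a * (1 - a))
      + (2 * a * b - a - b + 1) * (c - a) = 0 := by
    subst ha hb hc hd; field_simp; ring
  rw [hZ]
  simp only [hD]
  simp only [sub_eq_add_neg, neg_add, ← neg_smul, Sadd, Tadd, hS, hT, hSS, hTT, map_mul,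
    map_add, map_neg, map_one, sh, th, sk, tk, sa, sb, sc, sd, ta, tb, tc, td,
    spa, tpa, spc, tpc, srb, trb, srd, trd, tpa', srb', smul_add, smul_smul]
  clear ha hb hc hd
  match_scalars
  all_goals first
    | ring1
    | linear_combination (pa * rd * h * k) * e1
    | linear_combination -(rb * pc * h * k) * e1
    | linear_combination (pa * h * k ^ 2) * e2 + pa * h * (1 - a - c) * (hrd - hrb)
    | linear_combination (rb * k * h ^ 2) * e3 + rb * k * (d + b - 1) * hpc
        + rb * k * (1 - b - d) * hpa
    | linear_combination -(rd * rd') * hpa - (v + h ^ 2 * (a * (1 - a))) * hrd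
        + (rb * rb') * hpc + (v + h ^ 2 * (c * (1 - c))) * hrb
        + k ^ 2 * (1 - b - d) * (d - b) * hpa + h ^ 2 * (1 - c - a) * (a - c) * hrb

-- First of two stages in the expansion of Z Z D. In type G2 the shorter words survive in Z D and
-- cancel only after the second application of Z.
include hS hT Sadd Tadd hSS hTT in
theorem rankTwo_G2_aux
    {v w h k a b c d e f pa pa' rb rb' pc pc' pd re re' rf y z : K} {Z D : V → V}
    (sh : s h = h) (th : t h = h) (sk : s k = k) (tk : t k = k)
    (sa : s a = 1 - a) (sb : s b = e) (sc : s c = d) (sd : s d = c) (se : s e = b) (sf : s f = f)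
    (ta : t a = c) (tb : t b = 1 - b) (tc : t c = a) (td : t d = d) (te : t e = f) (tf : t f = e)
    (spa : s pa = pa') (tpa : t pa = pc) (tpa' : t pa' = pc') (spc : s pc = pd) (tpc : t pc = pa)
    (tpd : t pd = pd) (srb : s rb = re) (trb : t rb = rb') (srb' : s rb' = re')
    (sre : s re = rb) (tre : t re = rf) (srf : s rf = rf)
    (hpa : pa * pa' = v + h ^ 2 * (a * (1 - a))) (hpc : pc * pc' = v + h ^ 2 * (c * (1 - c)))
    (hrb : rb * rb' = w + k ^ 2 * (b * (1 - b))) (hre : re * re' = w + k ^ 2 * (e * (1 - e)))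
    (hy : 1 - y ≠ 0) (hz : 1 - z ≠ 0) (hyz : 1 - y * z ≠ 0) (hyyz : 1 - y ^ 2 * z ≠ 0)
    (hyyyz : 1 - y ^ 3 * z ≠ 0) (hyyyzz : 1 - y ^ 3 * z ^ 2 ≠ 0)
    (ha : a = 1 / (1 - y)) (hb : b = 1 / (1 - z)) (hc : c = 1 / (1 - y * z))
    (hd : d = 1 / (1 - y ^ 2 * z)) (he : e = 1 / (1 - y ^ 3 * z))
    (hf : f = 1 / (1 - y ^ 3 * z ^ 2))
    (hD : ∀ x, D x = (pa * re) • S (T x) - (rb * pc) • T (S x) + (pa * k * (b - e)) • S x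
      + (rb * h * (c - a)) • T x)
    (hZ : ∀ x, Z x = (pa * re) • S (T x) + (rb * pc) • T (S x) + (pa * k * (1 - b - e)) • S x
      + (rb * h * (1 - c - a)) • T x + (h * k * (2 * a * b - a - b + 1)) • x) (x : V) :
    Z (D x) = (pa * re * pd * rf) • S (T (S (T x))) - (rb * pc * rf * pd) • T (S (T (S x)))
      + (pa * pd * re * k * (b - f)) • S (T (S x)) + (rb * pc * rf * h * (d - a)) • T (S (T x))
      + (pa * re * h * k * (a * b + d * (1 - a - b))) • S (T x)
      - (rb * pc * h * k * (a * c + f * (1 - a - c))) • T (S x)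
      + (pa * h * (w * (c - d) + k ^ 2 * (e * (1 - e) * (1 - a - d) - b * (1 - b) * (1 - a - c)
        + (2 * a * b - a - b + 1) * (b - e)))) • S x
      + (rb * k * (v * (f - e) + h ^ 2 * (c * (1 - c) * (f + b - 1) + a * (1 - a) * (1 - b - e)
        + (2 * a * b - a - b + 1) * (c - a)))) • T x := by
  have h1 : 1 - z * y ≠ 0 := by rwa [mul_comm]
  have h2 : 1 - z * y ^ 2 ≠ 0 := by rwa [mul_comm]
  have h3 : 1 - z * y ^ 3 ≠ 0 := by rwa [mul_comm]
  have h4 : 1 - z ^ 2 * y ^ 3 ≠ 0 := by rwa [mul_comm]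
  have ezST :
      (1 - b - e) * (a + d - 1) + (2 * a * b - a - b + 1) - (a * b + d * (1 - a - b)) = 0 := by
    subst ha hb hc hd he hf; field_simp; ring
  have ezTS :
      (1 - c - a) * (1 - b - f) - (2 * a * b - a - b + 1) + (a * c + f * (1 - a - c)) = 0 := by
    subst ha hb hc hd he hf; field_simp; ring
  rw [hZ]
  simp only [hD]
  simp only [sub_eq_add_neg, neg_add, ← neg_smul, Sadd, Tadd, hS, hT, hSS, hTT, map_mul,
    map_add, map_neg, map_one, sh, th, sk, tk, sa, sb, sc, se,
    sf, ta, tb, tc, td, te, spa, tpa, tpa', spc, tpc, tpd, srb, trb, srb', sre, tre, srf,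
    smul_add, smul_smul]
  clear ha hb hc hd he hf
  match_scalars
  all_goals first
    | ring1
    | linear_combination (pa * re * h * k) * ezST
    | linear_combination (rb * pc * h * k) * ezTS
    | linear_combination pa * h * (1 - a - d) * hre - pa * h * (1 - a - c) * hrb
    | linear_combination rb * k * (f + b - 1) * hpc + rb * k * (1 - b - e) * hpa
    | linear_combination -(re * re') * hpa - (v + h ^ 2 * (a * (1 - a))) * hre
        + (rb * rb') * hpc + (v + h ^ 2 * (c * (1 - c))) * hrb
        + k ^ 2 * (1 - b - e) * (e - b) * hpa + h ^ 2 * (1 - c - a) * (a - c) * hrb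

-- The six positive roots are y, z, yz, y²z, y³z, y³z². Each identity below is named after the word
-- whose coefficient it removes, with I for the empty word. A numeral marks one of the parts into
-- which a coefficient is split according to v w, v k², w h² and h² k².
set_option maxRecDepth 4000 in
set_option maxHeartbeats 1600000 in
include hS hT Sadd Tadd hSS hTT in
theorem rankTwo_G2
    {v w h k a b c d e f pa pa' rb rb' pc pc' pd re re' rf y z : K} {Z D : V → V}
    (sv : s v = v) (sw : s w = w) (tv : t v = v) (tw : t w = w)
    (sh : s h = h) (th : t h = h) (sk : s k = k) (tk : t k = k)
    (sa : s a = 1 - a) (sb : s b = e) (sc : s c = d) (sd : s d = c) (se : s e = b) (sf : s f = f)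
    (ta : t a = c) (tb : t b = 1 - b) (tc : t c = a) (td : t d = d) (te : t e = f) (tf : t f = e)
    (spa : s pa = pa') (tpa : t pa = pc) (tpa' : t pa' = pc') (spc : s pc = pd) (tpc : t pc = pa)
    (spd : s pd = pc) (tpd : t pd = pd) (srb : s rb = re) (trb : t rb = rb') (srb' : s rb' = re')
    (sre : s re = rb) (tre : t re = rf) (srf : s rf = rf) (trf : t rf = re)
    (hpa : pa * pa' = v + h ^ 2 * (a * (1 - a))) (hpc : pc * pc' = v + h ^ 2 * (c * (1 - c)))
    (hrb : rb * rb' = w + k ^ 2 * (b * (1 - b))) (hre : re * re' = w + k ^ 2 * (e * (1 - e)))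
    (hy : 1 - y ≠ 0) (hz : 1 - z ≠ 0) (hyz : 1 - y * z ≠ 0) (hyyz : 1 - y ^ 2 * z ≠ 0)
    (hyyyz : 1 - y ^ 3 * z ≠ 0) (hyyyzz : 1 - y ^ 3 * z ^ 2 ≠ 0)
    (ha : a = 1 / (1 - y)) (hb : b = 1 / (1 - z)) (hc : c = 1 / (1 - y * z))
    (hd : d = 1 / (1 - y ^ 2 * z)) (he : e = 1 / (1 - y ^ 3 * z))
    (hf : f = 1 / (1 - y ^ 3 * z ^ 2))
    (hD : ∀ x, D x = (pa * re) • S (T x) - (rb * pc) • T (S x) + (pa * k * (b - e)) • S x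
      + (rb * h * (c - a)) • T x)
    (hZ : ∀ x, Z x = (pa * re) • S (T x) + (rb * pc) • T (S x) + (pa * k * (1 - b - e)) • S x
      + (rb * h * (1 - c - a)) • T x + (h * k * (2 * a * b - a - b + 1)) • x) (x : V) :
    Z (Z (D x)) - (v * w) • D x = (pa * rb * pc * pd * re * rf)
      • (S (T (S (T (S (T x))))) - T (S (T (S (T (S x)))))) := by
  have h1 : 1 - z * y ≠ 0 := by rwa [mul_comm]
  have h2 : 1 - z * y ^ 2 ≠ 0 := by rwa [mul_comm]
  have h3 : 1 - z * y ^ 3 ≠ 0 := by rwa [mul_comm]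
  have h4 : 1 - z ^ 2 * y ^ 3 ≠ 0 := by rwa [mul_comm]
  have eSTST :
      d * (1 - e) + c * (e - d) + (1 - b - e) * (c + a - 1) + (2 * a * b - a - b + 1) = 0 := by
    subst ha hb hc hd he hf; field_simp; ring
  have eTSTS :
      -((1 - c) * d + e * (1 - (1 - c) - d)) + (1 - c - a) * (1 - b - e) - (2 * a * b - a - b +
      1) = 0 := by
    subst ha hb hc hd he hf; field_simp; ring
  have eSTS :
      (f * (1 - f) * (1 - d - c) - (1 - e) * (1 - (1 - e)) * (1 - d - (1 - a)) + (2 * d * (1 -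
      e) - d - (1 - e) + 1) * ((1 - e) - f)) - (1 - b - e) * ((1 - a) * d + f * (1 - (1 - a) -
      d)) + (2 * a * b - a - b + 1) * (b - f) - (b * (1 - b)) * (1 - c - a) = 0 := by
    subst ha hb hc hd he hf; field_simp; ring
  have eTST :
      (d * (1 - d) * (e + f - 1) + (1 - c) * (1 - (1 - c)) * (1 - f - (1 - b)) + (2 * (1 - c) *
      f - (1 - c) - f + 1) * (d - (1 - c))) + (1 - c - a) * (c * (1 - b) + d * (1 - c - (1 -
      b))) + (2 * a * b - a - b + 1) * (d - a) + (1 - b - e) * (a * (1 - a)) = 0 := by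
    subst ha hb hc hd he hf; field_simp; ring
  have eST1 :
      (1 - b - e) * (f - b) + (b * (1 - b)) = 0 := by
    subst ha hb hc hd he hf; field_simp; ring
  have eST2 :
      (c * (1 - c)) + (1 - c - a) * (d - c) = 0 := by
    subst ha hb hc hd he hf; field_simp; ring
  have eST3 :
      (1 - b - e) * (d * (1 - d) * (f + e - 1) + (1 - a) * (1 - (1 - a)) * (1 - e - b) + (2 *
      (1 - a) * e - (1 - a) - e + 1) * (d - (1 - a))) + (b * (1 - b)) * (c * (1 - c)) + (b * (1
      - b)) * (1 - c - a) * (d - c) + (2 * a * b - a - b + 1) * (a * b + d * (1 - a - b)) = 0 := by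
    subst ha hb hc hd he hf; field_simp; ring
  have eTS1 :
      (1 - c - a) * (a - d) - (a * (1 - a)) = 0 := by
    subst ha hb hc hd he hf; field_simp; ring
  have eTS2 :
      -(e * (1 - e)) + (1 - b - e) * (e - f) = 0 := by
    subst ha hb hc hd he hf; field_simp; ring
  have eTS3 :
      (1 - c - a) * (f * (1 - f) * (1 - c - d) - (1 - b) * (1 - (1 - b)) * (1 - c - a) + (2 * c
      * (1 - b) - c - (1 - b) + 1) * ((1 - b) - f)) - (a * (1 - a)) * (e * (1 - e)) + (1 - b -
      e) * (e - f) * (a * (1 - a)) - (2 * a * b - a - b + 1) * (a * c + f * (1 - a - c)) = 0 := by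
    subst ha hb hc hd he hf; field_simp; ring
  have eS1 :
      (e * (1 - e)) * (b - f) + (b * (1 - b)) * (f - e) = 0 := by
    subst ha hb hc hd he hf; field_simp; ring
  have eS2 :
      ((1 - a) * (1 - (1 - a)) * (b + (1 - e) - 1) + d * (1 - d) * (1 - (1 - e) - f) + (2 * d *
      (1 - e) - d - (1 - e) + 1) * ((1 - a) - d)) + (c * (1 - c)) * (f - e) - (1 - c - a) * (c
      * a + e * (1 - c - a)) + (2 * a * b - a - b + 1) * (c - d) = 0 := by
    subst ha hb hc hd he hf; field_simp; ring
  have eS3 :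
      (e * (1 - e)) * ((1 - a) * (1 - (1 - a)) * (b + (1 - e) - 1) + d * (1 - d) * (1 - (1 - e)
      - f) + (2 * d * (1 - e) - d - (1 - e) + 1) * ((1 - a) - d)) + (b * (1 - b)) * (c * (1 -
      c)) * (f - e) - (1 - c - a) * (c * a + e * (1 - c - a)) * (b * (1 - b)) + (2 * a * b - a
      - b + 1) * (e * (1 - e) * (1 - a - d) - b * (1 - b) * (1 - a - c) + (2 * a * b - a - b +
      1) * (b - e)) = 0 := by
    subst ha hb hc hd he hf; field_simp; ring
  have eT1 :
      (c * (1 - c)) * (d - a) + (a * (1 - a)) * (c - d) = 0 := by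
    subst ha hb hc hd he hf; field_simp; ring
  have eT2 :
      ((1 - b) * (1 - (1 - b)) * (1 - (1 - c) - a) - f * (1 - f) * (1 - (1 - c) - d) + (2 * (1
      - c) * f - (1 - c) - f + 1) * (f - (1 - b))) + (1 - b - e) * ((1 - a) * e + c * (1 - (1 -
      a) - e)) + (e * (1 - e)) * (c - d) + (2 * a * b - a - b + 1) * (f - e) = 0 := by
    subst ha hb hc hd he hf; field_simp; ring
  have eT3 :
      (c * (1 - c)) * ((1 - b) * (1 - (1 - b)) * (1 - (1 - c) - a) - f * (1 - f) * (1 - (1 - c)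
      - d) + (2 * (1 - c) * f - (1 - c) - f + 1) * (f - (1 - b))) + (1 - b - e) * ((1 - a) * e
      + c * (1 - (1 - a) - e)) * (a * (1 - a)) + (a * (1 - a)) * (e * (1 - e)) * (c - d) + (2 *
      a * b - a - b + 1) * (c * (1 - c) * (f + b - 1) + a * (1 - a) * (1 - b - e) + (2 * a * b
      - a - b + 1) * (c - a)) = 0 := by
    subst ha hb hc hd he hf; field_simp; ring
  have eI0 :
      -(d * (1 - a) + b * (1 - d - (1 - a))) + ((1 - c) * f + a * (1 - (1 - c) - f)) + (1 - b -
      e) * (d - c) + (1 - c - a) * (e - f) = 0 := by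
    subst ha hb hc hd he hf; field_simp; ring
  have eI1 :
      -(e * (1 - e)) * (d * (1 - a) + b * (1 - d - (1 - a))) + (b * (1 - b)) * ((1 - c) * f + a
      * (1 - (1 - c) - f)) + (1 - b - e) * (b * (1 - b) * (1 - (1 - a) - c) - e * (1 - e) * (1
      - (1 - a) - d) + (2 * (1 - a) * e - (1 - a) - e + 1) * (e - b)) + (1 - c - a) * (b * (1 -
      b)) * (e - f) = 0 := by
    subst ha hb hc hd he hf; field_simp; ring
  have eI2 :
      -(a * (1 - a)) * (d * (1 - a) + b * (1 - d - (1 - a))) + (c * (1 - c)) * ((1 - c) * f + a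
      * (1 - (1 - c) - f)) + (1 - b - e) * (a * (1 - a)) * (d - c) + (1 - c - a) * (a * (1 - a)
      * (e + (1 - b) - 1) + c * (1 - c) * (1 - (1 - b) - f) + (2 * c * (1 - b) - c - (1 - b) +
      1) * (a - c)) = 0 := by
    subst ha hb hc hd he hf; field_simp; ring
  have eI3 :
      -(a * (1 - a)) * (e * (1 - e)) * (d * (1 - a) + b * (1 - d - (1 - a))) + (b * (1 - b)) *
      (c * (1 - c)) * ((1 - c) * f + a * (1 - (1 - c) - f)) + (1 - b - e) * (a * (1 - a)) * (b
      * (1 - b) * (1 - (1 - a) - c) - e * (1 - e) * (1 - (1 - a) - d) + (2 * (1 - a) * e - (1 -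
      a) - e + 1) * (e - b)) + (1 - c - a) * (b * (1 - b)) * (a * (1 - a) * (e + (1 - b) - 1) +
      c * (1 - c) * (1 - (1 - b) - f) + (2 * c * (1 - b) - c - (1 - b) + 1) * (a - c)) = 0 := by
    subst ha hb hc hd he hf; field_simp; ring
  rw [rankTwo_G2_aux Sadd Tadd hS hT hSS hTT sh th sk tk sa sb sc sd se sf ta tb tc td te
    tf spa tpa tpa' spc tpc tpd srb trb srb' sre tre srf hpa hpc hrb hre hy hz hyz hyyz
    hyyyz hyyyzz ha hb hc hd he hf hD hZ, hZ, hD]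
  simp only [sub_eq_add_neg, neg_add, ← neg_smul, Sadd, Tadd, hS, hT, hSS, hTT, map_mul,
    map_add, map_neg, map_one, map_pow, map_ofNat, sv, tv, sw, tw, sh, th, sk, tk, sa, sb, sc,
        sd, se,
    sf, ta, tb, tc, td, te, tf, spa, tpa, tpa', spc, tpc, spd, tpd, srb, trb, srb', sre, tre,
        srf, trf,
    smul_add, smul_smul]
  clear ha hb hc hd he hf
  match_scalars
  all_goals first
    | ring1
    | linear_combination
        (pa * re * pd * rf * h * k) * eSTST
    | linear_combination
        (rb * pc * pd * rf * h * k) * eTSTS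
    | linear_combination
        (pa * re * pd * h * k ^ 2) * eSTS - pa * re * pd * h * (1 - c - a) * hrb
    | linear_combination
        (rb * pc * rf * k * h ^ 2) * eTST + rb * pc * rf * k * (1 - b - e) * hpa
    | linear_combination
        pa * re * (v * k ^ 2 * eST1 + w * h ^ 2 * eST2 + h ^ 2 * k ^ 2 * eST3 + pc * pc' * hrb
        + (w + k ^ 2 * (b * (1 - b))) * hpc + h ^ 2 * (1 - c - a) * (d - c) * hrb)
    | linear_combination
        rb * pc * (w * h ^ 2 * eTS1 + v * k ^ 2 * eTS2 + h ^ 2 * k ^ 2 * eTS3 - re * re' * hpa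
        - (v + h ^ 2 * (a * (1 - a))) * hre + k ^ 2 * (1 - b - e) * (e - f) * hpa)
    | linear_combination
        pa * k * (v * k ^ 2 * eS1 + w * h ^ 2 * eS2 + h ^ 2 * k ^ 2 * eS3 + (v * (b - f) + h ^
        2 * ((1 - a) * (1 - (1 - a)) * (b + (1 - e) - 1) + d * (1 - d) * (1 - (1 - e) - f) + (2
        * d * (1 - e) - d - (1 - e) + 1) * ((1 - a) - d))) * hre + pc * pc' * (f - e) * hrb +
        (w + k ^ 2 * (b * (1 - b))) * (f - e) * hpc - h ^ 2 * (1 - c - a) * (c * a + e * (1 - c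
        - a)) * hrb)
    | linear_combination
        rb * h * (w * h ^ 2 * eT1 + v * k ^ 2 * eT2 + h ^ 2 * k ^ 2 * eT3 + (w * (d - a) + k ^
        2 * ((1 - b) * (1 - (1 - b)) * (1 - (1 - c) - a) - f * (1 - f) * (1 - (1 - c) - d) + (2
        * (1 - c) * f - (1 - c) - f + 1) * (f - (1 - b)))) * hpc + k ^ 2 * (1 - b - e) * ((1 -
        a) * e + c * (1 - (1 - a) - e)) * hpa + re * re' * (c - d) * hpa + (v + h ^ 2 * (a * (1
        - a))) * (c - d) * hre)
    | linear_combination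
        h * k * (v * w * eI0 + v * k ^ 2 * eI1 + w * h ^ 2 * eI2 + h ^ 2 * k ^ 2 * eI3 - (d *
        (1 - a) + b * (1 - d - (1 - a))) * re * re' * hpa - (d * (1 - a) + b * (1 - d - (1 -
        a))) * (v + h ^ 2 * (a * (1 - a))) * hre + ((1 - c) * f + a * (1 - (1 - c) - f)) * pc *
        pc' * hrb + ((1 - c) * f + a * (1 - (1 - c) - f)) * (w + k ^ 2 * (b * (1 - b))) * hpc +
        (1 - b - e) * (w * (d - c) + k ^ 2 * (b * (1 - b) * (1 - (1 - a) - c) - e * (1 - e) *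
        (1 - (1 - a) - d) + (2 * (1 - a) * e - (1 - a) - e + 1) * (e - b))) * hpa + (1 - c - a)
        * (v * (e - f) + h ^ 2 * (a * (1 - a) * (e + (1 - b) - 1) + c * (1 - c) * (1 - (1 - b)
        - f) + (2 * c * (1 - b) - c - (1 - b) + 1) * (a - c))) * hrb)

end RankTwo

/-- The quadratic relations say A(A + 1 - v) = v and B(B + 1 - w) = w, so Z = AB + (B + 1 - w)(A + 1
- v) plays the role of AB + vw(AB)⁻¹, and by symmetry of BA + vw(BA)⁻¹. Hence Z(AB - BA) = (AB)² -
(BA)², and a second application of Z adds vw(AB - BA) to the difference of cubes. Linearity is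
required only over the subring generated by v and w, because A and B are not linear over K. -/
theorem braid_four_sub {K V : Type*} [CommRing K] [AddCommGroup V] [Module K V] {v w : K}
    {A B : V → V} (Aadd : ∀ x y, A (x + y) = A x + A y) (Badd : ∀ x y, B (x + y) = B x + B y)
    (Asmul : ∀ c ∈ Subring.closure {v, w}, ∀ x, A (c • x) = c • A x)
    (Bsmul : ∀ c ∈ Subring.closure {v, w}, ∀ x, B (c • x) = c • B x)
    (hAA : ∀ x, A (A x) = v • x - (1 - v) • A x) (hBB : ∀ x, B (B x) = w • x - (1 - w) • B x)
    {D Z : V → V} (hD : ∀ x, D x = A (B x) - B (A x))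
    (hZ : ∀ x, Z x = A (B x) + B (A x) + (1 - w) • A x + (1 - v) • B x
      + ((1 - v) * (1 - w)) • x) (x : V) :
    A (B (A (B x))) - B (A (B (A x))) = Z (D x) ∧
    A (B (A (B (A (B x))))) - B (A (B (A (B (A x))))) = Z (Z (D x)) - (v * w) • D x := by
  have hv : v ∈ Subring.closure {v, w} := Subring.subset_closure (by simp)
  have hw : w ∈ Subring.closure {v, w} := Subring.subset_closure (by simp)
  have h1v := sub_mem (one_mem _) hv
  have h1w := sub_mem (one_mem _) hw
  have hneg : -1 ∈ Subring.closure {v, w} := neg_mem (one_mem _)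
  have Asub : ∀ x y, A (x - y) = A x - A y := fun x y ↦ by
    rw [sub_eq_add_neg, ← neg_one_smul K y, Aadd, Asmul _ hneg]; module
  have Bsub : ∀ x y, B (x - y) = B x - B y := fun x y ↦ by
    rw [sub_eq_add_neg, ← neg_one_smul K y, Badd, Bsmul _ hneg]; module
  have key : A (B (A (B x))) - B (A (B (A x))) = Z (D x) := by
    rw [hZ, hD]
    simp only [Asub, Bsub, Asmul _ h1w, Bsmul _ h1v, Asmul _ hw, Bsmul _ hv, hAA, hBB]
    module
  refine ⟨key, ?_⟩
  rw [← key, hZ, hD]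
  simp only [Asub, Bsub, Asmul _ h1w, Bsmul _ h1v, Asmul _ hw, Bsmul _ hv, hAA, hBB]
  module

section Products

variable {K V : Type*} [Field K] [AddCommGroup V] [Module K V] {s t : K →+* K} {S T : V → V}
  (Sadd : ∀ x y, S (x + y) = S x + S y) (Tadd : ∀ x y, T (x + y) = T x + T y)
  (hS : ∀ (f : K) (x : V), S (f • x) = s f • S x) (hT : ∀ (f : K) (x : V), T (f • x) = t f • T x)

include Sadd hS in
theorem demazureLusztig_mul {v w a b e : K} (sb : s b = e) (sw : s w = w) (x : V) :
    demazureLusztig S v a (demazureLusztig T w b x)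
      = ((v + (1 - v) * a) * (w + (1 - w) * e)) • S (T x)
        - ((v + (1 - v) * a) * ((1 - w) * e)) • S x
        - (((1 - v) * a) * (w + (1 - w) * b)) • T x + (((1 - v) * a) * ((1 - w) * b)) • x := by
  simp only [demazureLusztig, sub_eq_add_neg, neg_add, ← neg_smul, Sadd, hS, map_mul, map_add,
    map_neg, map_one, sw, sb, smul_add, smul_smul]
  match_scalars <;> ring

end Products

/-! ### Rank two data and the transfer of braid relations -/

/-- Two semilinear involutions of a vector space over a field `K` with the action on two elements
`y` and `z` of `K` of the simple reflections of a rank two root system with Cartan integers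
`-p` and `-q`. -/
structure RankTwoDatum (K V : Type*) [Field K] [AddCommGroup V] [Module K V] (p q : ℤ) where
  s : K →+* K
  t : K →+* K
  S : AddMonoid.End V
  T : AddMonoid.End V
  S_smul : ∀ (f : K) (x : V), S (f • x) = s f • S x
  T_smul : ∀ (f : K) (x : V), T (f • x) = t f • T x
  S_S : ∀ x, S (S x) = x
  T_T : ∀ x, T (T x) = x
  v : K
  w : K
  s_v : s v = v
  s_w : s w = w
  t_v : t v = v
  t_w : t w = w
  y : K
  z : K
  y_ne_zero : y ≠ 0
  z_ne_zero : z ≠ 0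
  s_y : s y = y⁻¹
  t_z : t z = z⁻¹
  s_z : s z = z * y ^ p
  t_y : t y = y * z ^ q
  -- The positive roots occur as monomials y^i z^j. These three conditions make 1/(1-u) meaningful
  -- and the factors (1-vu)/(1-u), (1-wu)/(1-u) nonzero.
  one_sub_ne_zero : ∀ i j : ℕ, (i, j) ≠ (0, 0) → 1 - y ^ i * z ^ j ≠ 0
  one_sub_v_ne_zero : ∀ i j : ℕ, (i, j) ≠ (0, 0) → 1 - v * (y ^ i * z ^ j) ≠ 0
  one_sub_w_ne_zero : ∀ i j : ℕ, (i, j) ≠ (0, 0) → 1 - w * (y ^ i * z ^ j) ≠ 0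

namespace RankTwoDatum

variable {K V : Type*} [Field K] [AddCommGroup V] [Module K V] {p q : ℤ} (d : RankTwoDatum K V p q)

/-- The datum with the two involutions interchanged. -/
def swap : RankTwoDatum K V q p where
  s := d.t
  t := d.s
  S := d.T
  T := d.S
  S_smul := d.T_smul
  T_smul := d.S_smul
  S_S := d.T_T
  T_T := d.S_S
  v := d.w
  w := d.v
  s_v := d.t_w
  s_w := d.t_v
  t_v := d.s_w
  t_w := d.s_v
  y := d.z
  z := d.y
  y_ne_zero := d.z_ne_zero
  z_ne_zero := d.y_ne_zero
  s_y := d.t_z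
  t_z := d.s_y
  s_z := d.t_y
  t_y := d.s_z
  one_sub_ne_zero i j h := by
    rw [mul_comm]; exact d.one_sub_ne_zero j i (by simpa [and_comm] using h)
  one_sub_v_ne_zero i j h := by
    rw [mul_comm (d.z ^ i)]; exact d.one_sub_w_ne_zero j i (by simpa [and_comm] using h)
  one_sub_w_ne_zero i j h := by
    rw [mul_comm (d.z ^ i)]; exact d.one_sub_v_ne_zero j i (by simpa [and_comm] using h)

/-- The Demazure-Lusztig operator attached to the first involution. -/
def A : AddMonoid.End V :=
  AddMonoidHom.mk' (demazureLusztig d.S d.v (1 / (1 - d.y)))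
    fun x y ↦ demazureLusztig_add (map_add d.S) _ _ x y

/-- The Demazure-Lusztig operator attached to the second involution. -/
def B : AddMonoid.End V := d.swap.A

theorem A_apply (x : V) : d.A x = demazureLusztig d.S d.v (1 / (1 - d.y)) x := rfl

theorem B_apply (x : V) : d.B x = demazureLusztig d.T d.w (1 / (1 - d.z)) x := rfl

theorem map_inv_one_sub {f : K →+* K} {u u' : K} (h : f u = u') :
    f (1 / (1 - u)) = 1 / (1 - u') := by
  simp [h]

theorem inv_one_sub_inv {u : K} (hu : u ≠ 0) (h : 1 - u ≠ 0) :
    1 / (1 - u⁻¹) = 1 - 1 / (1 - u) := by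
  have : u - 1 ≠ 0 := by rw [← neg_sub]; exact neg_ne_zero.mpr h
  field_simp
  ring

theorem coeff_ne_zero {u c : K} (h : 1 - u ≠ 0) (hc : 1 - c * u ≠ 0) :
    c + (1 - c) * (1 / (1 - u)) ≠ 0 := by
  have : c + (1 - c) * (1 / (1 - u)) = (1 - c * u) / (1 - u) := by field_simp; ring
  rw [this]
  exact div_ne_zero hc h

theorem mul_coeff {u c : K} :
    (c + (1 - c) * u) * (c + (1 - c) * (1 - u)) = c + (1 - c) ^ 2 * (u * (1 - u)) := by
  ring

theorem smul_left_cancel_sub {c : K} (hc : c ≠ 0) {x y x' y' : V} (h : x - y = c • (x' - y'))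
    (hxy : x = y) : x' = y' := by
  rw [hxy, sub_self] at h
  exact sub_eq_zero.mp ((smul_eq_zero.mp h.symm).resolve_left hc)

theorem s_a : d.s (1 / (1 - d.y)) = 1 - 1 / (1 - d.y) := by
  rw [map_inv_one_sub d.s_y, inv_one_sub_inv d.y_ne_zero]
  simpa using d.one_sub_ne_zero 1 0 (by simp)

theorem s_coeff {u u' : K} (h : d.s u = u') : d.s (d.v + (1 - d.v) * u) = d.v + (1 - d.v) * u' := by
  simp [h, d.s_v]

theorem s_coeff' {u u' : K} (h : d.s u = u') : d.s (d.w + (1 - d.w) * u) = d.w + (1 - d.w) * u'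
    := by
  simp [h, d.s_w]

theorem s_one_sub_v : d.s (1 - d.v) = 1 - d.v := by simp [d.s_v]

theorem s_one_sub_w : d.s (1 - d.w) = 1 - d.w := by simp [d.s_w]

theorem A_A (x : V) : d.A (d.A x) = d.v • x - (1 - d.v) • d.A x :=
  demazureLusztig_demazureLusztig (map_add d.S) d.S_smul d.S_S d.s_v d.s_a x

theorem A_smul {c : K} (hc : c ∈ Subring.closure {d.v, d.w}) (x : V) : d.A (c • x) = c • d.A x := by
  refine demazureLusztig_smul d.S_smul ?_ x
  have : Subring.closure {d.v, d.w} ≤ RingHom.eqLocus d.s (RingHom.id K) := by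
    rw [Subring.closure_le]
    rintro _ (rfl | rfl)
    exacts [d.s_v, d.s_w]
  exact this hc

/-- The commutator of the two Demazure-Lusztig operators. -/
def commutator (x : V) : V := d.A (d.B x) - d.B (d.A x)

/-- The central element of the algebra generated by the two Demazure-Lusztig operators. -/
def casimir (x : V) : V :=
  d.A (d.B x) + d.B (d.A x) + (1 - d.w) • d.A x + (1 - d.v) • d.B x
    + ((1 - d.v) * (1 - d.w)) • x

theorem braid_sub (x : V) :
    d.A (d.B (d.A (d.B x))) - d.B (d.A (d.B (d.A x))) = d.casimir (d.commutator x) ∧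
    d.A (d.B (d.A (d.B (d.A (d.B x))))) - d.B (d.A (d.B (d.A (d.B (d.A x)))))
      = d.casimir (d.casimir (d.commutator x)) - (d.v * d.w) • d.commutator x :=
  braid_four_sub (map_add d.A) (map_add d.B) (fun _ hc x ↦ d.A_smul hc x)
    (fun _ hc x ↦ d.swap.A_smul (by rwa [Set.pair_comm] at hc) x) d.A_A d.swap.A_A
    (fun _ ↦ rfl) (fun _ ↦ rfl) x

theorem commutator_eq {e c : K} (sb : d.s (1 / (1 - d.z)) = e) (ta : d.t (1 / (1 - d.y)) = c)
    (x : V) :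
    d.commutator x = ((d.v + (1 - d.v) * (1 / (1 - d.y))) * (d.w + (1 - d.w) * e)) • d.S (d.T x)
      - ((d.w + (1 - d.w) * (1 / (1 - d.z))) * (d.v + (1 - d.v) * c)) • d.T (d.S x)
      + ((d.v + (1 - d.v) * (1 / (1 - d.y))) * (1 - d.w) * (1 / (1 - d.z) - e)) • d.S x
      + ((d.w + (1 - d.w) * (1 / (1 - d.z))) * (1 - d.v) * (c - 1 / (1 - d.y))) • d.T x := by
  rw [commutator, A_apply, B_apply, A_apply, B_apply,
    demazureLusztig_mul (map_add d.S) d.S_smul sb d.s_w,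
    demazureLusztig_mul (map_add d.T) d.T_smul ta d.t_v]
  module

theorem casimir_eq {e c : K} (sb : d.s (1 / (1 - d.z)) = e) (ta : d.t (1 / (1 - d.y)) = c)
    (x : V) :
    d.casimir x = ((d.v + (1 - d.v) * (1 / (1 - d.y))) * (d.w + (1 - d.w) * e)) • d.S (d.T x)
      + ((d.w + (1 - d.w) * (1 / (1 - d.z))) * (d.v + (1 - d.v) * c)) • d.T (d.S x)
      + ((d.v + (1 - d.v) * (1 / (1 - d.y))) * (1 - d.w) * (1 - 1 / (1 - d.z) - e)) • d.S x
      + ((d.w + (1 - d.w) * (1 / (1 - d.z))) * (1 - d.v) * (1 - c - 1 / (1 - d.y))) • d.T x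
      + ((1 - d.v) * (1 - d.w) * (2 * (1 / (1 - d.y)) * (1 / (1 - d.z))
        - 1 / (1 - d.y) - 1 / (1 - d.z) + 1)) • x := by
  rw [casimir, A_apply, B_apply, A_apply, B_apply,
    demazureLusztig_mul (map_add d.S) d.S_smul sb d.s_w,
    demazureLusztig_mul (map_add d.T) d.T_smul ta d.t_v, demazureLusztig, demazureLusztig]
  module

theorem one_sub_ne_zero' {i j : ℕ} {u : K} (hu : d.y ^ i * d.z ^ j = u) (h : (i, j) ≠ (0, 0)) :
    1 - u ≠ 0 ∧ d.v + (1 - d.v) * (1 / (1 - u)) ≠ 0 ∧ d.w + (1 - d.w) * (1 / (1 - u)) ≠ 0 := by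
  subst hu
  have := d.one_sub_ne_zero i j h
  exact ⟨this, coeff_ne_zero this (d.one_sub_v_ne_zero i j h),
    coeff_ne_zero this (d.one_sub_w_ne_zero i j h)⟩

theorem altProd_apply_A1A1 (d : RankTwoDatum K V 0 0) (x : V)
    (hx : d.A (d.B x) = d.B (d.A x)) : d.S (d.T x) = d.T (d.S x) := by
  have hy := d.one_sub_ne_zero' (i := 1) (j := 0) (u := d.y) (by simp) (by simp)
  have hz := d.one_sub_ne_zero' (i := 0) (j := 1) (u := d.z) (by simp) (by simp)
  have sb : d.s (1 / (1 - d.z)) = 1 / (1 - d.z) := map_inv_one_sub (by simp [d.s_z])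
  have ta : d.t (1 / (1 - d.y)) = 1 / (1 - d.y) := map_inv_one_sub (by simp [d.t_y])
  exact smul_left_cancel_sub (mul_ne_zero hy.2.1 hz.2.2)
    (demazureLusztig_comm_A1A1 (map_add d.S) (map_add d.T) d.S_smul d.T_smul sb ta
      d.s_w d.t_v x) hx

theorem altProd_apply_A2 (d : RankTwoDatum K V 1 1) (hvw : d.v = d.w) (x : V)
    (hx : d.A (d.B (d.A x)) = d.B (d.A (d.B x))) : d.S (d.T (d.S x)) = d.T (d.S (d.T x)) := by
  have hy := d.one_sub_ne_zero' (i := 1) (j := 0) (u := d.y) (by simp) (by simp)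
  have hz := d.one_sub_ne_zero' (i := 0) (j := 1) (u := d.z) (by simp) (by simp)
  have hyz := d.one_sub_ne_zero' (i := 1) (j := 1) (u := d.y * d.z) (by simp) (by simp)
  have y0 := d.y_ne_zero
  have z0 := d.z_ne_zero
  have sb : d.s (1 / (1 - d.z)) = 1 / (1 - d.y * d.z) :=
    map_inv_one_sub (by simp [d.s_z, mul_comm])
  have sc : d.s (1 / (1 - d.y * d.z)) = 1 / (1 - d.z) :=
    map_inv_one_sub (by rw [map_mul, d.s_y, d.s_z, zpow_one]; field_simp)
  have ta : d.t (1 / (1 - d.y)) = 1 / (1 - d.y * d.z) := map_inv_one_sub (by simp [d.t_y])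
  have tc : d.t (1 / (1 - d.y * d.z)) = 1 / (1 - d.y) :=
    map_inv_one_sub (by rw [map_mul, d.t_y, d.t_z, zpow_one]; field_simp)
  have h : 1 / (1 - d.y * d.z) * (1 / (1 - d.y) + 1 / (1 - d.z) - 1)
      = 1 / (1 - d.y) * (1 / (1 - d.z)) := by
    have h1 := hy.1
    have h2 := hz.1
    have h3 := hyz.1
    field_simp
    ring
  simp only [A_apply, B_apply, ← hvw] at hx
  exact smul_left_cancel_sub (mul_ne_zero (mul_ne_zero hy.2.1 hz.2.1) hyz.2.1)
    (demazureLusztig_braid_A2 (map_add d.S) (map_add d.T) d.S_smul d.T_smul d.S_S d.T_T d.s_a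
      sb sc ta d.swap.s_a tc d.s_v d.t_v h x) hx

theorem altProd_apply_B2 (d : RankTwoDatum K V 2 1) (x : V)
    (hx : d.A (d.B (d.A (d.B x))) = d.B (d.A (d.B (d.A x)))) :
    d.S (d.T (d.S (d.T x))) = d.T (d.S (d.T (d.S x))) := by
  have hy := d.one_sub_ne_zero' (i := 1) (j := 0) (u := d.y) (by simp) (by simp)
  have hz := d.one_sub_ne_zero' (i := 0) (j := 1) (u := d.z) (by simp) (by simp)
  have hyz := d.one_sub_ne_zero' (i := 1) (j := 1) (u := d.y * d.z) (by simp) (by simp)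
  have hyyz := d.one_sub_ne_zero' (i := 2) (j := 1) (u := d.y ^ 2 * d.z) (by simp) (by simp)
  have y0 := d.y_ne_zero
  have z0 := d.z_ne_zero
  have sb : d.s (1 / (1 - d.z)) = 1 / (1 - d.y ^ 2 * d.z) :=
    map_inv_one_sub (by rw [d.s_z, mul_comm]; norm_cast)
  have sd : d.s (1 / (1 - d.y ^ 2 * d.z)) = 1 / (1 - d.z) :=
    map_inv_one_sub (by rw [map_mul, map_pow, d.s_y, d.s_z]; norm_cast; field_simp)
  have sc : d.s (1 / (1 - d.y * d.z)) = 1 / (1 - d.y * d.z) :=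
    map_inv_one_sub (by rw [map_mul, d.s_y, d.s_z]; norm_cast; field_simp)
  have ta : d.t (1 / (1 - d.y)) = 1 / (1 - d.y * d.z) :=
    map_inv_one_sub (by rw [d.t_y]; norm_cast; simp)
  have tc : d.t (1 / (1 - d.y * d.z)) = 1 / (1 - d.y) :=
    map_inv_one_sub (by rw [map_mul, d.t_y, d.t_z]; norm_cast; field_simp)
  have td : d.t (1 / (1 - d.y ^ 2 * d.z)) = 1 / (1 - d.y ^ 2 * d.z) :=
    map_inv_one_sub (by rw [map_mul, map_pow, d.t_y, d.t_z]; norm_cast; field_simp)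
  refine smul_left_cancel_sub (mul_ne_zero (mul_ne_zero (mul_ne_zero hy.2.1 hz.2.2) hyz.2.1)
    hyyz.2.2) ((d.braid_sub x).1.trans (rankTwo_B2 (map_add d.S) (map_add d.T) d.S_smul d.T_smul
    d.S_S d.T_T d.s_one_sub_v d.swap.s_one_sub_w d.s_one_sub_w d.swap.s_one_sub_v
    d.s_a sb sc sd ta d.swap.s_a tc td (d.s_coeff d.s_a)
    (d.swap.s_coeff' ta) (d.s_coeff sc) (d.swap.s_coeff' tc)
    (d.swap.s_coeff' (u := 1 - 1 / (1 - d.y)) (u' := 1 - 1 / (1 - d.y * d.z)) ?_)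
    (d.s_coeff' (u := 1 - 1 / (1 - d.z)) (u' := 1 - 1 / (1 - d.y ^ 2 * d.z)) ?_) (d.s_coeff' sb)
    (d.swap.s_coeff d.swap.s_a) (d.s_coeff' sd) (d.swap.s_coeff td) mul_coeff mul_coeff mul_coeff
    mul_coeff hy.1 hz.1 hyz.1 hyyz.1 rfl rfl rfl rfl (d.commutator_eq sb ta) (d.casimir_eq sb ta)
    x)) hx
  · rw [map_sub, map_one]; congr 1
  · rw [map_sub, map_one, sb]

theorem altProd_apply_G2 (d : RankTwoDatum K V 3 1) (x : V)
    (hx : d.A (d.B (d.A (d.B (d.A (d.B x))))) = d.B (d.A (d.B (d.A (d.B (d.A x)))))) :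
    d.S (d.T (d.S (d.T (d.S (d.T x))))) = d.T (d.S (d.T (d.S (d.T (d.S x))))) := by
  have hy := d.one_sub_ne_zero' (i := 1) (j := 0) (u := d.y) (by simp) (by simp)
  have hz := d.one_sub_ne_zero' (i := 0) (j := 1) (u := d.z) (by simp) (by simp)
  have hyz := d.one_sub_ne_zero' (i := 1) (j := 1) (u := d.y * d.z) (by simp) (by simp)
  have hyyz := d.one_sub_ne_zero' (i := 2) (j := 1) (u := d.y ^ 2 * d.z) (by simp) (by simp)
  have hyyyz := d.one_sub_ne_zero' (i := 3) (j := 1) (u := d.y ^ 3 * d.z) (by simp) (by simp)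
  have hyyyzz := d.one_sub_ne_zero' (i := 3) (j := 2) (u := d.y ^ 3 * d.z ^ 2) (by simp) (by simp)
  have y0 := d.y_ne_zero
  have z0 := d.z_ne_zero
  have sb : d.s (1 / (1 - d.z)) = 1 / (1 - d.y ^ 3 * d.z) :=
    map_inv_one_sub (by rw [d.s_z, mul_comm]; norm_cast)
  have se : d.s (1 / (1 - d.y ^ 3 * d.z)) = 1 / (1 - d.z) :=
    map_inv_one_sub (by rw [map_mul, map_pow, d.s_y, d.s_z]; norm_cast; field_simp)
  have sc : d.s (1 / (1 - d.y * d.z)) = 1 / (1 - d.y ^ 2 * d.z) :=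
    map_inv_one_sub (by rw [map_mul, d.s_y, d.s_z]; norm_cast; field_simp)
  have sd : d.s (1 / (1 - d.y ^ 2 * d.z)) = 1 / (1 - d.y * d.z) :=
    map_inv_one_sub (by rw [map_mul, map_pow, d.s_y, d.s_z]; norm_cast; field_simp)
  have sf : d.s (1 / (1 - d.y ^ 3 * d.z ^ 2)) = 1 / (1 - d.y ^ 3 * d.z ^ 2) :=
    map_inv_one_sub (by rw [map_mul, map_pow, map_pow, d.s_y, d.s_z]; norm_cast; field_simp)
  have ta : d.t (1 / (1 - d.y)) = 1 / (1 - d.y * d.z) :=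
    map_inv_one_sub (by rw [d.t_y]; norm_cast; simp)
  have tc : d.t (1 / (1 - d.y * d.z)) = 1 / (1 - d.y) :=
    map_inv_one_sub (by rw [map_mul, d.t_y, d.t_z]; norm_cast; field_simp)
  have td : d.t (1 / (1 - d.y ^ 2 * d.z)) = 1 / (1 - d.y ^ 2 * d.z) :=
    map_inv_one_sub (by rw [map_mul, map_pow, d.t_y, d.t_z]; norm_cast; field_simp)
  have te : d.t (1 / (1 - d.y ^ 3 * d.z)) = 1 / (1 - d.y ^ 3 * d.z ^ 2) :=
    map_inv_one_sub (by rw [map_mul, map_pow, d.t_y, d.t_z]; norm_cast; field_simp)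
  have tf : d.t (1 / (1 - d.y ^ 3 * d.z ^ 2)) = 1 / (1 - d.y ^ 3 * d.z) :=
    map_inv_one_sub (by rw [map_mul, map_pow, map_pow, d.t_y, d.t_z]; norm_cast; field_simp)
  refine smul_left_cancel_sub (mul_ne_zero (mul_ne_zero (mul_ne_zero (mul_ne_zero (mul_ne_zero
    hy.2.1 hz.2.2) hyz.2.1) hyyz.2.1) hyyyz.2.2) hyyyzz.2.2) ((d.braid_sub x).2.trans
    (rankTwo_G2 (map_add d.S) (map_add d.T) d.S_smul d.T_smul
    d.S_S d.T_T d.s_v d.s_w d.t_v d.t_w d.s_one_sub_v d.swap.s_one_sub_w d.s_one_sub_w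
    d.swap.s_one_sub_v d.s_a sb sc sd se sf ta d.swap.s_a tc td te tf (d.s_coeff d.s_a)
    (d.swap.s_coeff' ta)
    (d.swap.s_coeff' (u := 1 - 1 / (1 - d.y)) (u' := 1 - 1 / (1 - d.y * d.z)) ?_)
    (d.s_coeff sc) (d.swap.s_coeff' tc) (d.s_coeff sd) (d.swap.s_coeff' td) (d.s_coeff' sb)
    (d.swap.s_coeff d.swap.s_a)
    (d.s_coeff' (u := 1 - 1 / (1 - d.z)) (u' := 1 - 1 / (1 - d.y ^ 3 * d.z)) ?_) (d.s_coeff' se)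
    (d.swap.s_coeff te) (d.s_coeff' sf) (d.swap.s_coeff tf) mul_coeff mul_coeff mul_coeff
    mul_coeff hy.1 hz.1 hyz.1 hyyz.1 hyyyz.1 hyyyzz.1 rfl rfl rfl rfl rfl rfl
    (d.commutator_eq sb ta) (d.casimir_eq sb ta) x)) hx
  · rw [map_sub, map_one]; congr 1
  · rw [map_sub, map_one, sb]

/-- If the braid relation holds for the Demazure-Lusztig operators at one vector, it holds for the
involutions at that vector. -/
theorem altProd_apply_of_demazureLusztig {m : ℕ} (h : IsBond p q m) (hvw : m = 3 → d.v = d.w)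
    (x : V) (hx : altProd d.A d.B m x = altProd d.B d.A m x) :
    altProd d.S d.T m x = altProd d.T d.S m x := by
  cases h
  · exact d.altProd_apply_A1A1 x hx
  · exact d.altProd_apply_A2 (hvw rfl) x hx
  · exact d.altProd_apply_B2 x hx
  · exact (d.swap.altProd_apply_B2 x hx.symm).symm
  · exact d.altProd_apply_G2 x hx
  · exact (d.swap.altProd_apply_G2 x hx.symm).symm

end RankTwoDatum

/-! ### Pairings of weights and the arithmetic of m(α) -/

section Pairing

variable {ι E F : Type*} [NormedAddCommGroup E] [InnerProductSpace ℝ E]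
  [AddCommGroup F] [Module ℝ F] {R : RootPairing ι ℝ E F}

theorem pair_add (lam mu : weightLattice R) (i : ι) :
    pair R (lam + mu) i = pair R lam i + pair R mu i := by
  have : (pair R (lam + mu) i : ℝ) = (pair R lam i + pair R mu i : ℤ) := by
    push_cast; simp only [cast_pair]; simp
  exact_mod_cast this

/-- The linear form `lam ↦ (lam, α^∨)` on the weight lattice. -/
def pairHom (i : ι) : weightLattice R →+ ℤ :=
  AddMonoidHom.mk' (fun lam ↦ pair R lam i) fun lam mu ↦ pair_add lam mu i

theorem pair_neg (lam : weightLattice R) (i : ι) : pair R (-lam) i = -pair R lam i :=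
  map_neg (pairHom i) lam

theorem pair_sub (lam mu : weightLattice R) (i : ι) :
    pair R (lam - mu) i = pair R lam i - pair R mu i :=
  map_sub (pairHom i) lam mu

theorem pair_zsmul (c : ℤ) (lam : weightLattice R) (i : ι) :
    pair R (c • lam) i = c * pair R lam i :=
  (map_zsmul (pairHom i) c lam).trans (smul_eq_mul _ _)

theorem pair_nsmul (c : ℕ) (lam : weightLattice R) (i : ι) :
    pair R (c • lam) i = c * pair R lam i :=
  (map_nsmul (pairHom i) c lam).trans (nsmul_eq_mul _ _)

theorem pair_sum {κ : Type*} (s : Finset κ) (f : κ → weightLattice R) (i : ι) :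
    pair R (∑ k ∈ s, f k) i = ∑ k ∈ s, pair R (f k) i :=
  map_sum (pairHom i) f s

theorem pair_reflectionPerm (i j : ι) (lam : weightLattice R) :
    pair R lam (R.reflectionPerm i j) = pair R ((RootPairing.weylGroup.ofIdx R i : W R) • lam) j
        := by
  have : (pair R lam (R.reflectionPerm i j) : ℝ)
      = pair R ((RootPairing.weylGroup.ofIdx R i : W R) • lam) j := by
    rw [cast_pair, cast_pair]
    exact (R.coroot'_reflection (i := i) (j := j) (lam : E)).symm
  exact_mod_cast this

variable [R.IsCrystallographic]

theorem pair_rootP (i j : ι) : pair R (rootP R i) j = R.pairingIn ℤ i j := by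
  have : (pair R (rootP R i) j : ℝ) = R.pairingIn ℤ i j := by
    rw [cast_pair]
    exact (R.algebraMap_pairingIn ℤ i j).symm
  exact_mod_cast this

@[simp]
theorem pair_rootP_self (i : ι) : pair R (rootP R i) i = 2 := by
  rw [pair_rootP, RootPairing.pairingIn_same]

theorem ofIdx_smul_weight (i : ι) (lam : weightLattice R) :
    (RootPairing.weylGroup.ofIdx R i : W R) • lam = lam - pair R lam i • rootP R i := by
  refine Subtype.ext ?_
  rw [coe_smul, ofIdx_smul]
  change _ = (lam : E) - pair R lam i • R.root i
  rw [← Int.cast_smul_eq_zsmul ℝ, cast_pair]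

theorem ofIdx_smul_rootP (i j : ι) :
    (RootPairing.weylGroup.ofIdx R i : W R) • rootP R j = rootP R (R.reflectionPerm i j) :=
  Subtype.ext (R.root_reflectionPerm i j).symm

theorem simpleReflection_smul_weight {b : R.Base} (i : b.support) (lam : weightLattice R) :
    simpleReflection b i • lam = lam - pair R lam i • rootP R i := ofIdx_smul_weight (i : ι) lam

theorem pair_simpleReflection_smul {b : R.Base} (i : b.support) (lam : weightLattice R) (j : ι) :
    pair R (simpleReflection b i • lam) j = pair R lam j - pair R lam i * R.pairingIn ℤ i j := by
  rw [simpleReflection_smul_weight, pair_sub, pair_zsmul, pair_rootP]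

@[simp]
theorem pair_simpleReflection_smul_self {b : R.Base} (i : b.support) (lam : weightLattice R) :
    pair R (simpleReflection b i • lam) i = -pair R lam i := by
  rw [pair_simpleReflection_smul, RootPairing.pairingIn_same]
  ring

theorem rootP_mem (L : AddSubgroup (weightLattice R)) [h : Fact (rootLattice R ≤ L)] (i : ι) :
    rootP R i ∈ L :=
  h.out (AddSubgroup.subset_closure ⟨i, rfl⟩)

omit [R.IsCrystallographic] in
theorem pair_fundamentalWeight [R.IsRootSystem] [DecidableEq ι] {b : R.Base} (i j : b.support) :
    pair R (fundamentalWeight b i) j = if j = i then 1 else 0 := by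
  have : (pair R (fundamentalWeight b i) j : ℝ) = (if j = i then 1 else 0 : ℤ) := by
    rw [cast_pair]
    exact (fundamentalWeightE_coroot b i j).trans (by split_ifs <;> simp)
  exact_mod_cast this

end Pairing

namespace MetaplecticDatum

variable {ι E F : Type*} [NormedAddCommGroup E] [InnerProductSpace ℝ E]
  [AddCommGroup F] [Module ℝ F] {R : RootPairing ι ℝ E F} [R.IsCrystallographic]
  (D : MetaplecticDatum R)

/-- The integer `Q(α)`. -/
def qRoot (i : ι) : ℤ := ⌊D.Q (rootP R i)⌋

theorem cast_qRoot (i : ι) : (D.qRoot i : ℚ) = D.Q (rootP R i) := by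
  obtain ⟨z, hz⟩ := D.Q_int (rootP R i) (AddSubgroup.subset_closure ⟨i, rfl⟩)
  simp [qRoot, hz]

theorem B_smul (w : W R) (lam mu : weightLattice R) : D.B (w • lam) (w • mu) = D.B lam mu := by
  simp only [B, QuadraticMap.polar, ← smul_add, D.Q_smul]

/-- Invariance under s_α gives B(λ,α) = B(s_αλ,-α) = -B(λ,α) + (λ,α^∨) B(α,α), and B(α,α) = 2Q(α).
-/
theorem B_rootP (lam : weightLattice R) (i : ι) :
    D.B lam (rootP R i) = D.qRoot i * pair R lam i := by
  have h1 := D.B_smul (RootPairing.weylGroup.ofIdx R i) lam (rootP R i)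
  rw [ofIdx_smul_weight, ofIdx_smul_weight, pair_rootP_self, B, B, sub_eq_add_neg lam,
    QuadraticMap.polar_add_left, ← neg_zsmul, QuadraticMap.polar_smul_left_of_tower,
    show rootP R i - (2 : ℤ) • rootP R i = -rootP R i by module, QuadraticMap.polar_neg_right,
    QuadraticMap.polar_neg_right, QuadraticMap.polar_self, ← D.cast_qRoot] at h1
  rw [B]
  simp only [smul_neg, zsmul_eq_mul, nsmul_eq_mul] at h1
  push_cast at h1
  linarith

theorem qRoot_mul_pairingIn (i j : ι) :
    D.qRoot i * R.pairingIn ℤ j i = D.qRoot j * R.pairingIn ℤ i j := by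
  have h := QuadraticMap.polar_comm D.Q (rootP R i) (rootP R j)
  have h1 := D.B_rootP (rootP R i) j
  have h2 := D.B_rootP (rootP R j) i
  rw [pair_rootP] at h1 h2
  have : (D.qRoot i * R.pairingIn ℤ j i : ℚ) = D.qRoot j * R.pairingIn ℤ i j := by
    rw [← h1, ← h2]; exact h.symm
  exact_mod_cast this

theorem floor_sub_B (lam : weightLattice R) (i : ι) :
    ⌊D.Q (rootP R i) - D.B lam (rootP R i)⌋ = D.qRoot i * (1 - pair R lam i) := by
  rw [B_rootP, ← cast_qRoot]
  rw [mul_sub, mul_one]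
  exact_mod_cast Int.floor_intCast (R := ℚ) (D.qRoot i - D.qRoot i * pair R lam i)

theorem m_mul_gcd (i : ι) : D.m i * Nat.gcd D.n (D.qRoot i).natAbs = D.n :=
  Nat.div_mul_cancel (Nat.gcd_dvd_left _ _)

theorem m_pos (i : ι) : 0 < D.m i :=
  Nat.pos_of_ne_zero fun h ↦ D.n_pos.ne' (by rw [← D.m_mul_gcd i, h, zero_mul])

theorem cast_m_pos (i : ι) : (0 : ℤ) < D.m i := by exact_mod_cast D.m_pos i

theorem m_dvd_n (i : ι) : D.m i ∣ D.n := ⟨_, (D.m_mul_gcd i).symm⟩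

/-- Dividing n and Q(α) by their greatest common divisor leaves the coprime numbers m(α) and u. This
is how periodicity modulo n of the g_j becomes periodicity modulo m(α) in (λ,α^∨). -/
theorem n_dvd_qRoot_mul_iff (i : ι) (j : ℤ) : (D.n : ℤ) ∣ D.qRoot i * j ↔ (D.m i : ℤ) ∣ j := by
  set g := Nat.gcd D.n (D.qRoot i).natAbs with hg
  have hg0 : 0 < g := Nat.gcd_pos_of_pos_left _ D.n_pos
  obtain ⟨u, hu⟩ : (g : ℤ) ∣ D.qRoot i := Int.natCast_dvd.mpr (Nat.gcd_dvd_right _ _)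
  have hn : (D.n : ℤ) = g * D.m i := by
    rw [← D.m_mul_gcd i]; push_cast; ring
  rw [hu, mul_assoc, hn, mul_dvd_mul_iff_left (by exact_mod_cast hg0.ne')]
  refine ⟨fun h ↦ IsCoprime.dvd_of_dvd_mul_left ?_ h, fun h ↦ h.mul_left u⟩
  have h1 := Nat.coprime_div_gcd_div_gcd (m := D.n) (n := (D.qRoot i).natAbs) hg0
  rw [Int.isCoprime_iff_gcd_eq_one, Int.gcd, Int.natAbs_natCast]
  convert h1 using 1
  rw [← hg, hu, Int.natAbs_mul, Int.natAbs_natCast, Nat.mul_div_cancel_left _ hg0]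
  rfl

theorem mem_Pm_iff {lam : weightLattice R} :
    lam ∈ D.Pm ↔ ∀ i, (D.m i : ℤ) ∣ pair R lam i := by
  refine forall_congr' fun i ↦ ?_
  have h0 : (D.m i : ℝ) ≠ 0 := by exact_mod_cast (D.m_pos i).ne'
  refine exists_congr fun z ↦ ?_
  rw [← cast_pair, inv_mul_eq_iff_eq_mul₀ h0]
  norm_cast

/-- As n divides m(α)Q(α), the symmetry Q(α)(β,α^∨) = Q(β)(α,β^∨) moves the divisibility to β. -/
theorem rootM_mem_Pm (i : ι) : D.rootM i ∈ D.Pm := by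
  refine D.mem_Pm_iff.mpr fun j ↦ (D.n_dvd_qRoot_mul_iff j _).mp ?_
  rw [rootM, pair_nsmul, pair_rootP, mul_left_comm, ← D.qRoot_mul_pairingIn i j, ← mul_assoc]
  refine Dvd.dvd.mul_right ?_ _
  rw [mul_comm]
  exact (D.n_dvd_qRoot_mul_iff i _).mpr dvd_rfl

theorem n_smul_mem_Pm (lam : weightLattice R) : D.n • lam ∈ D.Pm := by
  refine D.mem_Pm_iff.mpr fun i ↦ ?_
  rw [pair_nsmul]
  exact Dvd.dvd.mul_right (by exact_mod_cast D.m_dvd_n i) _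

theorem rootM_ne_zero (i : ι) : D.rootM i ≠ 0 := fun h ↦ by
  have h1 : pair R (D.rootM i) i = D.m i * 2 := by rw [rootM, pair_nsmul, pair_rootP_self]
  rw [h, show pair R 0 i = 0 from map_zero (pairHom i)] at h1
  have := D.cast_m_pos i
  omega

theorem rootM_mem (L : AddSubgroup (weightLattice R)) [Fact (rootLattice R ≤ L)] (i : ι) :
    D.rootM i ∈ L ⊓ D.Pm :=
  ⟨nsmul_mem (rootP_mem L i) _, D.rootM_mem_Pm i⟩

theorem zsmul_rootM (N : ℤ) (i : ι) : N • D.rootM i = (N * D.m i) • rootP R i := by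
  rw [rootM, ← natCast_zsmul, ← mul_zsmul]

@[simp]
theorem simpleReflection_smul_rootM {b : R.Base} (i : b.support) :
    simpleReflection b i • D.rootM i = -D.rootM i := by
  rw [simpleReflection_smul_weight, rootM, pair_nsmul, pair_rootP_self]
  module

/-- Subtracting r(λ) removes the remainder of (λ,α_i^∨) modulo m(α_i), and division by m(α_i) leaves
the integer quotient. -/
theorem pairM_q [R.IsRootSystem] (b : R.Base) (i : b.support) (lam : weightLattice R) :
    D.pairM (D.q b lam) i = pair R lam i / D.m i := by
  classical
  have h0 : (D.m i : ℝ) ≠ 0 := by exact_mod_cast (D.m_pos i).ne'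
  have h1 : pair R (D.q b lam) i = D.m i * (pair R lam i / D.m i) := by
    rw [q, pair_sub, r, pair_sum]
    simp only [pair_zsmul, pair_fundamentalWeight, mul_ite, mul_one, mul_zero, Finset.sum_ite_eq,
      Finset.mem_univ, if_true]
    have := Int.emod_add_mul_ediv (pair R lam i) (D.m i)
    omega
  rw [pairM, ← cast_pair, h1]
  push_cast
  rw [inv_mul_cancel_left₀ h0, Int.floor_intCast]

end MetaplecticDatum

/-! ### Monomials in ℂ(P) and spanning sets of ℂ(L) -/

section Monomials

variable {ι E F : Type*} [NormedAddCommGroup E] [InnerProductSpace ℝ E]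
  [AddCommGroup F] [Module ℝ F] {R : RootPairing ι ℝ E F}

@[simp]
theorem X_zero : X R 0 = 1 := by
  rw [X, ← AddMonoidAlgebra.one_def, map_one]

theorem X_neg (lam : weightLattice R) : X R (-lam) = (X R lam)⁻¹ := by
  refine eq_inv_of_mul_eq_one_left ?_
  rw [← X_add, neg_add_cancel, X_zero]

theorem X_ne_zero (lam : weightLattice R) : X R lam ≠ 0 := fun h ↦ by
  have := X_add R lam (-lam)
  rw [h, add_neg_cancel, X_zero, zero_mul] at this
  exact one_ne_zero this

theorem X_sub (lam mu : weightLattice R) : X R (lam - mu) = X R lam / X R mu := by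
  rw [sub_eq_add_neg, X_add, X_neg, div_eq_mul_inv]

theorem X_nsmul (n : ℕ) (lam : weightLattice R) : X R (n • lam) = X R lam ^ n := by
  induction n with
  | zero => simp
  | succ n ih => rw [succ_nsmul, X_add, ih, pow_succ]

theorem X_zsmul (n : ℤ) (lam : weightLattice R) : X R (n • lam) = X R lam ^ n := by
  cases n with
  | ofNat n => simpa using X_nsmul n lam
  | negSucc n => rw [negSucc_zsmul, X_neg, X_nsmul, zpow_negSucc]

theorem algebraMap_eq (c : ℂ) : algebraMap ℂ (CP R) c
    = algebraMap (GroupAlgebraP R) (CP R) (AddMonoidAlgebra.single 0 c) := by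
  rw [IsScalarTower.algebraMap_apply ℂ (GroupAlgebraP R) (CP R)]
  rfl

theorem one_sub_mul_X_ne_zero (c : ℂ) {lam : weightLattice R} (h : lam ≠ 0) :
    1 - algebraMap ℂ (CP R) c * X R lam ≠ 0 := by
  rw [algebraMap_eq, X, ← map_mul, ← map_one (algebraMap (GroupAlgebraP R) (CP R)), ← map_sub]
  refine (map_ne_zero_iff _ (IsFractionRing.injective (GroupAlgebraP R) (CP R))).mpr fun h0 ↦ ?_
  rw [AddMonoidAlgebra.one_def, AddMonoidAlgebra.single_mul_single, zero_add, mul_one] at h0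
  rcases AddMonoidAlgebra.single_inj.mp (sub_eq_zero.mp h0) with h1 | h1
  · exact h h1.1.symm
  · exact one_ne_zero h1.1

theorem one_sub_X_ne_zero {lam : weightLattice R} (h : lam ≠ 0) : 1 - X R lam ≠ 0 := by
  simpa using one_sub_mul_X_ne_zero 1 h

theorem algebraMap_mem_C (L : AddSubgroup (weightLattice R)) (c : ℂ) :
    algebraMap ℂ (CP R) c ∈ C R L := (C R L).algebraMap_mem c

theorem C_top : C R ⊤ = ⊤ := by
  have h : ∀ a : GroupAlgebraP R, algebraMap (GroupAlgebraP R) (CP R) a ∈ C R ⊤ := by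
    intro a
    induction a using AddMonoidAlgebra.induction_linear with
    | zero => rw [map_zero]; exact zero_mem _
    | add f g hf hg => rw [map_add]; exact add_mem hf hg
    | single lam c =>
      have : (AddMonoidAlgebra.single lam c : GroupAlgebraP R)
          = AddMonoidAlgebra.single 0 c * AddMonoidAlgebra.single lam 1 := by
        rw [AddMonoidAlgebra.single_mul_single, zero_add, mul_one]
      rw [this, map_mul, ← algebraMap_eq]
      exact mul_mem (algebraMap_mem_C _ _) (X_mem_C R (AddSubgroup.mem_top lam))
  refine eq_top_iff.mpr fun x _ ↦ ?_
  obtain ⟨a, c, -, rfl⟩ := IsFractionRing.div_surjective (A := GroupAlgebraP R) x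
  exact div_mem (h a) (h c)

/-- Each x^λ with λ in L is algebraic over K = ℂ(L ∩ P^m), because x^{nλ} lies in K. Hence the field
generated over K by these monomials is already the algebra they generate, which is their K-span. -/
theorem C_induction [R.IsCrystallographic] (D : MetaplecticDatum R)
    (L : AddSubgroup (weightLattice R)) {p : CP R → Prop}
    (mul_X : ∀ f ∈ C R (L ⊓ D.Pm), ∀ lam ∈ L, p (f * X R lam))
    (add : ∀ x y, p x → p y → p (x + y)) {x : CP R} (hx : x ∈ C R L) : p x := by
  set K := C R (L ⊓ D.Pm)
  have halg : ∀ y ∈ X R '' (L : Set (weightLattice R)), IsAlgebraic K y := by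
    rintro _ ⟨lam, hlam, rfl⟩
    refine IsIntegral.isAlgebraic (IsIntegral.of_pow D.n_pos ?_)
    rw [← X_nsmul]
    exact isIntegral_algebraMap
      (x := (⟨X R (D.n • lam), X_mem_C R ⟨nsmul_mem hlam _, D.n_smul_mem_Pm lam⟩⟩ : K))
  have hx' : x ∈ IntermediateField.adjoin K (X R '' (L : Set (weightLattice R))) := by
    have : C R L ≤ (IntermediateField.adjoin K (X R '' (L : Set (weightLattice
        R)))).restrictScalars ℂ :=
      IntermediateField.adjoin_le_iff.mpr (IntermediateField.subset_adjoin _ _)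
    exact this hx
  rw [← IntermediateField.mem_toSubalgebra, IntermediateField.adjoin_toSubalgebra_of_isAlgebraic
      halg,
    ← Subalgebra.mem_toSubmodule, Algebra.adjoin_eq_span] at hx'
  have hclosure : ∀ y ∈ Submonoid.closure (X R '' (L : Set (weightLattice R))),
      ∃ lam ∈ L, X R lam = y := by
    intro y hy
    induction hy using Submonoid.closure_induction with
    | mem y hy => exact hy
    | one => exact ⟨0, zero_mem L, X_zero⟩
    | mul y z _ _ hy hz =>
      obtain ⟨lam, hlam, rfl⟩ := hy
      obtain ⟨mu, hmu, rfl⟩ := hz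
      exact ⟨lam + mu, add_mem hlam hmu, X_add R lam mu⟩
  clear hx
  -- Since `p` is not known to be stable under multiplication by K, the induction carries an
  -- arbitrary factor f in K.
  suffices h : ∀ f ∈ K, p (f * x) by simpa using h 1 (one_mem _)
  induction hx' using Submodule.span_induction with
  | mem y hy =>
    obtain ⟨lam, hlam, rfl⟩ := hclosure y hy
    exact fun f hf ↦ mul_X f hf lam hlam
  | zero => exact fun f _ ↦ by simpa using mul_X 0 (zero_mem _) 0 (zero_mem _)
  | add x y _ _ hx hy => exact fun f hf ↦ by rw [mul_add]; exact add _ _ (hx f hf) (hy f hf)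
  | smul c y _ hy =>
    intro f hf
    rw [Algebra.smul_def, ← mul_assoc]
    exact hy _ (mul_mem hf c.2)

end Monomials

/-! ### Projections to congruence classes of weights -/

section Twist

variable {ι E F : Type*} [NormedAddCommGroup E] [InnerProductSpace ℝ E]
  [AddCommGroup F] [Module ℝ F] {R : RootPairing ι ℝ E F}

/-- The algebra endomorphism `x^lam ↦ z ^ (lam, α^∨) x^lam` of `ℂ[P]`. -/
def twistHom (z : ℂˣ) (i : ι) : GroupAlgebraP R →ₐ[ℂ] GroupAlgebraP R :=
  AddMonoidAlgebra.lift ℂ (GroupAlgebraP R) (weightLattice R)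
    { toFun := fun lam ↦ AddMonoidAlgebra.single lam.toAdd ((z ^ pair R lam.toAdd i : ℂˣ) : ℂ)
      map_one' := by
        rw [AddMonoidAlgebra.one_def, toAdd_one, show pair R 0 i = 0 from map_zero (pairHom i)]
        simp
      map_mul' := fun lam mu ↦ by
        rw [AddMonoidAlgebra.single_mul_single, toAdd_mul, pair_add, zpow_add, Units.val_mul] }

theorem twistHom_single (z : ℂˣ) (i : ι) (lam : weightLattice R) :
    twistHom z i (AddMonoidAlgebra.single lam 1 : GroupAlgebraP R)
      = AddMonoidAlgebra.single lam ((z ^ pair R lam i : ℂˣ) : ℂ) := by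
  rw [twistHom, AddMonoidAlgebra.lift_single, one_smul]
  rfl

theorem single_eq_smul (lam : weightLattice R) (c : ℂ) :
    (AddMonoidAlgebra.single lam c : GroupAlgebraP R) = c • AddMonoidAlgebra.single lam 1 := by
  rw [AddMonoidAlgebra.smul_single, smul_eq_mul, mul_one]

theorem twistHom_comp {z w : ℂˣ} (h : z * w = 1) (i : ι) :
    (twistHom (R := R) z i).comp (twistHom w i) = AlgHom.id ℂ _ := by
  refine AddMonoidAlgebra.algHom_ext (fun lam ↦ ?_) (Subsingleton.elim _ _)
  rw [AlgHom.comp_apply, twistHom_single, single_eq_smul, map_smul, twistHom_single,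
    single_eq_smul (R := R) lam (_ : ℂ), smul_smul, ← Units.val_mul, ← mul_zpow, mul_comm w, h]
  simp

/-- The automorphism `x^lam ↦ z ^ (lam, α^∨) x^lam` of `ℂ(P)`. -/
def twist (z : ℂˣ) (i : ι) : CP R ≃ₐ[ℂ] CP R :=
  IsFractionRing.fieldEquivOfAlgEquiv ℂ (CP R) (CP R)
    (AlgEquiv.ofAlgHom (twistHom (R := R) z i) (twistHom z⁻¹ i) (twistHom_comp (mul_inv_cancel z) i)
      (twistHom_comp (inv_mul_cancel z) i))

theorem twist_X (z : ℂˣ) (i : ι) (lam : weightLattice R) :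
    twist z i (X R lam) = ((z ^ pair R lam i : ℂˣ) : ℂ) • X R lam := by
  rw [X, twist, IsFractionRing.fieldEquivOfAlgEquiv_algebraMap, AlgEquiv.ofAlgHom_apply,
    twistHom_single, single_eq_smul, Algebra.algebraMap_eq_smul_one, smul_assoc,
    ← Algebra.algebraMap_eq_smul_one]

variable [R.IsCrystallographic] (D : MetaplecticDatum R)

namespace MetaplecticDatum

/-- For λ in P^m the exponent (λ,α^∨) is a multiple of m(α), so roots of unity of order dividing
m(α) twist trivially. -/
theorem twist_of_mem {z : ℂˣ} {i : ι} (hz : z ^ D.m i = 1) {f : CP R} (hf : f ∈ C R D.Pm) :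
    twist z i f = f := by
  induction hf using IntermediateField.adjoin_induction with
  | mem f hf =>
    obtain ⟨lam, hlam, rfl⟩ := hf
    obtain ⟨c, hc⟩ := D.mem_Pm_iff.mp hlam i
    rw [twist_X, hc, zpow_mul, zpow_natCast, hz, one_zpow, Units.val_one, one_smul]
  | algebraMap c => exact AlgEquiv.commutes _ c
  | add f g _ _ hf hg => rw [map_add, hf, hg]
  | inv f _ hf => rw [map_inv₀, hf]
  | mul f g _ _ hf hg => rw [map_mul, hf, hg]

/-- A primitive root of unity of order `m(α)`. -/
def zeta (i : ι) : ℂˣ :=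
  (Complex.isPrimitiveRoot_exp (D.m i) (D.m_pos i).ne').isUnit (D.m_pos i).ne' |>.unit

theorem isPrimitiveRoot_zeta (i : ι) : IsPrimitiveRoot (D.zeta i) (D.m i) :=
  (Complex.isPrimitiveRoot_exp (D.m i) (D.m_pos i).ne').isUnit_unit (D.m_pos i).ne'

/-- The projection to the span over `ℂ(P^m)` of the `x^lam` with `(lam, α^∨) ≡ c` modulo `m(α)`. -/
def proj (i : ι) (c : ℤ) : CP R →ₗ[ℂ] CP R :=
  (D.m i : ℂ)⁻¹ • ∑ j ∈ Finset.range (D.m i),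
    ((D.zeta i ^ (-(j * c)) : ℂˣ) : ℂ) • (twist (D.zeta i ^ j) i).toLinearMap

theorem proj_apply (i : ι) (c : ℤ) (x : CP R) :
    D.proj i c x = (D.m i : ℂ)⁻¹ • ∑ j ∈ Finset.range (D.m i),
      ((D.zeta i ^ (-(j * c)) : ℂˣ) : ℂ) • twist (D.zeta i ^ j) i x := by
  simp [proj, LinearMap.sum_apply]

theorem proj_mul (i : ι) (c : ℤ) {f : CP R} (hf : f ∈ C R D.Pm) (x : CP R) :
    D.proj i c (f * x) = f * D.proj i c x := by
  have h : ∀ j : ℕ, twist (D.zeta i ^ j) i f = f := fun j ↦ by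
    refine D.twist_of_mem ?_ hf
    rw [← pow_mul, mul_comm, pow_mul, (D.isPrimitiveRoot_zeta i).pow_eq_one, one_pow]
  simp only [proj_apply, map_mul, h, mul_smul_comm, Finset.mul_sum]

/-- Orthogonality of characters: the average over the powers of ζ is a geometric sum, equal to 1 or
0 according to whether ζ^{(λ,α^∨)-c} is 1. -/
theorem proj_X (i : ι) (c : ℤ) (lam : weightLattice R) :
    D.proj i c (X R lam) = if (D.m i : ℤ) ∣ pair R lam i - c then X R lam else 0 := by
  have hz := D.isPrimitiveRoot_zeta i
  have h : ∀ j : ℕ, ((D.zeta i ^ (-(j * c)) : ℂˣ) : ℂ) • twist (D.zeta i ^ j) i (X R lam)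
      = (((D.zeta i ^ (pair R lam i - c) : ℂˣ) : ℂ) ^ j) • X R lam := fun j ↦ by
    rw [twist_X, smul_smul, ← Units.val_mul, ← Units.val_pow_eq_pow_val, ← zpow_natCast,
      ← zpow_natCast, ← zpow_mul, ← zpow_mul, ← zpow_add]
    congr 3
    ring
  simp only [proj_apply, h, ← Finset.sum_smul]
  split_ifs with hd
  · rw [(hz.zpow_eq_one_iff_dvd _).mpr hd]
    have : (D.m i : ℂ) ≠ 0 := by exact_mod_cast (D.m_pos i).ne'
    simp [smul_smul, this]
  · have h1 : ((D.zeta i ^ (pair R lam i - c) : ℂˣ) : ℂ) ≠ 1 := fun h1 ↦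
      hd ((hz.zpow_eq_one_iff_dvd _).mp (Units.ext h1))
    have h2 : ((D.zeta i ^ (pair R lam i - c) : ℂˣ) : ℂ) ^ D.m i = 1 := by
      rw [← Units.val_pow_eq_pow_val, ← zpow_natCast, ← zpow_mul, mul_comm, zpow_mul,
        zpow_natCast, hz.pow_eq_one, one_zpow, Units.val_one]
    rw [geom_sum_eq h1, h2, sub_self, zero_div, zero_smul, smul_zero]

/-- The operator `f x^lam ↦ a_(lam, α^∨) s_α(f x^lam)`, for `f` in `ℂ(P^m)`. -/
def weylOp (i : ι) (a : ℤ → CP R) : CP R →ₗ[ℂ] CP R :=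
  ∑ c ∈ Finset.range (D.m i), LinearMap.mulLeft ℂ (a c) ∘ₗ
    (weylHom R (RootPairing.weylGroup.ofIdx R i)).toLinearMap ∘ₗ D.proj i c

theorem weylOp_apply (i : ι) (a : ℤ → CP R) (x : CP R) :
    D.weylOp i a x = ∑ c ∈ Finset.range (D.m i),
      a c * (RootPairing.weylGroup.ofIdx R i : W R) • D.proj i c x := by
  simp only [weylOp, LinearMap.sum_apply]
  rfl

/-- The projections are ℂ(P^m)-linear and s_α is semilinear. An operator built from them is defined
on the whole field at once, so no independence of the expression f x^λ has to be checked. -/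
theorem weylOp_mul (i : ι) (a : ℤ → CP R) {f : CP R} (hf : f ∈ C R D.Pm) (x : CP R) :
    D.weylOp i a (f * x)
      = ((RootPairing.weylGroup.ofIdx R i : W R) • f) * D.weylOp i a x := by
  simp only [weylOp_apply, D.proj_mul i _ hf, smul_mul', mul_left_comm, Finset.mul_sum]

theorem weylOp_X (i : ι) {a : ℤ → CP R} (ha : ∀ c, a (c % D.m i) = a c) (lam : weightLattice R) :
    D.weylOp i a (X R lam)
      = a (pair R lam i) * X R ((RootPairing.weylGroup.ofIdx R i : W R) • lam) := by
  have hm := D.cast_m_pos i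
  have h0 := Int.emod_nonneg (pair R lam i) hm.ne'
  have hlt := Int.emod_lt_of_pos (pair R lam i) hm
  have hcast : (((pair R lam i % D.m i).toNat : ℕ) : ℤ) = pair R lam i % D.m i :=
    Int.toNat_of_nonneg h0
  rw [weylOp_apply, Finset.sum_eq_single (pair R lam i % D.m i).toNat]
  · rw [hcast, ha, proj_X, if_pos (Int.dvd_self_sub_emod), smul_X]
  · intro c hc hne
    rw [proj_X, if_neg, smul_zero, mul_zero]
    rintro hd
    refine hne ?_
    have hc' : (c : ℤ) < D.m i := by exact_mod_cast Finset.mem_range.mp hc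
    have h1 : pair R lam i % D.m i = c := by
      rw [((Int.modEq_iff_dvd.mpr hd).symm : pair R lam i % D.m i = (c : ℤ) % D.m i)]
      exact Int.emod_eq_of_lt (by positivity) hc'
    omega
  · intro h
    refine absurd (Finset.mem_range.mpr ?_) h
    omega

end MetaplecticDatum

end Twist

/-! ### The operators σ(s_i) and their squares -/

section Operators

variable {ι E F : Type*} [NormedAddCommGroup E] [InnerProductSpace ℝ E]
  [AddCommGroup F] [Module ℝ F] {R : RootPairing ι ℝ E F} [R.IsCrystallographic]
  (b : R.Base) {D : MetaplecticDatum R} (p : Parameters D)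

namespace Parameters

/-- The scalar `k_i ^ 2`, as an element of `ℂ(P)`. -/
def v (i : ι) : CP R := algebraMap ℂ (CP R) ((p.k i : ℂ) ^ 2)

/-- The representation parameter that occurs in the metaplectic formula for `s_i` and a weight
whose value at the coroot of `α_i` is `c`. -/
def gam (i : ι) (c : ℤ) : CP R :=
  algebraMap ℂ (CP R) (p.g (D.qRoot i * (1 - c)) (D.size i) : ℂ)

theorem gam_congr {i : ι} {c c' : ℤ} (h : (D.m i : ℤ) ∣ c - c') : p.gam i c = p.gam i c' := by
  rw [gam, gam, p.g_mod, p.g_mod (D.qRoot i * (1 - c'))]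
  have h1 : D.qRoot i * (1 - c) ≡ D.qRoot i * (1 - c') [ZMOD D.n] := by
    rw [Int.modEq_iff_dvd, ← mul_sub, sub_sub_sub_cancel_left]
    exact (D.n_dvd_qRoot_mul_iff i _).mpr h
  rw [h1]

theorem gam_of_dvd {i : ι} {c : ℤ} (h : (D.m i : ℤ) ∣ c - 1) : p.gam i c = -1 := by
  rw [gam, p.g_of_dvd]
  · simp
  · refine (D.n_dvd_qRoot_mul_iff i _).mpr ?_
    rw [← neg_sub]
    exact (dvd_neg (α := ℤ)).mpr h

/-- Replacing c by 2-c changes the sign of the index Q(α)(1-c), and n - j has the same residue as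
-j. -/
theorem gam_mul_gam {i : ι} {c : ℤ} (h : ¬ (D.m i : ℤ) ∣ c - 1) :
    p.gam i c * p.gam i (2 - c) * p.v i = 1 := by
  have h1 : ¬ (D.n : ℤ) ∣ D.qRoot i * (1 - c) := fun h1 ↦ h (by
    rw [← neg_sub]
    exact (dvd_neg (α := ℤ)).mpr ((D.n_dvd_qRoot_mul_iff i _).mp h1))
  have h2 := p.g_mul _ i h1
  have h3 : p.g (D.qRoot i * (1 - (2 - c))) (D.size i)
      = p.g (D.n - D.qRoot i * (1 - c)) (D.size i) := by
    rw [p.g_mod, p.g_mod (D.n - _)]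
    congr 1
    rw [sub_eq_add_neg (D.n : ℤ), Int.add_emod_left]
    congr 1
    ring
  rw [gam, gam, h3, v, ← map_mul, ← map_mul, ← Units.val_pow_eq_pow_val, ← Units.val_mul,
    ← Units.val_mul, h2]
  simp

theorem gam_ne_zero (i : ι) (c : ℤ) : p.gam i c ≠ 0 := by
  simp [gam]

theorem v_ne_zero (i : ι) : p.v i ≠ 0 := by simp [v]

theorem one_sub_v_mul_ne_zero (i : ι) {lam : weightLattice R} (h : lam ≠ 0) :
    1 - p.v i * X R lam ≠ 0 :=
  one_sub_mul_X_ne_zero _ h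

/-- The coefficient of `s_i(f x^lam)` in the metaplectic formula, for a weight `lam` whose value at
the coroot of `α_i` is `c`. -/
def coeff (i : ι) (c : ℤ) : CP R :=
  ((1 - p.v i) * X R (-(-c % D.m i) • rootP R i)
      + p.v i * p.gam i c * (1 - X R (-D.rootM i)) * X R (rootP R i))
    / (1 - p.v i * X R (D.rootM i))

theorem coeff_emod (i : ι) (c : ℤ) : p.coeff i (c % D.m i) = p.coeff i c := by
  have h : (D.m i : ℤ) ∣ c % D.m i - c := by
    rw [← neg_sub]; exact (dvd_neg (α := ℤ)).mpr Int.dvd_self_sub_emod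
  rw [coeff, coeff, p.gam_congr h]
  have h1 : -(c % D.m i) ≡ -c [ZMOD D.m i] := (Int.mod_modEq _ _).neg
  rw [h1]

/-- With c = (λ,α_i^∨), division of -c by m(α_i) rewrites the monomial of the first term as x^{s_iλ}
times x to the power minus the remainder of -c, times α_i. Both terms are thus multiples of x^{s_iλ}
whose coefficient depends only on c modulo m(α_i), as `weylOp_X` requires. -/
theorem sigmaFormula_eq_coeff [R.IsRootSystem] (i : b.support) (f : CP R) (lam : weightLattice R) :
    D.sigmaFormula b p i f lam = (simpleReflection b i • f)
      * (p.coeff i (pair R lam i) * X R (simpleReflection b i • lam)) := by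
  have h1 : X R (D.pairM (D.q b (-lam)) i • D.rootM i) * X R lam
      = X R (-(-pair R lam i % D.m i) • rootP R i) * X R (simpleReflection b i • lam) := by
    rw [← X_add, ← X_add, D.pairM_q, pair_neg, D.zsmul_rootM, simpleReflection_smul_weight]
    congr 1
    have := Int.emod_add_mul_ediv (-pair R lam i) (D.m i)
    rw [show -(-pair R lam i % (D.m i : ℤ)) = pair R lam i + -pair R lam i / D.m i * D.m i by
      linarith]
    module
  rw [MetaplecticDatum.sigmaFormula, coeff, D.floor_sub_B, X_add (R := R) (rootP R i)]
  change (1 - p.v i) * _ / (1 - p.v i * _) * _ * _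
    + p.v i * p.gam i _ * (_ / (1 - p.v i * _)) * _ * _ = _
  linear_combination ((1 - p.v i) / (1 - p.v i * X R (D.rootM i)) * (simpleReflection b i • f)) * h1

/-- The operator by which `s_i` acts in the metaplectic representation. -/
def sigma (i : b.support) : CP R →ₗ[ℂ] CP R := D.weylOp i (p.coeff i)

theorem sigma_mul (i : b.support) {f : CP R} (hf : f ∈ C R D.Pm) (x : CP R) :
    p.sigma b i (f * x) = (simpleReflection b i • f) * p.sigma b i x :=
  D.weylOp_mul i _ hf x

theorem v_mem (i : ι) : p.v i ∈ C R D.Pm := algebraMap_mem_C _ _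

theorem gam_mem (i : ι) (c : ℤ) : p.gam i c ∈ C R D.Pm := algebraMap_mem_C _ _

theorem smul_v (w : W R) (i : ι) : w • p.v i = p.v i := by
  rw [v, smul_eq_weylHom]; exact AlgEquiv.commutes _ _

theorem smul_gam (w : W R) (i : ι) (c : ℤ) : w • p.gam i c = p.gam i c := by
  rw [gam, smul_eq_weylHom]; exact AlgEquiv.commutes _ _

variable [R.IsRootSystem]

theorem sigma_mul_X (i : b.support) {f : CP R} (hf : f ∈ C R D.Pm) (lam : weightLattice R) :
    p.sigma b i (f * X R lam) = D.sigmaFormula b p i f lam := by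
  rw [sigma_mul _ _ _ hf, sigmaFormula_eq_coeff, sigma, D.weylOp_X i (p.coeff_emod i)]
  rfl

theorem sigma_X (i : b.support) (lam : weightLattice R) :
    p.sigma b i (X R lam)
      = (1 - p.v i) * X R (D.rootM i) ^ (-pair R lam i / D.m i) / (1 - p.v i * X R (D.rootM i))
          * X R lam
        + p.v i * p.gam i (pair R lam i) * (1 - (X R (D.rootM i))⁻¹)
          / (1 - p.v i * X R (D.rootM i)) * X R (rootP R i + simpleReflection b i • lam) := by
  have h := p.sigma_mul_X b i (one_mem (C R D.Pm)) lam
  rw [one_mul] at h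
  rw [h, MetaplecticDatum.sigmaFormula, D.floor_sub_B, D.pairM_q, pair_neg, X_zsmul, X_neg,
      smul_one]
  change (1 - p.v i) * _ / (1 - p.v i * _) * _ * _
    + p.v i * p.gam i _ * (_ / (1 - p.v i * _)) * _ * _ = _
  ring

/-- The monomials of λ and of λ' = α_i + s_iλ are interchanged by λ ↦ λ', and (λ',α_i^∨) = 2 - c. If
m(α_i) divides c - 1, the two are proportional over ℂ(P^m) and both parameters are -1. Otherwise the
product of the two parameters is v⁻¹, which makes the coefficient of x^λ equal to 1. -/
theorem sigma_sigma_X (i : b.support) (lam : weightLattice R) :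
    p.sigma b i (p.sigma b i (X R lam)) = X R lam := by
  have hy : X R (D.rootM i) ∈ C R D.Pm := X_mem_C R (D.rootM_mem_Pm i)
  have hv := p.v_mem (i : ι)
  have hg := p.gam_mem (i : ι)
  have hsy : simpleReflection b i • X R (D.rootM i) = (X R (D.rootM i))⁻¹ := by
    rw [smul_X, D.simpleReflection_smul_rootM, X_neg]
  have hden := p.one_sub_v_mul_ne_zero i (D.rootM_ne_zero i)
  have hden' := p.one_sub_v_mul_ne_zero i (neg_ne_zero.mpr (D.rootM_ne_zero i))
  have hy0 := X_ne_zero (D.rootM i)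
  rw [X_neg] at hden'
  have hden'' : X R (D.rootM i) - p.v i ≠ 0 := fun h ↦ hden' (by
    rw [← sub_eq_zero.mp h, mul_inv_cancel₀ hy0, sub_self])
  have hlam : rootP R i + simpleReflection b i • (rootP R i + simpleReflection b i • lam) = lam
      := by
    rw [smul_add, simpleReflection_smul_smul, simpleReflection_smul_weight _ (rootP R (i : ι)),
      pair_rootP_self]
    module
  have hpair : pair R (rootP R i + simpleReflection b i • lam) i = 2 - pair R lam i := by
    rw [pair_add, pair_rootP_self, pair_simpleReflection_smul_self]
    ring
  rw [sigma_X, map_add, sigma_mul _ _ _ (by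
    exact div_mem (mul_mem (sub_mem (one_mem _) hv) (zpow_mem hy _))
      (sub_mem (one_mem _) (mul_mem hv hy))), sigma_mul _ _ _ (by
    exact div_mem (mul_mem (mul_mem hv (hg _)) (sub_mem (one_mem _) (inv_mem hy)))
      (sub_mem (one_mem _) (mul_mem hv hy))), sigma_X, sigma_X, hlam, hpair]
  simp only [smul_eq_weylHom, map_div₀, map_mul, map_sub, map_one, map_zpow₀, map_inv₀]
  simp only [← smul_eq_weylHom, smul_v, smul_gam, hsy, inv_inv]
  set c := pair R lam i with hc
  set m := D.m (i : ι) with hm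
  have hm0 : (0 : ℤ) < m := D.cast_m_pos i
  have hc1 := Int.emod_add_mul_ediv (-c) m
  have hc2 := Int.emod_nonneg (-c) hm0.ne'
  have hc3 := Int.emod_lt_of_pos (-c) hm0
  set N := -c / (m : ℤ) with hN
  by_cases hd : (m : ℤ) ∣ c - 1
  · obtain ⟨u, hu⟩ := hd
    have hNu : N = -u - 1 := by
      rw [hN, show -c = m * (-u - 1) + (m - 1) by linarith, Int.mul_add_ediv_left _ _ hm0.ne',
        Int.ediv_eq_zero_of_lt (by omega) (by omega), add_zero]
    have hNu' : -(2 - c) / (m : ℤ) = u - 1 := by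
      rw [show -(2 - c) = m * (u - 1) + (m - 1) by linarith, Int.mul_add_ediv_left _ _ hm0.ne',
        Int.ediv_eq_zero_of_lt (by omega) (by omega), add_zero]
    have hX : X R (rootP R i + simpleReflection b i • lam) = X R (D.rootM i) ^ (-u) * X R lam := by
      rw [← X_zsmul, ← X_add, D.zsmul_rootM, simpleReflection_smul_weight, ← hc,
        show c = 1 + m * u by linarith, ← hm]
      congr 1
      module
    rw [hX, hNu, hNu', p.gam_of_dvd ⟨u, hu⟩, p.gam_of_dvd (c := 2 - c) ⟨-u, by linarith⟩]
    have hyu := zpow_ne_zero u hy0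
    simp only [zpow_sub₀ hy0, zpow_neg, inv_zpow, zpow_one]
    field_simp
    ring
  -- The remainder m-1 is excluded exactly because m does not divide c-1; this fixes the integer
  -- quotient of -(2-c) as -N-1.
  · have hr : -c % m ≠ m - 1 := fun hr ↦ hd ⟨-N - 1, by linarith⟩
    have hN' : -(2 - c) / (m : ℤ) = -N - 1 := by
      rw [show -(2 - c) = m * (-N - 1) + (m - 2 - -c % m) by linarith,
        Int.mul_add_ediv_left _ _ hm0.ne', Int.ediv_eq_zero_of_lt (by omega) (by omega), add_zero]
    have hgg := p.gam_mul_gam hd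
    rw [hN']
    have hyN := zpow_ne_zero N hy0
    simp only [zpow_sub₀ hy0, zpow_neg, inv_zpow, zpow_one]
    field_simp
    linear_combination
      -(p.v i * (X R (D.rootM i) - 1) ^ 2 * X R (D.rootM i) ^ N * X R lam) * hgg

theorem sigma_sigma (i : b.support) (x : CP R) : p.sigma b i (p.sigma b i x) = x := by
  refine C_induction D ⊤ (p := fun x ↦ p.sigma b i (p.sigma b i x) = x) (fun f hf lam _ ↦ ?_)
    (fun x y hx hy ↦ by rw [map_add, map_add, hx, hy]) (x := x) (by rw [C_top]; trivial)
  have hf' := C_mono R inf_le_right hf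
  rw [sigma_mul _ _ _ hf', sigma_mul _ _ _ (smul_mem_C R _ _ hf'), simpleReflection_smul_smul,
    sigma_sigma_X]

end Parameters

end Operators

/-! ### Products along chains and rescaled Cartan integers -/

section Chains

variable {G : Type*} [Monoid G]

/-- The product `⋯ a b a` of `n` factors. -/
def altProdRev : G → G → ℕ → G
  | _, _, 0 => 1
  | a, b, n + 1 => altProdRev b a n * a

/-- The product of the values of two functions, taken in turn, along the values of a weight that
occur when two simple reflections are applied alternately. -/
def chainProd (f g : ℤ → ℂ) (p q : ℤ) : ℕ → ℤ → ℤ → ℂ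
  | 0, _, _ => 1
  | n + 1, x, y => f x * chainProd g f q p n (y + p * x) (-x)

/-- Both chains meet the same values in opposite orders. For even m each value goes to the same
function in both chains; for m = 3 the roles of f and g are exchanged, whence the hypothesis. -/
theorem IsBond.chainProd_eq {p q : ℤ} {m : ℕ} (h : IsBond p q m) {f g : ℤ → ℂ}
    (hfg : m = 3 → f = g) (x y : ℤ) : chainProd f g p q m x y = chainProd g f q p m y x := by
  cases h
  case one => rw [hfg rfl]; simp only [chainProd]; ring_nf
  all_goals simp only [chainProd]; ring_nf

/-- Reversal fixes the two words when m is odd and interchanges them when m is even. -/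
theorem IsBond.altProd_eq_iff {p q : ℤ} {m : ℕ} (h : IsBond p q m) {a b : G} {H : Type*}
    (φ : G → H) :
    φ (altProd a b m) = φ (altProd b a m) ↔ φ (altProdRev a b m) = φ (altProdRev b a m) := by
  cases h <;> simp only [altProd, altProdRev, mul_one, one_mul, mul_assoc] <;>
    first | exact Iff.rfl | exact eq_comm

/-- Passing from α to m(α)α preserves the product of the two Cartan integers, hence m, but it may
exchange the long and the short root. -/
theorem IsBond.rescale {p q p' q' a c : ℤ} {m : ℕ} (h : IsBond p q m) (ha : 0 < a) (hc : 0 < c)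
    (hp : p' * a = p * c) (hq : q' * c = q * a) : IsBond p' q' m := by
  have hpq : p' * q' = p * q := by
    have : p' * q' * (a * c) = p * q * (a * c) := by linear_combination q' * c * hp + p * c * hq
    exact mul_right_cancel₀ (mul_pos ha hc).ne' this
  have hp0 : 0 ≤ p → 0 ≤ p' := fun h0 ↦ by
    by_contra! hlt
    nlinarith [mul_nonneg h0 hc.le, mul_pos_of_neg_of_neg hlt (neg_neg_of_pos ha)]
  have hdvd : p' ∣ p * q := ⟨q', hpq.symm⟩
  cases h
  · have h1 : p' = 0 := by simpa [ha.ne'] using hp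
    have h2 : q' = 0 := by simpa [hc.ne'] using hq
    subst h1 h2; constructor
  all_goals
    have h0 := hp0 (by norm_num)
    have hle := Int.le_of_dvd (by norm_num) hdvd
    norm_num at hle hpq
    interval_cases p' <;> first | omega | skip
  · obtain rfl : q' = 1 := by omega
    constructor
  · obtain rfl : q' = 2 := by omega
    constructor
  · obtain rfl : q' = 1 := by omega
    constructor
  · obtain rfl : q' = 2 := by omega
    constructor
  · obtain rfl : q' = 1 := by omega
    constructor
  · obtain rfl : q' = 3 := by omega
    constructor
  · obtain rfl : q' = 1 := by omega
    constructor
  · obtain rfl : q' = 3 := by omega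
    constructor
  · obtain rfl : q' = 1 := by omega
    constructor

/-- The braid relation at `x` implies the braid relation at `S x`. -/
theorem IsBond.altProd_apply {p q : ℤ} {m : ℕ} (h : IsBond p q m) {V : Type*} [AddCommGroup V]
    [Module ℂ V] {S T : Module.End ℂ V} (hS : ∀ x, S (S x) = x) (hT : ∀ x, T (T x) = x) {x : V}
    (hx : altProd S T m x = altProd T S m x) :
    altProd S T m (S x) = altProd T S m (S x) := by
  have h1 := congrArg S hx
  have h2 := congrArg T hx
  cases h <;>
    simp only [altProd, Module.End.mul_apply, Module.End.one_apply, hS, hT] at h1 h2 ⊢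
  all_goals first | exact h1.symm | exact h2.symm

end Chains

/-! ### Reduction to small weights that are dominant in rank two -/

section Reduction

variable {ι E F : Type*} [NormedAddCommGroup E] [InnerProductSpace ℝ E]
  [AddCommGroup F] [Module ℝ F] {R : RootPairing ι ℝ E F} [R.IsCrystallographic]
  (D : MetaplecticDatum R)

namespace MetaplecticDatum

/-- The weights `lam` with `|(lam, β^∨)| ≤ m(β)` for all roots `β`. -/
def IsSmall (lam : weightLattice R) : Prop := ∀ i, |pair R lam i| ≤ D.m i

variable {D} in
theorem IsSmall.ofIdx_smul {lam : weightLattice R} (h : D.IsSmall lam) (i : ι) :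
    D.IsSmall ((RootPairing.weylGroup.ofIdx R i : W R) • lam) := fun j ↦ by
  rw [← pair_reflectionPerm, ← D.m_reflectionPerm i j]
  exact h _

variable [Finite ι]

/-- The invariant bilinear form `∑ β, (lam, β^∨) (mu, β^∨)` on the weight lattice. -/
def pairForm (lam mu : weightLattice R) : ℤ := ∑ᶠ i, pair R lam i * pair R mu i

omit [R.IsCrystallographic] in
theorem pairForm_add_left (lam mu nu : weightLattice R) :
    pairForm (lam + mu) nu = pairForm lam nu + pairForm mu nu := by
  simp only [pairForm, pair_add, add_mul]
  exact finsum_add_distrib (Set.toFinite _) (Set.toFinite _)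

omit [R.IsCrystallographic] [Finite ι] in
theorem pairForm_zsmul_left (c : ℤ) (lam mu : weightLattice R) :
    pairForm (c • lam) mu = c * pairForm lam mu := by
  simp only [pairForm, pair_zsmul, mul_assoc]
  exact (mul_finsum _ _).symm

omit [R.IsCrystallographic] [Finite ι] in
theorem pairForm_comm (lam mu : weightLattice R) : pairForm lam mu = pairForm mu lam := by
  simp only [pairForm, mul_comm]

omit [R.IsCrystallographic] [Finite ι] in
theorem pairForm_smul (i : ι) (lam mu : weightLattice R) :
    pairForm ((RootPairing.weylGroup.ofIdx R i : W R) • lam)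
      ((RootPairing.weylGroup.ofIdx R i : W R) • mu) = pairForm lam mu := by
  simp only [pairForm, ← pair_reflectionPerm]
  exact finsum_comp_equiv (R.reflectionPerm i)
    (f := fun j ↦ pair R lam j * pair R mu j)

theorem two_mul_pairForm_rootP (lam : weightLattice R) (i : ι) :
    2 * pairForm lam (rootP R i) = pair R lam i * pairForm (rootP R i) (rootP R i) := by
  have h := pairForm_smul i lam (rootP R i)
  have h1 : (RootPairing.weylGroup.ofIdx R i : W R) • rootP R i = (-1 : ℤ) • rootP R i := by
    rw [ofIdx_smul_weight, pair_rootP_self]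
    module
  rw [h1, ofIdx_smul_weight, pairForm_comm _ ((-1 : ℤ) • _), pairForm_zsmul_left, sub_eq_add_neg,
    ← neg_zsmul, pairForm_comm (rootP R i), pairForm_add_left, pairForm_zsmul_left] at h
  linarith

omit [R.IsCrystallographic] in
theorem pairForm_add_zsmul_self (c : ℤ) (lam mu : weightLattice R) :
    pairForm (lam + c • mu) (lam + c • mu)
      = pairForm lam lam + 2 * c * pairForm lam mu + c * c * pairForm mu mu := by
  rw [pairForm_add_left, pairForm_comm lam, pairForm_add_left, pairForm_zsmul_left,
    pairForm_zsmul_left, pairForm_comm mu (_ + _), pairForm_add_left, pairForm_zsmul_left,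
    pairForm_comm mu lam]
  ring

omit [R.IsCrystallographic] [Finite ι] in
theorem pairForm_self_nonneg (lam : weightLattice R) : 0 ≤ pairForm lam lam :=
  finsum_nonneg fun _ ↦ mul_self_nonneg _

theorem pairForm_rootP_pos (i : ι) : 0 < pairForm (rootP R i) (rootP R i) := by
  have h : pair R (rootP R i) i * pair R (rootP R i) i ≤ pairForm (rootP R i) (rootP R i) :=
    single_le_finsum i (Set.toFinite _) fun _ ↦ mul_self_nonneg _
  rw [pair_rootP_self] at h
  linarith

/-- A translate of λ by P^m of minimal length is small: comparing it with its translates by ±m(β)β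
gives |(λ+μ,β^∨)| ≤ m(β). The bound can be attained. -/
theorem exists_isSmall_add (lam : weightLattice R) : ∃ mu ∈ D.Pm, D.IsSmall (lam + mu) := by
  obtain ⟨mu, hmu, hmin⟩ := (measure fun mu : weightLattice R ↦
    (pairForm (lam + mu) (lam + mu)).toNat).wf.has_min (D.Pm : Set (weightLattice R))
    ⟨0, zero_mem _⟩
  have hle : ∀ nu ∈ D.Pm, pairForm (lam + mu) (lam + mu) ≤ pairForm (lam + nu) (lam + nu) := by
    intro nu hnu
    have := hmin nu hnu
    change ¬ ((pairForm (lam + nu) (lam + nu)).toNat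
      < (pairForm (lam + mu) (lam + mu)).toNat) at this
    have h0 := pairForm_self_nonneg (lam + nu)
    omega
  refine ⟨mu, hmu, fun i ↦ ?_⟩
  have hpos := pairForm_rootP_pos (R := R) i
  have hm := D.cast_m_pos i
  have key : ∀ t : ℤ, t * t = 1 → -(t * pair R (lam + mu) i) ≤ D.m i := by
    intro t ht
    have h := hle (mu + t • D.rootM i) (add_mem hmu (zsmul_mem (D.rootM_mem_Pm i) t))
    rw [← add_assoc, D.zsmul_rootM, pairForm_add_zsmul_self] at h
    have hr := two_mul_pairForm_rootP (lam + mu) i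
    set u := pairForm (rootP R i) (rootP R i)
    set c := pair R (lam + mu) i
    have h1 : 0 ≤ (D.m i * u) * (t * c + D.m i) := by
      linear_combination h + (t * D.m i) * hr + (D.m i * D.m i * u) * ht
    have := nonneg_of_mul_nonneg_right h1 (mul_pos hm hpos)
    linarith
  have h1 := key 1 (by norm_num)
  have h2 := key (-1) (by norm_num)
  rw [abs_le]
  constructor <;> linarith

end MetaplecticDatum

variable [Finite ι] [R.IsReduced] [R.IsRootSystem] (b : R.Base)

/-- A weight that has nonnegative values at two simple coroots in every orbit of the group generated
by the two simple reflections. -/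
theorem exists_mem_closure_pair_nonneg (i j : b.support) (lam : weightLattice R) :
    ∃ w ∈ Subgroup.closure {simpleReflection b i, simpleReflection b j},
      0 ≤ pair R (w • lam) i ∧ 0 ≤ pair R (w • lam) j := by
  -- At a point of maximal height in the finite orbit, a negative coroot value would let the
  -- reflection increase the height.
  obtain ⟨w, hw, hmax⟩ := Set.exists_max_image
    (Subgroup.closure {simpleReflection b i, simpleReflection b j} : Set (W R))
    (fun w ↦ heightForm b (w • lam : weightLattice R)) (Set.toFinite _) ⟨1, one_mem _⟩
  have key : ∀ k, simpleReflection b k ∈ Subgroup.closure {simpleReflection b i,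
      simpleReflection b j} → 0 ≤ pair R (w • lam) k := by
    intro k hk
    have h := hmax _ (mul_mem hk hw)
    have hcoe : ((simpleReflection b k • w • lam : weightLattice R) : E)
        = ((w • lam : weightLattice R) : E) - (pair R (w • lam) k : ℝ) • R.root k := by
      rw [simpleReflection_smul_weight, Int.cast_smul_eq_zsmul]
      rfl
    change heightForm b (((simpleReflection b k * w) • lam : weightLattice R) : E)
      ≤ heightForm b ((w • lam : weightLattice R) : E) at h
    rw [mul_smul, hcoe, map_sub, map_smul, heightForm_root_support, smul_eq_mul, mul_one] at h
    have : (0 : ℝ) ≤ pair R (w • lam) k := by linarith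
    exact_mod_cast this
  exact ⟨w, hw, key i (Subgroup.subset_closure (by simp)),
    key j (Subgroup.subset_closure (by simp))⟩

end Reduction

/-! ### Demazure-Lusztig operators on shifted monomials -/

section Shift

variable {ι E F : Type*} [NormedAddCommGroup E] [InnerProductSpace ℝ E]
  [AddCommGroup F] [Module ℝ F] {R : RootPairing ι ℝ E F} [R.IsCrystallographic] [R.IsRootSystem]
  (b : R.Base) {D : MetaplecticDatum R} (p : Parameters D)

namespace MetaplecticDatum

variable (D) in
/-- The weight with value `1 - m(α_i)` at the coroot of `α_i`, for all `i`. -/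
def shift : weightLattice R := ∑ i : b.support, (1 - (D.m i : ℤ)) • fundamentalWeight b i

theorem pair_shift (i : b.support) : pair R (D.shift b) i = 1 - D.m i := by
  classical
  simp only [shift, pair_sum, pair_zsmul, pair_fundamentalWeight, mul_ite, mul_one, mul_zero,
    Finset.sum_ite_eq, Finset.mem_univ, if_true]

end MetaplecticDatum

namespace Parameters

/-- The operator `(v + (1 - v) / (1 - y)) σ_i - (1 - v) / (1 - y)`, where `y = x^{α_i^m}`. -/
def demLus (i : b.support) : Module.End ℂ (CP R) :=
  LinearMap.mulLeft ℂ (p.v i + (1 - p.v i) * (1 / (1 - X R (D.rootM i)))) ∘ₗ p.sigma b i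
    - LinearMap.mulLeft ℂ ((1 - p.v i) * (1 / (1 - X R (D.rootM i))))

omit [R.IsRootSystem] in
theorem demLus_apply (i : b.support) (x : CP R) : p.demLus b i x
    = (p.v i + (1 - p.v i) * (1 / (1 - X R (D.rootM i)))) * p.sigma b i x
      - ((1 - p.v i) * (1 / (1 - X R (D.rootM i)))) * x := rfl

/-- The scalar by which `demLus` multiplies a shifted monomial. -/
def scalar (i : ι) (c : ℤ) : ℂ :=
  -- The boundary value is not the limit of the general formula: at c = m(α_i) the parameter is g_0
  -- = -1, and the other branch would give k_i² instead of 1.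
  if c = D.m i then 1
  else -((p.k i : ℂ) ^ 2 * p.g (D.qRoot i * (D.m i - c)) (D.size i))

/-- For the shift δ one has α_i + s_i(μ+δ) = m(α_i)α_i + s_iμ + δ, so up to a factor in ℂ(P^m) the
affine action on exponents becomes the linear action on μ. -/
theorem sigma_X_add_shift (i : b.support) (mu : weightLattice R) :
    p.sigma b i (X R (mu + D.shift b))
      = (1 - p.v i) * X R (D.rootM i) ^ ((D.m i - 1 - pair R mu i) / D.m i)
          / (1 - p.v i * X R (D.rootM i)) * X R (mu + D.shift b)
        - p.v i * p.gam i (pair R mu i + 1 - D.m i) * (1 - X R (D.rootM i))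
          / (1 - p.v i * X R (D.rootM i)) * X R (simpleReflection b i • mu + D.shift b) := by
  have h : rootP R i + simpleReflection b i • (mu + D.shift b)
      = D.rootM i + (simpleReflection b i • mu + D.shift b) := by
    rw [smul_add, simpleReflection_smul_weight _ (D.shift b), D.pair_shift,
      MetaplecticDatum.rootM]
    generalize simpleReflection b i • mu = nu
    module
  have hy0 := X_ne_zero (D.rootM i)
  rw [sigma_X, h, X_add R (D.rootM i), pair_add, D.pair_shift,
    show -(pair R mu i + (1 - (D.m i : ℤ))) = D.m i - 1 - pair R mu i by ring,
    show pair R mu i + (1 - (D.m i : ℤ)) = pair R mu i + 1 - D.m i by ring, sub_eq_add_neg (_ * _)]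
  congr 1
  field_simp
  ring

/-- For values below m(α_i) the power of x^{α_i^m} in `sigma_X_add_shift` is trivial, and the term
subtracted in `demLus` cancels the multiple of x^{μ+δ}. At the value m(α_i) the two monomials differ
by the factor x^{α_i^m}, and everything collapses to one term with coefficient 1. -/
theorem demLus_X (i : b.support) (mu : weightLattice R) (h0 : 0 ≤ pair R mu i)
    (hm : pair R mu i ≤ D.m i) : p.demLus b i (X R (mu + D.shift b))
      = p.scalar i (pair R mu i) • X R (simpleReflection b i • mu + D.shift b) := by
  have hpos := D.cast_m_pos i
  have hden := p.one_sub_v_mul_ne_zero i (D.rootM_ne_zero i)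
  have hden' := one_sub_X_ne_zero (D.rootM_ne_zero i)
  have hy0 := X_ne_zero (D.rootM i)
  rw [demLus_apply, sigma_X_add_shift, scalar, Algebra.smul_def]
  split_ifs with h
  · have hmu : mu = D.rootM i + simpleReflection b i • mu := by
      rw [simpleReflection_smul_weight, h, MetaplecticDatum.rootM]
      module
    have hX : X R (mu + D.shift b)
        = X R (D.rootM i) * X R (simpleReflection b i • mu + D.shift b) := by
      rw [← X_add, ← add_assoc, ← hmu]
    rw [hX, p.gam_of_dvd (by rw [h]; exact ⟨0, by ring⟩), h,
      show (D.m i : ℤ) - 1 - D.m i = D.m i * (-1) + (D.m i - 1) by ring,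
      Int.mul_add_ediv_left _ _ hpos.ne', Int.ediv_eq_zero_of_lt (by omega) (by omega), add_zero,
      zpow_neg_one, map_one]
    field_simp
    ring
  · have hN : ((D.m i : ℤ) - 1 - pair R mu i) / D.m i = 0 :=
      Int.ediv_eq_zero_of_lt (by omega) (by omega)
    have hg : algebraMap ℂ (CP R) (-((p.k i : ℂ) ^ 2
        * p.g (D.qRoot i * (D.m i - pair R mu i)) (D.size i)))
        = -(p.v i * p.gam i (pair R mu i + 1 - D.m i)) := by
      rw [map_neg, map_mul, v, gam, show (1 : ℤ) - (pair R mu i + 1 - D.m i) = D.m i - pair R mu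
          i by
        ring]
    rw [hN, zpow_zero, hg]
    field_simp
    ring

/-- The words in two of the operators `demLus`, applied to the monomial of a small weight that has
nonnegative values at the two coroots. -/
theorem altProdRev_demLus_X (n : ℕ) (i j : b.support) {mu : weightLattice R} (hmu : D.IsSmall mu)
    (h : ChainNonneg (-R.pairingIn ℤ i j : ℤ) (-R.pairingIn ℤ j i : ℤ) n
      (pair R mu i) (pair R mu j)) :
    altProdRev (p.demLus b i) (p.demLus b j) n (X R (mu + D.shift b))
      = chainProd (p.scalar i) (p.scalar j) (-R.pairingIn ℤ i j) (-R.pairingIn ℤ j i) n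
          (pair R mu i) (pair R mu j)
        • X R (altProdRev (simpleReflection b i) (simpleReflection b j) n • mu + D.shift b) := by
  induction n generalizing i j mu with
  | zero => simp [altProdRev, chainProd]
  | succ n ih =>
    have h1 : pair R (simpleReflection b i • mu) j
        = pair R mu j + -R.pairingIn ℤ i j * pair R mu i := by
      rw [pair_simpleReflection_smul]; ring
    have h2 := pair_simpleReflection_smul_self i mu
    rw [altProdRev, Module.End.mul_apply, p.demLus_X b i mu (by exact_mod_cast h.1)
      (abs_le.mp (hmu i)).2, map_smul,
      ih j i (mu := simpleReflection b i • mu) (hmu.ofIdx_smul i) ?_, chainProd, altProdRev,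
      mul_smul (altProdRev _ _ n), ← h1, ← h2, mul_smul (p.scalar _ _)]
    · convert h.2 using 1
      · rw [h1]; push_cast; ring
      · rw [h2]; push_cast; ring

end Parameters

end Shift

/-! ### Braid relations for the operators σ(s_i) -/

section Braid

variable {ι E F : Type*} [NormedAddCommGroup E] [InnerProductSpace ℝ E]
  [AddCommGroup F] [Module ℝ F] {R : RootPairing ι ℝ E F} [R.IsCrystallographic]
  (b : R.Base) {D : MetaplecticDatum R} (p : Parameters D)

namespace Parameters

/-- The monomial `x^lam` as an element of `ℂ(P^m)`. -/
def XPm {lam : weightLattice R} (h : lam ∈ D.Pm) : C R D.Pm := ⟨X R lam, X_mem_C R h⟩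

/-- The scalar `k_i ^ 2` as an element of `ℂ(P^m)`. -/
def vPm (i : ι) : C R D.Pm := ⟨p.v i, p.v_mem i⟩

theorem smul_rootM (i : b.support) (j : ι) {c : ℤ}
    (hc : c * D.m i = -R.pairingIn ℤ j i * D.m j) :
    simpleReflection b i • D.rootM j = D.rootM j + c • D.rootM i := by
  rw [simpleReflection_smul_weight, D.zsmul_rootM, hc, MetaplecticDatum.rootM, pair_nsmul,
    pair_rootP]
  module

variable [Finite ι] [R.IsReduced] [R.IsRootSystem]

theorem nsmul_rootM_add_ne_zero (i j : b.support) {u u' : ℕ} (h : (u, u') ≠ (0, 0)) :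
    u • D.rootM i + u' • D.rootM j ≠ 0 := fun h0 ↦ by
  have h1 : heightForm b ((u • D.rootM i + u' • D.rootM j : weightLattice R) : E) = 0 := by
    rw [h0]; exact map_zero _
  have h2 : ((u • D.rootM i + u' • D.rootM j : weightLattice R) : E)
      = (u : ℝ) • (D.m i : ℝ) • R.root i + (u' : ℝ) • (D.m j : ℝ) • R.root j := by
    simp only [Nat.cast_smul_eq_nsmul]
    rfl
  rw [h2, map_add, map_smul, map_smul, map_smul, map_smul, heightForm_root_support,
    heightForm_root_support, smul_eq_mul, smul_eq_mul, smul_eq_mul, smul_eq_mul, mul_one,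
    mul_one] at h1
  norm_cast at h1
  have hi := D.m_pos (i : ι)
  have hj := D.m_pos (j : ι)
  rw [Nat.add_eq_zero_iff, Nat.mul_eq_zero, Nat.mul_eq_zero] at h1
  exact h (Prod.ext (h1.1.resolve_right hi.ne') (h1.2.resolve_right hj.ne'))

/-- Linear maps as additive maps. -/
def linToAdd (V : Type*) [AddCommGroup V] [Module ℂ V] : Module.End ℂ V →* AddMonoid.End V where
  toFun f := f.toAddMonoidHom
  map_one' := rfl
  map_mul' _ _ := rfl

omit [Finite ι] [R.IsReduced] [R.IsRootSystem] in
theorem smul_XPm (i : b.support) {lam : weightLattice R} (h : lam ∈ D.Pm) :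
    ((simpleReflection b i • XPm h : C R D.Pm) : CP R) = X R (simpleReflection b i • lam) :=
  smul_X R _ _

theorem one_sub_mul_XPm_ne_zero (v : C R D.Pm) (c : ℂ) (hv : (v : CP R) = algebraMap ℂ (CP R) c)
    (i j : b.support) (u u' : ℕ) (h : (u, u') ≠ (0, 0)) :
    1 - v * (XPm (D.rootM_mem_Pm i) ^ u * XPm (D.rootM_mem_Pm j) ^ u') ≠ 0 := fun h0 ↦ by
  refine one_sub_mul_X_ne_zero c (nsmul_rootM_add_ne_zero b (D := D) i j h) ?_
  have := congrArg (Subtype.val : C R D.Pm → CP R) h0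
  rw [X_add, X_nsmul, X_nsmul, ← hv]
  exact this

/-- The operators `sigma` of two simple reflections, as a rank two datum over `ℂ(P^m)`. -/
def rankTwoDatum (i j : b.support) {c c' : ℤ} (hc : c * D.m i = -R.pairingIn ℤ j i * D.m j)
    (hc' : c' * D.m j = -R.pairingIn ℤ i j * D.m i) :
    RankTwoDatum (C R D.Pm) (CP R) c c' where
  s := MulSemiringAction.toRingHom (W R) (C R D.Pm) (simpleReflection b i)
  t := MulSemiringAction.toRingHom (W R) (C R D.Pm) (simpleReflection b j)
  S := linToAdd _ (p.sigma b i)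
  T := linToAdd _ (p.sigma b j)
  S_smul f x := p.sigma_mul b i f.2 x
  T_smul f x := p.sigma_mul b j f.2 x
  S_S := p.sigma_sigma b i
  T_T := p.sigma_sigma b j
  v := p.vPm i
  w := p.vPm j
  s_v := Subtype.ext (p.smul_v _ _)
  s_w := Subtype.ext (p.smul_v _ _)
  t_v := Subtype.ext (p.smul_v _ _)
  t_w := Subtype.ext (p.smul_v _ _)
  y := XPm (D.rootM_mem_Pm i)
  z := XPm (D.rootM_mem_Pm j)
  y_ne_zero h := X_ne_zero (D.rootM i) (congrArg Subtype.val h)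
  z_ne_zero h := X_ne_zero (D.rootM j) (congrArg Subtype.val h)
  s_y := Subtype.ext (by
    rw [MulSemiringAction.toRingHom_apply, smul_XPm, D.simpleReflection_smul_rootM, X_neg]; rfl)
  t_z := Subtype.ext (by
    rw [MulSemiringAction.toRingHom_apply, smul_XPm, D.simpleReflection_smul_rootM, X_neg]; rfl)
  s_z := Subtype.ext (by
    rw [MulSemiringAction.toRingHom_apply, smul_XPm, smul_rootM b i j hc, X_add, X_zsmul,
        MulMemClass.coe_mul]
    exact congrArg _ (map_zpow₀ (C R D.Pm).val (XPm _) c).symm)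
  t_y := Subtype.ext (by
    rw [MulSemiringAction.toRingHom_apply, smul_XPm, smul_rootM b j i hc', X_add, X_zsmul,
        MulMemClass.coe_mul]
    exact congrArg _ (map_zpow₀ (C R D.Pm).val (XPm _) c').symm)
  one_sub_ne_zero u u' h := by
    have := one_sub_mul_XPm_ne_zero b (1 : C R D.Pm) 1 (by simp) i j u u' h
    rwa [one_mul] at this
  one_sub_v_ne_zero := one_sub_mul_XPm_ne_zero b (p.vPm i) _ rfl i j
  one_sub_w_ne_zero := one_sub_mul_XPm_ne_zero b (p.vPm j) _ rfl i j

theorem rankTwoDatum_A (i j : b.support) {c c' : ℤ}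
    (hc : c * D.m i = -R.pairingIn ℤ j i * D.m j) (hc' : c' * D.m j = -R.pairingIn ℤ i j * D.m i) :
    (p.rankTwoDatum b i j hc hc').A = linToAdd _ (p.demLus b i) := rfl

theorem rankTwoDatum_B (i j : b.support) {c c' : ℤ}
    (hc : c * D.m i = -R.pairingIn ℤ j i * D.m j) (hc' : c' * D.m j = -R.pairingIn ℤ i j * D.m i) :
    (p.rankTwoDatum b i j hc hc').B = linToAdd _ (p.demLus b j) := rfl

/-- The rank two theory is applied over ℂ(P^m) with y, z the monomials of α_i^m and α_j^m. The
relevant Cartan integers are those of the rescaled roots, so the bond first passes through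
`IsBond.rescale`. -/
theorem altProd_sigma_apply {i j : b.support} {m : ℕ}
    (h : IsBond (-R.pairingIn ℤ j i) (-R.pairingIn ℤ i j) m) (hk : m = 3 → p.k i = p.k j) (x : CP R)
    (hx : altProd (p.demLus b i) (p.demLus b j) m x = altProd (p.demLus b j) (p.demLus b i) m x) :
    altProd (p.sigma b i) (p.sigma b j) m x = altProd (p.sigma b j) (p.sigma b i) m x := by
  have hdvd : ∀ i j : ι, ∃ c : ℤ, c * D.m i = -R.pairingIn ℤ j i * D.m j := fun i j ↦ by
    obtain ⟨c, hc⟩ := D.mem_Pm_iff.mp (D.rootM_mem_Pm j) i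
    rw [MetaplecticDatum.rootM, pair_nsmul, pair_rootP] at hc
    exact ⟨-c, by linarith⟩
  obtain ⟨c, hc⟩ := hdvd i j
  obtain ⟨c', hc'⟩ := hdvd j i
  have hb := h.rescale (D.cast_m_pos i) (D.cast_m_pos j) hc hc'
  have := (p.rankTwoDatum b i j hc hc').altProd_apply_of_demazureLusztig hb
    (fun hm ↦ Subtype.ext (by change p.v i = p.v j; rw [v, v, hk hm])) x (by
      rw [rankTwoDatum_A, rankTwoDatum_B, ← map_altProd, ← map_altProd]
      exact hx)
  change altProd (linToAdd _ (p.sigma b i)) (linToAdd _ (p.sigma b j)) m x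
    = altProd (linToAdd _ (p.sigma b j)) (linToAdd _ (p.sigma b i)) m x at this
  rw [← map_altProd, ← map_altProd] at this
  exact this

end Parameters

end Braid

section Braid

variable {ι E F : Type*} [NormedAddCommGroup E] [InnerProductSpace ℝ E]
  [AddCommGroup F] [Module ℝ F] {R : RootPairing ι ℝ E F} [R.IsCrystallographic]
  (b : R.Base) {D : MetaplecticDatum R} (p : Parameters D)

theorem exists_reflectionPerm_eq {i j : ι} (hij : R.pairingIn ℤ i j = -1)
    (hji : R.pairingIn ℤ j i = -1) : R.reflectionPerm j (R.reflectionPerm i j) = i := by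
  refine R.root.injective ?_
  have aij : R.toLinearMap (R.root i) (R.coroot j) = (R.pairingIn ℤ i j : ℝ) :=
    (R.algebraMap_pairingIn ℤ i j).symm
  have aji : R.toLinearMap (R.root j) (R.coroot i) = (R.pairingIn ℤ j i : ℝ) :=
    (R.algebraMap_pairingIn ℤ j i).symm
  have ajj : R.toLinearMap (R.root j) (R.coroot j) = 2 := by simp
  rw [R.root_reflectionPerm, R.root_reflectionPerm, R.reflection_apply, R.reflection_apply,
    RootPairing.coroot', RootPairing.coroot']
  simp only [LinearMap.flip_apply, map_sub, map_smul, aij, aji, ajj, hij, hji, smul_eq_mul]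
  push_cast
  module

theorem norm_root_eq (hR : IsEuclidean R) {i j : ι} (hij : R.pairingIn ℤ i j = -1)
    (hji : R.pairingIn ℤ j i = -1) : ‖R.root i‖ = ‖R.root j‖ := by
  have aij : R.toLinearMap (R.root i) (R.coroot j) = (R.pairingIn ℤ i j : ℝ) :=
    (R.algebraMap_pairingIn ℤ i j).symm
  have aji : R.toLinearMap (R.root j) (R.coroot i) = (R.pairingIn ℤ j i : ℝ) :=
    (R.algebraMap_pairingIn ℤ j i).symm
  rw [hR, hij] at aij
  rw [hR, hji, real_inner_comm] at aji
  have hi : ⟪R.root i, R.root i⟫_ℝ ≠ 0 := fun h ↦ by rw [h] at aji; simp at aji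
  have hj : ⟪R.root j, R.root j⟫_ℝ ≠ 0 := fun h ↦ by rw [h] at aij; simp at aij
  rw [div_eq_iff hj] at aij
  rw [div_eq_iff hi] at aji
  push_cast at aij aji
  have : ⟪R.root i, R.root i⟫_ℝ = ⟪R.root j, R.root j⟫_ℝ := by linarith
  rw [real_inner_self_eq_norm_sq, real_inner_self_eq_norm_sq] at this
  exact (sq_eq_sq₀ (norm_nonneg _) (norm_nonneg _)).mp this

include b in
theorem MetaplecticDatum.IsSmall.smul [Finite ι] [R.IsReduced] {lam : weightLattice R}
    (h : D.IsSmall lam) (w : W R) : D.IsSmall (w • lam) := by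
  induction w using weylGroup_induction b with
  | one => rwa [one_smul]
  | mul i w hw => rw [mul_smul]; exact hw.ofIdx_smul i

theorem MetaplecticDatum.qRoot_reflectionPerm (D : MetaplecticDatum R) (i j : ι) :
    D.qRoot (R.reflectionPerm i j) = D.qRoot j := by
  rw [qRoot, qRoot, ← ofIdx_smul_rootP, D.Q_smul]

namespace Parameters

/-- Roots joined by a single bond are conjugate, s_j s_i α_j = α_i, so invariance equates k, m and
Q. The size is defined by norms; equality of the norms is where the scalar product of E enters. -/
theorem scalar_eq (hR : IsEuclidean R) {i j : ι} (hij : R.pairingIn ℤ i j = -1)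
    (hji : R.pairingIn ℤ j i = -1) : p.k i = p.k j ∧ p.scalar i = p.scalar j := by
  have hp := exists_reflectionPerm_eq hij hji
  have hk : p.k i = p.k j := by rw [← hp, p.k_reflectionPerm, p.k_reflectionPerm]
  have hm : D.m i = D.m j := by rw [← hp, D.m_reflectionPerm, D.m_reflectionPerm]
  have hq : D.qRoot i = D.qRoot j := by rw [← hp, D.qRoot_reflectionPerm, D.qRoot_reflectionPerm]
  have hn : ‖(D.rootM i : E)‖ = ‖(D.rootM j : E)‖ := by
    change ‖D.m i • R.root i‖ = ‖D.m j • R.root j‖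
    rw [hm, ← Nat.cast_smul_eq_nsmul ℝ, ← Nat.cast_smul_eq_nsmul ℝ, norm_smul, norm_smul,
      norm_root_eq hR hij hji]
  have hs : D.size i = D.size j := by rw [MetaplecticDatum.size, MetaplecticDatum.size, hn]
  refine ⟨hk, ?_⟩
  funext c
  rw [scalar, scalar, hk, hm, hq, hs]

theorem altProd_sigma_mul (i j : b.support) (n : ℕ) {f : CP R} (hf : f ∈ C R D.Pm) (x : CP R) :
    altProd (p.sigma b i) (p.sigma b j) n (f * x)
      = (altProd (simpleReflection b i) (simpleReflection b j) n • f)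
        * altProd (p.sigma b i) (p.sigma b j) n x := by
  induction n generalizing i j with
  | zero => simp [altProd]
  | succ n ih =>
    rw [altProd, Module.End.mul_apply, ih, p.sigma_mul b i (smul_mem_C R _ _ hf), altProd, mul_smul,
      Module.End.mul_apply]

variable [Finite ι] [R.IsReduced] [R.IsRootSystem]

/-- The vectors at which the braid relation holds for the operators of two simple reflections. -/
def braidLocus (i j : b.support) (m : ℕ) : Submodule ℂ (CP R) :=
  LinearMap.eqLocus (altProd (p.sigma b i) (p.sigma b j) m) (altProd (p.sigma b j) (p.sigma b i) m)

variable {b p} {i j : b.support} {m : ℕ}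

omit [Finite ι] [R.IsReduced] [R.IsRootSystem] in
theorem mem_braidLocus {x : CP R} : x ∈ p.braidLocus b i j m ↔
    altProd (p.sigma b i) (p.sigma b j) m x = altProd (p.sigma b j) (p.sigma b i) m x := Iff.rfl

omit [Finite ι] [R.IsReduced] [R.IsRootSystem] in
theorem braidLocus_comm : p.braidLocus b i j m = p.braidLocus b j i m :=
  Submodule.ext fun _ ↦ eq_comm

omit [R.IsRootSystem] in
theorem mul_mem_braidLocus (h : IsBond (-R.pairingIn ℤ j i) (-R.pairingIn ℤ i j) m) {f x : CP R}
    (hf : f ∈ C R D.Pm) (hx : x ∈ p.braidLocus b i j m) : f * x ∈ p.braidLocus b i j m := by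
  rw [mem_braidLocus] at hx ⊢
  rw [altProd_sigma_mul _ _ _ _ _ hf, altProd_sigma_mul _ _ _ _ _ hf, hx,
    altProd_simpleReflection_eq b h]

/-- The locus contains σ_i(x^{μ+δ}) = f x^{μ+δ} - g x^{s_iμ+δ}, with f and g in ℂ(P^m) and g ≠ 0.
Since it is a ℂ(P^m)-subspace, the equation can be solved for x^{s_iμ+δ}. -/
theorem X_smul_mem_braidLocus (h : IsBond (-R.pairingIn ℤ j i) (-R.pairingIn ℤ i j) m)
    {mu : weightLattice R} (hx : X R (mu + D.shift b) ∈ p.braidLocus b i j m) :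
    X R (simpleReflection b i • mu + D.shift b) ∈ p.braidLocus b i j m := by
  have h1 : p.sigma b i (X R (mu + D.shift b)) ∈ p.braidLocus b i j m :=
    h.altProd_apply (p.sigma_sigma b i) (p.sigma_sigma b j) hx
  have hy : X R (D.rootM i) ∈ C R D.Pm := X_mem_C R (D.rootM_mem_Pm i)
  have hv := p.v_mem (i : ι)
  have hden := p.one_sub_v_mul_ne_zero i (D.rootM_ne_zero i)
  have hden' := one_sub_X_ne_zero (D.rootM_ne_zero i)
  rw [sigma_X_add_shift] at h1
  set f := (1 - p.v i) * X R (D.rootM i) ^ (((D.m i : ℤ) - 1 - pair R mu i) / D.m i)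
          / (1 - p.v i * X R (D.rootM i)) with hf
  set g := p.v i * p.gam i (pair R mu i + 1 - D.m i) * (1 - X R (D.rootM i))
          / (1 - p.v i * X R (D.rootM i)) with hg
  have hfm : f ∈ C R D.Pm := div_mem (mul_mem (sub_mem (one_mem _) hv) (zpow_mem hy _))
      (sub_mem (one_mem _) (mul_mem hv hy))
  have hgm : g ∈ C R D.Pm := div_mem (mul_mem (mul_mem hv (p.gam_mem _ _))
      (sub_mem (one_mem _) hy)) (sub_mem (one_mem _) (mul_mem hv hy))
  have hg0 : g ≠ 0 :=
    div_ne_zero (mul_ne_zero (mul_ne_zero (p.v_ne_zero i) (p.gam_ne_zero _ _)) hden') hden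
  have h2 := mul_mem_braidLocus h (inv_mem hgm)
    (sub_mem (mul_mem_braidLocus h hfm hx) h1)
  rwa [sub_sub_cancel, inv_mul_cancel_left₀ hg0] at h2

theorem X_mem_braidLocus_iff (h : IsBond (-R.pairingIn ℤ j i) (-R.pairingIn ℤ i j) m)
    {w : W R} (hw : w ∈ Subgroup.closure {simpleReflection b i, simpleReflection b j})
    (mu : weightLattice R) : X R (w • mu + D.shift b) ∈ p.braidLocus b i j m ↔
      X R (mu + D.shift b) ∈ p.braidLocus b i j m := by
  induction hw using Subgroup.closure_induction generalizing mu with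
  | mem w hw =>
    rcases hw with rfl | rfl
    · refine ⟨fun h1 ↦ ?_, X_smul_mem_braidLocus h⟩
      simpa using X_smul_mem_braidLocus h h1
    · rw [braidLocus_comm]
      refine ⟨fun h1 ↦ ?_, X_smul_mem_braidLocus h.symm⟩
      simpa using X_smul_mem_braidLocus h.symm h1
  | one => rw [one_smul]
  | mul u w _ _ hu hw => rw [mul_smul, hu, hw]
  | inv w _ hw => rw [← hw, smul_inv_smul]

/-- Both words of Demazure-Lusztig operators send x^{μ+δ} to a multiple of the same monomial, by the
braid relation in W, and the multiples agree by `IsBond.chainProd_eq`. -/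
theorem X_mem_braidLocus_of_isSmall (hR : IsEuclidean R)
    (h : IsBond (-R.pairingIn ℤ j i) (-R.pairingIn ℤ i j) m) {mu : weightLattice R}
    (hmu : D.IsSmall mu) (hi : 0 ≤ pair R mu i) (hj : 0 ≤ pair R mu j) :
    X R (mu + D.shift b) ∈ p.braidLocus b i j m := by
  have h3 : m = 3 → p.k i = p.k j ∧ p.scalar i = p.scalar j := by
    rintro rfl
    refine p.scalar_eq hR ?_ ?_
    all_goals
      generalize h1 : -R.pairingIn ℤ j i = c at h
      generalize h2 : -R.pairingIn ℤ i j = c' at h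
      cases h
      omega
  refine p.altProd_sigma_apply b h (fun hm ↦ (h3 hm).1) _ ?_
  refine (h.altProd_eq_iff (fun f : Module.End ℂ (CP R) ↦ f (X R (mu + D.shift b)))).mpr ?_
  have hi' : (0 : ℝ) ≤ pair R mu i := by exact_mod_cast hi
  have hj' : (0 : ℝ) ≤ pair R mu j := by exact_mod_cast hj
  have hw : altProdRev (simpleReflection b i) (simpleReflection b j) m
      = altProdRev (simpleReflection b j) (simpleReflection b i) m :=
    (h.altProd_eq_iff id).mp (altProd_simpleReflection_eq b h)
  rw [p.altProdRev_demLus_X b m i j hmu (h.symm.chainNonneg hi' hj'),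
    p.altProdRev_demLus_X b m j i hmu (h.chainNonneg hj' hi'), hw,
    h.symm.chainProd_eq (fun hm ↦ (h3 hm).2)]

theorem altProd_sigma_eq (hR : IsEuclidean R)
    (h : IsBond (-R.pairingIn ℤ j i) (-R.pairingIn ℤ i j) m) :
    altProd (p.sigma b i) (p.sigma b j) m = altProd (p.sigma b j) (p.sigma b i) m := by
  have hX : ∀ mu : weightLattice R, X R (mu + D.shift b) ∈ p.braidLocus b i j m := by
    intro mu
    obtain ⟨nu, hnu, hsmall⟩ := D.exists_isSmall_add mu
    obtain ⟨w, hw, hi, hj⟩ := exists_mem_closure_pair_nonneg b i j (mu + nu)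
    have h1 := (X_mem_braidLocus_iff (p := p) h hw _).mp
      -- Smallness is W-invariant, so moving μ+ν to a weight nonnegative at both coroots does not
      -- destroy it.
      (X_mem_braidLocus_of_isSmall hR h (hsmall.smul b w) hi hj)
    have h2 := mul_mem_braidLocus h (X_mem_C R (neg_mem hnu)) h1
    rw [← X_add] at h2
    convert h2 using 2
    module
  refine LinearMap.ext fun x ↦ ?_
  refine C_induction D ⊤ (p := fun x ↦ x ∈ p.braidLocus b i j m) (fun f hf lam _ ↦ ?_)
    (fun x y hx hy ↦ add_mem hx hy) (x := x) (by rw [C_top]; trivial)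
  have := hX (lam - D.shift b)
  rw [sub_add_cancel] at this
  exact mul_mem_braidLocus h (C_mono R inf_le_right hf) this

end Parameters

end Braid

/-! ### Nonvanishing of the quadratic form at the roots -/

section Nondegenerate

variable {ι E F : Type*} [Finite ι] [NormedAddCommGroup E] [InnerProductSpace ℝ E]
  [AddCommGroup F] [Module ℝ F] {R : RootPairing ι ℝ E F} [R.IsRootSystem] [R.IsCrystallographic]

omit [Finite ι] [R.IsCrystallographic] in
theorem eq_zero_of_smul_eq {lam : weightLattice R} (h : ∀ w : W R, w • lam = lam) : lam = 0 := by
  refine Subtype.ext (R.toLinearMap.toPerfPair.injective (LinearMap.ext fun y ↦ ?_))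
  have hy : y ∈ Submodule.span ℝ (Set.range R.coroot) := by
    rw [RootPairing.IsRootSystem.span_coroot_eq_top]; trivial
  induction hy using Submodule.span_induction with
  | mem y hy =>
    obtain ⟨i, rfl⟩ := hy
    have h1 : (RootPairing.weylGroup.ofIdx R i : W R) • (lam : E) = lam :=
      congrArg Subtype.val (h (RootPairing.weylGroup.ofIdx R i))
    rw [ofIdx_smul, sub_eq_self, smul_eq_zero] at h1
    have h2 := h1.resolve_right (R.ne_zero i)
    rw [ZeroMemClass.coe_zero, map_zero]
    exact h2
  | zero => simp
  | add x y _ _ hx hy => rw [map_add, map_add, hx, hy]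
  | smul c y _ hy => rw [map_smul, map_smul, hy]

-- The sum of the orbit of λ over W is invariant, hence zero, so -|W|λ is the sum of the elements wλ
-- - λ of the root lattice.
variable (R) in
theorem exists_nsmul_mem_rootLattice :
    ∃ N : ℕ, 0 < N ∧ ∀ lam : weightLattice R, N • lam ∈ rootLattice R := by
  classical
  have := Fintype.ofFinite (W R)
  refine ⟨Fintype.card (W R), Fintype.card_pos, fun lam ↦ ?_⟩
  have h0 : ∑ w : W R, w • lam = 0 := by
    refine eq_zero_of_smul_eq fun u ↦ ?_
    rw [Finset.smul_sum]
    simp only [← mul_smul]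
    exact Fintype.sum_equiv (Equiv.mulLeft u) _ _ fun _ ↦ rfl
  have h1 : ∑ w : W R, (w • lam - lam) = -(Fintype.card (W R) • lam) := by
    rw [Finset.sum_sub_distrib, h0, Finset.sum_const, Finset.card_univ, zero_sub]
  rw [← neg_neg (Fintype.card (W R) • lam), ← h1]
  exact neg_mem (sum_mem fun w _ ↦ smul_sub_mem_rootLattice R w lam)

/-- A nonzero invariant quadratic form does not vanish at the roots of an irreducible root
system. -/
theorem MetaplecticDatum.qRoot_ne_zero [R.IsIrreducible] (D : MetaplecticDatum R) (i : ι) :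
    D.qRoot i ≠ 0 := fun hi ↦ by
  -- Roots with Q = 0 pair to zero with all other roots, so their span is stable under every
  -- reflection; irreducibility makes it everything.
  set S : Set ι := {j | D.qRoot j = 0}
  have hS : ∀ j ∈ S, ∀ k ∉ S, R.pairingIn ℤ j k = 0 := by
    intro j hj k hk
    have h := D.qRoot_mul_pairingIn j k
    rw [show D.qRoot j = 0 from hj, zero_mul, eq_comm, mul_eq_zero] at h
    exact h.resolve_left hk
  have htop : Submodule.span ℝ (R.root '' S) = ⊤ := by
    refine RootPairing.IsIrreducible.eq_top_of_invtSubmodule_reflection (P := R) _ (fun k ↦ ?_)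
      fun h ↦ ?_
    · rw [Module.End.mem_invtSubmodule, Submodule.span_le]
      rintro _ ⟨j, hj, rfl⟩
      change R.reflection k (R.root j) ∈ Submodule.span ℝ (R.root '' S)
      rw [R.reflection_apply]
      refine sub_mem (Submodule.subset_span ⟨j, hj, rfl⟩) ?_
      by_cases hk : k ∈ S
      · exact Submodule.smul_mem _ _ (Submodule.subset_span ⟨k, hk, rfl⟩)
      · have h1 : R.coroot' k (R.root j) = (R.pairingIn ℤ j k : ℝ) :=
          (R.algebraMap_pairingIn ℤ j k).symm
        rw [h1, hS j hj k hk, Int.cast_zero, zero_smul]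
        exact zero_mem _
    · have h1 : R.root i ∈ Submodule.span ℝ (R.root '' S) := Submodule.subset_span ⟨i, hi, rfl⟩
      rw [h, Submodule.mem_bot] at h1
      exact R.ne_zero i h1
  have hall : ∀ k, D.qRoot k = 0 := by
    intro k
    by_contra hk
    have h1 : Submodule.span ℝ (R.root '' S) ≤ LinearMap.ker (R.coroot' k) := by
      rw [Submodule.span_le]
      rintro _ ⟨j, hj, rfl⟩
      have h1 : R.coroot' k (R.root j) = (R.pairingIn ℤ j k : ℝ) :=
        (R.algebraMap_pairingIn ℤ j k).symm
      rw [SetLike.mem_coe, LinearMap.mem_ker, h1, hS j hj k hk, Int.cast_zero]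
    rw [htop] at h1
    have h2 : R.coroot' k (R.root k) = 0 := h1 (Submodule.mem_top (x := R.root k))
    rw [RootPairing.root_coroot'_eq_pairing, RootPairing.pairing_same] at h2
    norm_num at h2
  have hB : ∀ lam, ∀ mu ∈ rootLattice R, D.B lam mu = 0 := by
    intro lam mu hmu
    induction hmu using AddSubgroup.closure_induction with
    | mem mu hmu =>
      obtain ⟨k, rfl⟩ := hmu
      rw [D.B_rootP, hall, Int.cast_zero, zero_mul]
    | zero => exact QuadraticMap.polar_zero_right D.Q lam
    | add x y _ _ hx hy =>
      exact (QuadraticMap.polar_add_right D.Q lam x y).trans (by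
        change D.B lam x + D.B lam y = 0
        rw [hx, hy, add_zero])
    | neg x _ hx => exact (QuadraticMap.polar_neg_right D.Q lam x).trans (neg_eq_zero.mpr hx)
  -- As B vanishes on P × Q and Nλ lies in the root lattice, 0 = B(λ,Nλ) = 2N Q(λ). This contradicts
  -- that the form is nonzero.
  obtain ⟨N, hN, hmem⟩ := exists_nsmul_mem_rootLattice R
  refine D.Q_ne_zero (QuadraticMap.ext fun lam ↦ ?_)
  have h1 := hB lam _ (hmem lam)
  rw [MetaplecticDatum.B, ← natCast_zsmul, QuadraticMap.polar_smul_right_of_tower,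
    QuadraticMap.polar_self] at h1
  simpa [hN.ne'] using h1

end Nondegenerate

/-! ### Restriction of a representation to a stable subspace -/

section Restriction

variable {A V M : Type*} [Semiring A] [Algebra ℂ A] [AddCommGroup V] [Module ℂ V]
  [AddCommGroup M] [Module ℂ M] (σ : A →ₐ[ℂ] Module.End ℂ V) {i : M →ₗ[ℂ] V}
  (hi : Function.Injective i) (h : ∀ a x, σ a (i x) ∈ LinearMap.range i)

/-- The restriction of a linear map to a stable subspace. -/
def restrictLin (a : A) : Module.End ℂ M :=
  (LinearEquiv.ofInjective i hi).symm.toLinearMap ∘ₗ (σ a ∘ₗ i).codRestrict (LinearMap.range i)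
      (h a)

theorem restrictLin_apply (a : A) (x : M) : i (restrictLin σ hi h a x) = σ a (i x) :=
  congrArg Subtype.val ((LinearEquiv.ofInjective i hi).apply_symm_apply ⟨σ a (i x), h a x⟩)

/-- The restriction of a representation of an algebra to a stable subspace. -/
def restrictEnd : A →ₐ[ℂ] Module.End ℂ M where
  toFun := restrictLin σ hi h
  map_one' := LinearMap.ext fun x ↦ hi (by simp [restrictLin_apply])
  map_mul' a c := LinearMap.ext fun x ↦ hi (by simp [restrictLin_apply])
  map_zero' := LinearMap.ext fun x ↦ hi (by simp [restrictLin_apply])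
  map_add' a c := LinearMap.ext fun x ↦ hi (by simp [restrictLin_apply])
  commutes' c := LinearMap.ext fun x ↦ hi (by simp [restrictLin_apply,
      Algebra.algebraMap_eq_smul_one])

theorem restrictEnd_apply (a : A) (x : M) : i (restrictEnd σ hi h a x) = σ a (i x) :=
  restrictLin_apply σ hi h a x

end Restriction

/-! ### The metaplectic representation, its restrictions and the Chinta-Gunnells action -/

section Representation

variable {ι E F : Type*} [Finite ι] [NormedAddCommGroup E] [InnerProductSpace ℝ E]
  [AddCommGroup F] [Module ℝ F] {R : RootPairing ι ℝ E F} [R.IsRootSystem] [R.IsCrystallographic]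
  [R.IsReduced] (b : R.Base) {D : MetaplecticDatum R} (p : Parameters D)

omit [R.IsRootSystem] in
include b in
theorem weylGroup_hom_ext {G : Type*} [Monoid G] {φ ψ : W R →* G}
    (h : ∀ i, φ (simpleReflection b i) = ψ (simpleReflection b i)) : φ = ψ := by
  refine MonoidHom.ext fun w ↦ ?_
  induction w using weylGroup_induction b with
  | one => rw [map_one, map_one]
  | mul i w hw => rw [map_mul, map_mul, h, hw]

omit [Finite ι] [R.IsRootSystem] [R.IsCrystallographic] [R.IsReduced] in
theorem single_eq_mul (L : AddSubgroup (weightLattice R)) [IsWStable R L] (w : W R) (f : C R L) :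
    (SkewMonoidAlgebra.single w f : Semidirect R L) = ofC R L f * ofW R L w := by
  change _ = SkewMonoidAlgebra.single 1 f * SkewMonoidAlgebra.single w 1
  rw [SkewMonoidAlgebra.single_mul_single, one_mul, smul_one, mul_one]

omit [R.IsRootSystem] in
include b in
theorem semidirect_hom_ext {L : AddSubgroup (weightLattice R)} [IsWStable R L] {A : Type*}
    [Semiring A] [Algebra ℂ A] {σ τ : Semidirect R L →ₐ[ℂ] A}
    (hW : ∀ i, σ (ofW R L (simpleReflection b i)) = τ (ofW R L (simpleReflection b i)))
    (hC : ∀ f, σ (ofC R L f) = τ (ofC R L f)) : σ = τ := by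
  have h : ((σ : Semidirect R L →* A).comp (ofW R L)) = (τ : Semidirect R L →* A).comp (ofW R L) :=
    weylGroup_hom_ext b hW
  refine AlgHom.ext fun Y ↦ ?_
  induction Y using SkewMonoidAlgebra.induction_on with
  | zero => rw [map_zero, map_zero]
  | single w f =>
    rw [single_eq_mul, map_mul, map_mul, hC]
    exact congrArg _ (DFunLike.congr_fun h w)
  | add f g hf hg => rw [map_add, map_add, hf, hg]

omit [Finite ι] [R.IsRootSystem] [R.IsCrystallographic] [R.IsReduced] in
theorem semidirectInclusion_single {L M : AddSubgroup (weightLattice R)} [IsWStable R L]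
    [IsWStable R M] (h : L ≤ M) (w : W R) (f : C R L) :
    semidirectInclusion R h (SkewMonoidAlgebra.single w f)
      = ofC R M (IntermediateField.inclusion (C_mono R h) f) * ofW R M w :=
  SkewMonoidAlgebra.liftNC_single _ _ _ _

omit [Finite ι] [R.IsRootSystem] [R.IsCrystallographic] [R.IsReduced] in
theorem semidirectInclusion_ofW {L M : AddSubgroup (weightLattice R)} [IsWStable R L]
    [IsWStable R M] (h : L ≤ M) (w : W R) : semidirectInclusion R h (ofW R L w) = ofW R M w := by
  change semidirectInclusion R h (SkewMonoidAlgebra.single w 1) = _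
  rw [semidirectInclusion_single, map_one, map_one, one_mul]

omit [Finite ι] [R.IsRootSystem] [R.IsCrystallographic] [R.IsReduced] in
theorem semidirectInclusion_ofC {L M : AddSubgroup (weightLattice R)} [IsWStable R L]
    [IsWStable R M] (h : L ≤ M) (f : C R L) : semidirectInclusion R h (ofC R L f)
      = ofC R M (IntermediateField.inclusion (C_mono R h) f) := by
  change semidirectInclusion R h (SkewMonoidAlgebra.single 1 f) = _
  rw [semidirectInclusion_single, map_one, mul_one]

omit [Finite ι] [R.IsRootSystem] [R.IsReduced] in
theorem CP_hom_ext (D : MetaplecticDatum R) {f g : Module.End ℂ (CP R)}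
    (h : ∀ (u : C R D.Pm) (lam : weightLattice R),
      f ((u : CP R) * X R lam) = g ((u : CP R) * X R lam)) : f = g := by
  refine LinearMap.ext fun x ↦ C_induction D ⊤ (p := fun x ↦ f x = g x) (fun u hu lam _ ↦ ?_)
    (fun x y hx hy ↦ by rw [map_add, map_add, hx, hy]) (by rw [C_top]; trivial)
  exact h ⟨u, C_mono R inf_le_right hu⟩ lam

omit [Finite ι] [R.IsRootSystem] [R.IsReduced] in
theorem C_hom_ext (D : MetaplecticDatum R) {L : AddSubgroup (weightLattice R)}
    [Fact (rootLattice R ≤ L)] {f g : Module.End ℂ (C R L)}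
    (h : ∀ (u : C R (L ⊓ D.Pm)) (lam : L), f (D.mulX L u lam) = g (D.mulX L u lam)) : f = g := by
  refine LinearMap.ext fun x ↦ ?_
  have key : ∀ hx : (x : CP R) ∈ C R L, f ⟨x, hx⟩ = g ⟨x, hx⟩ := by
    intro hx
    have := C_induction D L (p := fun x ↦ ∃ hx : x ∈ C R L, f ⟨x, hx⟩ = g ⟨x, hx⟩)
      (fun u hu lam hlam ↦ ⟨_, h ⟨u, hu⟩ ⟨lam, hlam⟩⟩)
      (fun x y ⟨hx, hfx⟩ ⟨hy, hfy⟩ ↦ ⟨add_mem hx hy, by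
        change f (⟨x, hx⟩ + ⟨y, hy⟩) = g (⟨x, hx⟩ + ⟨y, hy⟩)
        rw [map_add, map_add, hfx, hfy]⟩) hx
    exact this.2
  exact key x.2

namespace Parameters

theorem exists_sigmaHom (hR : IsEuclidean R) :
    ∃ φ : W R →* Module.End ℂ (CP R), ∀ i, φ (simpleReflection b i) = p.sigma b i :=
  exists_monoidHom_weylGroup b (fun i ↦ LinearMap.ext (p.sigma_sigma b i))
    fun _ _ _ _ h ↦ altProd_sigma_eq hR h

/-- The metaplectic representation of `W` on `ℂ(P)`. -/
def sigmaHom (hR : IsEuclidean R) : W R →* Module.End ℂ (CP R) := (p.exists_sigmaHom b hR).choose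

theorem sigmaHom_simpleReflection (hR : IsEuclidean R) (i : b.support) :
    p.sigmaHom b hR (simpleReflection b i) = p.sigma b i := (p.exists_sigmaHom b hR).choose_spec i

theorem sigmaHom_mul (hR : IsEuclidean R) (w : W R) {f : CP R} (hf : f ∈ C R D.Pm) (x : CP R) :
    p.sigmaHom b hR w (f * x) = (w • f) * p.sigmaHom b hR w x := by
  induction w using weylGroup_induction b with
  | one => simp
  | mul i w hw =>
    rw [map_mul (p.sigmaHom b hR), Module.End.mul_apply, hw, sigmaHom_simpleReflection,
      p.sigma_mul b i (smul_mem_C R _ w hf), mul_smul, Module.End.mul_apply]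

/-- The metaplectic representation of `W ⋉ ℂ(P^m)` on `ℂ(P)`. -/
def sigmaAlgHom (hR : IsEuclidean R) : Semidirect R D.Pm →ₐ[ℂ] Module.End ℂ (CP R) :=
  SkewMonoidAlgebra.liftNCAlgHom ((Algebra.lmul ℂ (CP R)).comp (C R D.Pm).val) (p.sigmaHom b hR) (by
    intro f w
    exact LinearMap.ext fun x ↦ (p.sigmaHom_mul b hR w f.2 x).symm)

theorem sigmaAlgHom_single (hR : IsEuclidean R) (w : W R) (f : C R D.Pm) (x : CP R) :
    p.sigmaAlgHom b hR (SkewMonoidAlgebra.single w f) x = (f : CP R) * p.sigmaHom b hR w x :=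
  DFunLike.congr_fun (SkewMonoidAlgebra.liftNC_single _ _ _ _) x

theorem sigmaAlgHom_ofW (hR : IsEuclidean R) (w : W R) :
    p.sigmaAlgHom b hR (ofW R D.Pm w) = p.sigmaHom b hR w :=
  LinearMap.ext fun x ↦ (p.sigmaAlgHom_single b hR w 1 x).trans (one_mul _)

theorem sigmaAlgHom_ofC (hR : IsEuclidean R) (f : C R D.Pm) (x : CP R) :
    p.sigmaAlgHom b hR (ofC R D.Pm f) x = (f : CP R) * x := by
  refine (p.sigmaAlgHom_single b hR 1 f x).trans ?_
  rw [map_one, Module.End.one_apply]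

theorem isSigma_sigmaAlgHom (hR : IsEuclidean R) : D.IsSigma b p (p.sigmaAlgHom b hR) := by
  refine ⟨fun i f lam ↦ ?_, fun g f lam ↦ ?_⟩
  · rw [sigmaAlgHom_ofW, sigmaHom_simpleReflection, p.sigma_mul_X b i f.2]
  · rw [sigmaAlgHom_ofC, mul_assoc]

variable {b p} in
theorem eq_of_isSigma {σ τ : Semidirect R D.Pm →ₐ[ℂ] Module.End ℂ (CP R)} (hσ : D.IsSigma b p σ)
    (hτ : D.IsSigma b p τ) : σ = τ :=
  semidirect_hom_ext b (fun i ↦ CP_hom_ext D fun u lam ↦ by rw [hσ.1, hτ.1])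
    fun g ↦ CP_hom_ext D fun u lam ↦ by rw [hσ.2, hτ.2]

variable (L : AddSubgroup (weightLattice R)) [Fact (rootLattice R ≤ L)]

-- The coefficients in the formula involve only complex numbers and monomials of the root lattice,
-- which is contained in L, and L is W-stable.
omit [Finite ι] [R.IsReduced] in
theorem sigma_mem_C (i : b.support) {x : CP R} (hx : x ∈ C R L) : p.sigma b i x ∈ C R L := by
  refine C_induction D L (p := fun x ↦ p.sigma b i x ∈ C R L) (fun f hf lam hlam ↦ ?_)
    (fun x y hx hy ↦ by rw [map_add]; exact add_mem hx hy) hx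
  have hal : rootP R (i : ι) ∈ L := rootP_mem L _
  have hM : D.rootM (i : ι) ∈ L := (D.rootM_mem L _).1
  have hv : p.v i ∈ C R L := algebraMap_mem_C _ _
  have hg : ∀ c, p.gam i c ∈ C R L := fun c ↦ algebraMap_mem_C _ _
  rw [p.sigma_mul_X b i (C_mono R inf_le_right hf), sigmaFormula_eq_coeff]
  refine mul_mem (smul_mem_C R L _ (C_mono R inf_le_left hf)) (mul_mem (div_mem (add_mem
    (mul_mem (sub_mem (one_mem _) hv) (X_mem_C R (zsmul_mem hal _))) (mul_mem (mul_mem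
      (mul_mem hv (hg _)) (sub_mem (one_mem _) (X_mem_C R (neg_mem hM)))) (X_mem_C R hal)))
    (sub_mem (one_mem _) (mul_mem hv (X_mem_C R hM)))) (X_mem_C R ?_))
  exact IsWStable.smul_mem _ _ hlam

theorem sigmaHom_mem_C (hR : IsEuclidean R) (w : W R) {x : CP R} (hx : x ∈ C R L) :
    p.sigmaHom b hR w x ∈ C R L := by
  induction w using weylGroup_induction b with
  | one => rwa [map_one]
  | mul i w hw =>
    rw [map_mul, sigmaHom_simpleReflection]
    exact p.sigma_mem_C b L i hw

theorem sigmaAlgHom_mem_C (hR : IsEuclidean R) (Y : Semidirect R (L ⊓ D.Pm)) {x : CP R}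
    (hx : x ∈ C R L) :
    p.sigmaAlgHom b hR (semidirectInclusion R inf_le_right Y) x ∈ C R L := by
  induction Y using SkewMonoidAlgebra.induction_on with
  | zero => rw [map_zero, map_zero]; exact zero_mem _
  | single w f =>
    rw [semidirectInclusion_single, map_mul, Module.End.mul_apply, sigmaAlgHom_ofC,
      sigmaAlgHom_ofW]
    exact mul_mem (C_mono R inf_le_left f.2) (p.sigmaHom_mem_C b L hR w hx)
  | add f g hf hg => rw [map_add, map_add]; exact add_mem hf hg

/-- The restriction of the metaplectic representation to `ℂ(L)`. -/
def sigmaAlgHomOn (hR : IsEuclidean R) :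
    Semidirect R (L ⊓ D.Pm) →ₐ[ℂ] Module.End ℂ (C R L) :=
  restrictEnd ((p.sigmaAlgHom b hR).comp (semidirectInclusion R inf_le_right))
    (i := (C R L).val.toLinearMap) Subtype.val_injective
    fun Y x ↦ ⟨⟨_, p.sigmaAlgHom_mem_C b L hR Y x.2⟩, rfl⟩

theorem coe_sigmaAlgHomOn (hR : IsEuclidean R) (Y : Semidirect R (L ⊓ D.Pm)) (x : C R L) :
    (p.sigmaAlgHomOn b L hR Y x : CP R)
      = p.sigmaAlgHom b hR (semidirectInclusion R inf_le_right Y) x :=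
  restrictEnd_apply _ (i := (C R L).val.toLinearMap) _ _ Y x

theorem isSigmaOn_sigmaAlgHomOn (hR : IsEuclidean R) :
    D.IsSigmaOn b L p (p.sigmaAlgHomOn b L hR) := by
  have h := p.isSigma_sigmaAlgHom b hR
  refine ⟨fun i f lam ↦ ?_, fun g f lam ↦ ?_⟩
  · rw [coe_sigmaAlgHomOn, semidirectInclusion_ofW]
    exact h.1 i (IntermediateField.inclusion (C_mono R inf_le_right) f) lam
  · rw [coe_sigmaAlgHomOn, semidirectInclusion_ofC]
    exact h.2 (IntermediateField.inclusion (C_mono R inf_le_right) g)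
      (IntermediateField.inclusion (C_mono R inf_le_right) f) lam

variable {b p L} in
theorem eq_of_isSigmaOn {σ τ : Semidirect R (L ⊓ D.Pm) →ₐ[ℂ] Module.End ℂ (C R L)}
    (hσ : D.IsSigmaOn b L p σ) (hτ : D.IsSigmaOn b L p τ) : σ = τ :=
  semidirect_hom_ext b
    (fun i ↦ C_hom_ext D fun u lam ↦ Subtype.ext (by rw [hσ.1, hτ.1]))
    fun g ↦ C_hom_ext D fun u lam ↦ Subtype.ext (by rw [hσ.2, hτ.2])

omit [R.IsRootSystem] in
variable {b L} in
theorem eq_of_isChintaGunnells {v : ℂˣ} {g : ℤ → ℂˣ} {τ τ' : Representation ℂ (W R) (C R L)}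
    (h : D.IsChintaGunnells b L v g τ) (h' : D.IsChintaGunnells b L v g τ') : τ = τ' :=
  weylGroup_hom_ext b fun i ↦ C_hom_ext D fun u lam ↦ Subtype.ext (by rw [h, h'])

-- The first terms agree since Q(α_i) ≠ 0 gives B(λ,α_i)/Q(α_i) = (λ,α_i^∨). The second terms agree,
-- with the change of sign, because (1 - x^{-mα}) x^α = -x^{(1-m)α}(1 - x^{mα}).
omit [R.IsReduced] in
theorem sigmaFormula_eq_chintaGunnellsFormula [R.IsIrreducible] {k : ℂˣ} {g : ℤ → ℂˣ}
    (hk : ∀ i, p.k i = k) (hg : ∀ j y, p.g j y = g j) (i : b.support) (f : CP R)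
    (lam : weightLattice R) :
    D.sigmaFormula b p i f lam = D.chintaGunnellsFormula b (k ^ 2) g i f lam := by
  have hq : (D.qRoot i : ℚ) ≠ 0 := by exact_mod_cast D.qRoot_ne_zero (i : ι)
  have h1 : ⌊-(D.B lam (rootP R i) / D.Q (rootP R i))⌋ = -pair R lam i := by
    rw [D.B_rootP, ← D.cast_qRoot, mul_div_cancel_left₀ _ hq]
    exact_mod_cast Int.floor_intCast (R := ℚ) (-pair R lam i)
  have hv : algebraMap ℂ (CP R) ((k ^ 2 : ℂˣ) : ℂ) = p.v i := by rw [v, hk]; simp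
  have hy0 := X_ne_zero (D.rootM (i : ι))
  have h2 : X R ((1 - (D.m i : ℤ)) • rootP R (i : ι)) = X R (rootP R i) / X R (D.rootM i) := by
    rw [← X_sub, MetaplecticDatum.rootM]
    congr 1
    module
  rw [sigmaFormula_eq_coeff, coeff, MetaplecticDatum.chintaGunnellsFormula]
  rw [h1, hv, h2, D.floor_sub_B, X_neg, gam, hg]
  have hden := p.one_sub_v_mul_ne_zero i (D.rootM_ne_zero i)
  field_simp
  ring

theorem isChintaGunnells_sigmaAlgHomOn [R.IsIrreducible] (hR : IsEuclidean R) {k : ℂˣ} {g : ℤ → ℂˣ}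
    (hk : ∀ i, p.k i = k) (hg : ∀ j y, p.g j y = g j) :
    D.IsChintaGunnells b L (k ^ 2) g
      ((p.sigmaAlgHomOn b L hR : Semidirect R (L ⊓ D.Pm) →* Module.End ℂ (C R L)).comp
        (ofW R (L ⊓ D.Pm))) := fun i f lam ↦
  ((p.isSigmaOn_sigmaAlgHomOn b L hR).1 i f lam).trans
    (p.sigmaFormula_eq_chintaGunnellsFormula b hk hg i f lam)

end Parameters

end Representation

end Metaplectic

end

theorem mainTheorem3 {ι E F : Type*} [Finite ι] [NormedAddCommGroup E] [InnerProductSpace ℝ E]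
    [AddCommGroup F] [Module ℝ F] (R : RootPairing ι ℝ E F)
    [R.IsRootSystem] [R.IsCrystallographic] [R.IsReduced] [R.IsIrreducible]
    (hR : IsEuclidean R) (b : R.Base) (D : MetaplecticDatum R) :
    (∀ p : Parameters D,
      ∃ σ : Semidirect R D.Pm →ₐ[ℂ] Module.End ℂ (CP R),
        (D.IsSigma b p σ ∧ ∀ σ', D.IsSigma b p σ' → σ' = σ) ∧
        ∀ (L : AddSubgroup (weightLattice R))
          [Fact (rootLattice R ≤ L)],
          (∀ (Y : Semidirect R (L ⊓ D.Pm)) (h : CP R),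
            h ∈ C R L →
            σ (semidirectInclusion R inf_le_right Y) h ∈ C R L) ∧
          ∃ σL : Semidirect R (L ⊓ D.Pm) →ₐ[ℂ] Module.End ℂ (C R L),
            (∀ (Y : Semidirect R (L ⊓ D.Pm)) (h : C R L),
              (σL Y h : CP R)
                = σ (semidirectInclusion R inf_le_right Y) (h : CP R)) ∧
            (D.IsSigmaOn b L p σL ∧ ∀ σ', D.IsSigmaOn b L p σ' → σ' = σL) ∧
            ∀ (k : ℂˣ) (g : ℤ → ℂˣ), (∀ i, p.k i = k) → (∀ j y, p.g j y = g j) →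
              D.IsChintaGunnells b L (k ^ 2) g
                ((σL : Semidirect R (L ⊓ D.Pm) →*
                  Module.End ℂ (C R L)).comp (ofW R (L ⊓ D.Pm))) ∧
              ∀ τ, D.IsChintaGunnells b L (k ^ 2) g τ →
                τ = (σL : Semidirect R (L ⊓ D.Pm) →*
                  Module.End ℂ (C R L)).comp (ofW R (L ⊓ D.Pm))) ∧
    ∀ (v : ℂˣ) (g : ℤ → ℂˣ),
      (∀ j : ℤ, (D.n : ℤ) ∣ j → g j = -1) → (∀ j : ℤ, g j = g (j % D.n)) →
      (∀ j : ℤ, ¬ (D.n : ℤ) ∣ j → g j * g (D.n - j) = v⁻¹) →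
      ∀ (L : AddSubgroup (weightLattice R)) [Fact (rootLattice R ≤ L)],
        ∃! τ : Representation ℂ (W R) (C R L),
          D.IsChintaGunnells b L v g τ := by
  refine ⟨fun p ↦
    ⟨p.sigmaAlgHom b hR, ⟨p.isSigma_sigmaAlgHom b hR,
      fun _ h ↦ Parameters.eq_of_isSigma h (p.isSigma_sigmaAlgHom b hR)⟩, fun L _ ↦
      ⟨fun Y _ ↦ p.sigmaAlgHom_mem_C b L hR Y, p.sigmaAlgHomOn b L hR,
        p.coe_sigmaAlgHomOn b L hR, ⟨p.isSigmaOn_sigmaAlgHomOn b L hR,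
          fun _ h ↦ Parameters.eq_of_isSigmaOn h (p.isSigmaOn_sigmaAlgHomOn b L hR)⟩,
        fun k g hk hg ↦ ⟨p.isChintaGunnells_sigmaAlgHomOn b L hR hk hg, fun _ h ↦
          Parameters.eq_of_isChintaGunnells h (p.isChintaGunnells_sigmaAlgHomOn b L hR hk hg)⟩⟩⟩,
              fun v g hg1 hg2 hg3 L _ ↦ ?_⟩
  -- A square root of v, taken as a constant k together with g independent of the length, gives
  -- parameters for which the metaplectic representation is the required action.
  obtain ⟨k, hk⟩ : ∃ k : ℂˣ, k ^ 2 = v := by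
    obtain ⟨z, hz⟩ := IsAlgClosed.exists_pow_nat_eq (v : ℂ) (n := 2) (by norm_num)
    have hz0 : z ≠ 0 := by
      rintro rfl
      exact v.ne_zero (by rw [← hz]; norm_num)
    exact ⟨Units.mk0 z hz0, Units.ext hz⟩
  let p : Parameters D :=
    { k := fun _ ↦ k
      k_reflectionPerm := fun _ _ ↦ rfl
      g := fun j _ ↦ g j
      g_of_dvd := fun j _ h ↦ hg1 j h
      g_mod := fun j _ ↦ hg2 j
      g_mul := fun j _ h ↦ by rw [hg3 j h, hk] }
  have h := p.isChintaGunnells_sigmaAlgHomOn b L hR (k := k) (g := g) (fun _ ↦ rfl) fun _ _ ↦ rfl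
  rw [hk] at h
  exact ⟨_, h, fun _ h' ↦ Parameters.eq_of_isChintaGunnells h' h⟩
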